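/- Let $n\ge 3$ and $2\le k\le n$ be integers, and let $(\overline M,g)$ be a smooth compact $n$-dimensional Riemannian manifold with (possibly empty) boundary and interior $M$. For a function $v$ put \[ \mathcal W[v]=g^{-1}\Big(\nabla^2v-dv\otimes dv+\Big(\frac{\Delta v}{n-2}+|\nabla v|^2\Big)g-\frac{\mathrm{Ric}_g}{n-2}\Big), \] and for an endomorphism $A$ with real eigenvalues $\lambda_1,\dots,\lambda_n$ let $\sigma_j(A)$ be the $j$-th elementary symmetric function of $\lambda_1,\dots,\lambda_n$. A $C^2$ function $v$ is called $(k-1)$-admissible if $\sigma_j(\mathcal W[v])>0$ at every point for $j=1,\dots,k-1$. Let $B_s(x_0)$ denote the open ball of radius $s$ about $x_0$ for the Riemannian distance of $\overline M$. For all constants $r_1>0$, $a>0$, $K$, $A$, $A_0$ there is a constant $C$, depending only on $(\overline M,g)$, $n$, $k$, $r_1$, $K$, $A$, $A_0$, $a$, such that the following holds. Let $r\ge r_1$, let $x_0\in\overline M$ be such that $B_r=B_r(x_0)\subset M$, let $\alpha,\alpha_0\in C^2(B_r)$, and let $v\in C^4(B_r)$ be a $(k-1)$-admissible solution of \[ \sigma_k\big((n-2)e^{-2v}\mathcal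 W[v]\big)+\alpha(x)\,\sigma_{k-1}\big((n-2)e^{-2v}\mathcal W[v]\big)=\alpha_0(x)\qquad\text{in }B_r \] with $\|v\|_{C^1(B_r)}\le K$, $\|\alpha\|_{C^2(B_r)}\le A$, $\|\alpha_0\|_{C^2(B_r)}\le A_0$ and $\inf_{B_r}\alpha_0\ge a$. Then \[ \sup_{B_{r/2}(x_0)}|\nabla^2v|\le C . \] In other words, $C$ depends on $v$, $\alpha$, $\alpha_0$ and the ball only through bounds for $r^{-1}$, $\|v\|_{C^1(B_r)}$, $\|\alpha\|_{C^2(B_r)}$, $\|\alpha_0\|_{C^2(B_r)}$ and $(\inf_{B_r}\alpha_0)^{-1}$. -/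

import Mathlib

open Bundle Set
open scoped Manifold ContDiff ENNReal

noncomputable section

namespace KRicci

/-! ### Tensor calculus in coordinates

`G` is a field of symmetric positive definite matrices on (an open subset of) `ℝⁿ`, the matrix
`g_{ij}` of a Riemannian metric in a coordinate system. -/

/-- The partial derivative `∂_i f` at `y`. -/
def pd {n : ℕ} (i : Fin n) (f : EuclideanSpace ℝ (Fin n) → ℝ) (y : EuclideanSpace ℝ (Fin n)) : ℝ :=
  fderiv ℝ f y (EuclideanSpace.single i 1)

/-- The Christoffel symbol
`Γ^m_{ij} = ½ ∑_l g^{ml} (∂_i g_{jl} + ∂_j g_{il} - ∂_l g_{ij})`. -/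
def christoffel {n : ℕ} (G : EuclideanSpace ℝ (Fin n) → Matrix (Fin n) (Fin n) ℝ)
    (m i j : Fin n) (y : EuclideanSpace ℝ (Fin n)) : ℝ :=
  (1 / 2 : ℝ) * ∑ l, (G y)⁻¹ m l *
    (pd i (fun z => G z j l) y + pd j (fun z => G z i l) y - pd l (fun z => G z i j) y)

/-- The Ricci tensor
`R_{ij} = ∂_l Γ^l_{ij} - ∂_j Γ^l_{il} + Γ^l_{ij} Γ^m_{lm} - Γ^m_{il} Γ^l_{jm}`
(positive on round spheres). -/
def coordRicci {n : ℕ} (G : EuclideanSpace ℝ (Fin n) → Matrix (Fin n) (Fin n) ℝ)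
    (y : EuclideanSpace ℝ (Fin n)) : Matrix (Fin n) (Fin n) ℝ :=
  Matrix.of fun i j =>
    ∑ l, (pd l (christoffel G l i j) y - pd j (christoffel G l i l) y)
      + ∑ l, ∑ m, (christoffel G l i j y * christoffel G m l m y
          - christoffel G m i l y * christoffel G l j m y)

/-- The Hessian `∇_{ij} f = ∂_i ∂_j f - Γ^m_{ij} ∂_m f`. -/
def coordHessian {n : ℕ} (G : EuclideanSpace ℝ (Fin n) → Matrix (Fin n) (Fin n) ℝ)
    (f : EuclideanSpace ℝ (Fin n) → ℝ) (y : EuclideanSpace ℝ (Fin n)) :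
    Matrix (Fin n) (Fin n) ℝ :=
  Matrix.of fun i j => pd i (pd j f) y - ∑ m, christoffel G m i j y * pd m f y

/-! ### Elementary symmetric functions of the eigenvalues -/

/-- `σ_k(A) = σ_k(λ(A))`: the `k`-th elementary symmetric function of the eigenvalues of `A`
(the roots of its characteristic polynomial, with multiplicity). It is used for matrices
`g⁻¹ S` with `g` positive definite and `S` symmetric, whose `n` eigenvalues are all real. -/
def sigma {n : ℕ} (k : ℕ) (A : Matrix (Fin n) (Fin n) ℝ) : ℝ :=
  A.charpoly.roots.esymm k

/-- `λ(A) ∈ Γ_k`: the eigenvalues of `A` lie in Gårding's cone. -/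
def InGardingCone {n : ℕ} (k : ℕ) (A : Matrix (Fin n) (Fin n) ℝ) : Prop :=
  ∀ j : ℕ, 1 ≤ j → j ≤ k → 0 < sigma j A

/-! ### Riemannian manifolds

All tensors at `p` are given by their components in the preferred chart at `p`. They are used
at interior points of `M` only, so that derivatives in the chart are ordinary ones. -/

section Manifold

variable {n : ℕ} {H : Type*} [TopologicalSpace H]
  (I : ModelWithCorners ℝ (EuclideanSpace ℝ (Fin n)) H)
  {M : Type*} [TopologicalSpace M] [ChartedSpace H M]

/-- The coordinate vector field `∂_i` of the chart at `p`, at the point with coordinates `y`. -/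
def coordField (p : M) (i : Fin n) (y : EuclideanSpace ℝ (Fin n)) :
    TangentSpace I ((extChartAt I p).symm y) :=
  mfderivWithin 𝓘(ℝ, EuclideanSpace ℝ (Fin n)) I (extChartAt I p).symm (range I) y
    (EuclideanSpace.single i (1 : ℝ) : EuclideanSpace ℝ (Fin n))

/-- A function on `M` read in the chart at `p`. -/
def inChart (p : M) (f : M → ℝ) : EuclideanSpace ℝ (Fin n) → ℝ :=
  fun y => f ((extChartAt I p).symm y)

/-- The differential `∂_i f` at `p`, in the chart at `p`. -/
def diffAt (f : M → ℝ) (p : M) : Fin n → ℝ :=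
  fun i => pd i (inChart I p f) (extChartAt I p p)

variable [RiemannianBundle (fun x : M => TangentSpace I x)]

/-- The matrix `g_{ij} = ⟨∂_i, ∂_j⟩` of the metric in the chart at `p`. -/
def chartMetric (p : M) : EuclideanSpace ℝ (Fin n) → Matrix (Fin n) (Fin n) ℝ :=
  fun y => Matrix.of fun i j => inner ℝ (coordField I p i y) (coordField I p j y)

/-- `g_{ij}` at `p`. -/
def metricAt (p : M) : Matrix (Fin n) (Fin n) ℝ := chartMetric I p (extChartAt I p p)

/-- The Ricci tensor at `p`. -/
def ricciAt (p : M) : Matrix (Fin n) (Fin n) ℝ :=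
  coordRicci (chartMetric I p) (extChartAt I p p)

/-- The Hessian `∇²f` at `p`. -/
def hessAt (f : M → ℝ) (p : M) : Matrix (Fin n) (Fin n) ℝ :=
  coordHessian (chartMetric I p) (inChart I p f) (extChartAt I p p)

/-- The Laplacian `Δf = g^{ij} ∇_{ij} f` at `p`. -/
def laplacianAt (f : M → ℝ) (p : M) : ℝ := ((metricAt I p)⁻¹ * hessAt I f p).trace

/-- `|∇f|² = g^{ij} ∂_i f ∂_j f` at `p`. -/
def gradSq (f : M → ℝ) (p : M) : ℝ :=
  ∑ i, ∑ j, (metricAt I p)⁻¹ i j * diffAt I f p i * diffAt I f p j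

/-- `|∇f|` at `p`. -/
def gradNorm (f : M → ℝ) (p : M) : ℝ := √(gradSq I f p)

/-- `|∇²f| = (g^{ia} g^{jb} ∇_{ij} f ∇_{ab} f)^{1/2}` at `p`. -/
def hessNorm (f : M → ℝ) (p : M) : ℝ :=
  √(∑ i, ∑ j, ∑ a, ∑ b,
    (metricAt I p)⁻¹ i a * (metricAt I p)⁻¹ j b * hessAt I f p i j * hessAt I f p a b)

/-- `‖f‖_{C¹(s)} = sup_s |f| + sup_s |∇f|`, possibly infinite. -/
def normC1 (s : Set M) (f : M → ℝ) : ℝ≥0∞ :=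
  (⨆ p ∈ s, ENNReal.ofReal |f p|) + ⨆ p ∈ s, ENNReal.ofReal (gradNorm I f p)

/-- `‖f‖_{C²(s)} = sup_s |f| + sup_s |∇f| + sup_s |∇²f|`, possibly infinite. -/
def normC2 (s : Set M) (f : M → ℝ) : ℝ≥0∞ :=
  normC1 I s f + ⨆ p ∈ s, ENNReal.ofReal (hessNorm I f p)

/-- The matrix at `p` of the `(1,1)`-tensor
`𝒲[v] = g⁻¹ (∇²v - dv ⊗ dv + (Δv / (n - 2) + |∇v|²) g - Ric_g / (n - 2))`. -/
def calW (v : M → ℝ) (p : M) : Matrix (Fin n) (Fin n) ℝ :=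
  (metricAt I p)⁻¹ *
    (hessAt I v p - Matrix.vecMulVec (diffAt I v p) (diffAt I v p)
      + (laplacianAt I v p / ((n : ℝ) - 2) + gradSq I v p) • metricAt I p
      - ((n : ℝ) - 2)⁻¹ • ricciAt I p)

/-- `v` is `j`-admissible on `s`: `λ(𝒲[v]) ∈ Γ_j` at every point of `s`. -/
def IsAdmissibleOn (j : ℕ) (s : Set M) (v : M → ℝ) : Prop :=
  ∀ p ∈ s, InGardingCone j (calW I v p)

/-- `v` solves
`σ_k((n-2) e^{-2v} 𝒲[v]) + α σ_{k-1}((n-2) e^{-2v} 𝒲[v]) = α₀` on `s`. -/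
def IsSolutionOn (k : ℕ) (α α₀ : M → ℝ) (s : Set M) (v : M → ℝ) : Prop :=
  ∀ p ∈ s,
    sigma k ((((n : ℝ) - 2) * Real.exp (-2 * v p)) • calW I v p)
      + α p * sigma (k - 1) ((((n : ℝ) - 2) * Real.exp (-2 * v p)) • calW I v p) = α₀ p

end Manifold

end KRicci

end

open scoped Matrix Topology

/-! Put m = k - 1 and let M be the matrix of g𝒲[v] in a g-orthonormal frame. Dividing the equation
by σ_m(M) > 0 turns it into F(M, t) = -β, where F(M, t) = (σ_{m+1}(M) - t^{m+1}) / σ_m(M), t =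
α₀^{1/(m+1)} e^{2v}/(n-2) and β = α e^{2v}/(n-2). The sign of α plays no role.

Concavity. F is homogeneous of degree one and superadditive on Γ_m × (0, ∞) (`quotOp_superadd`): the
quotients σ_{j+1}/σ_j are superadditive (`es_quot_superadd`), σ_m is a product of such quotients,
and Mahler's inequality then makes t^{m+1}/σ_m subadditive. Averaging over permutations carries this
to symmetric matrices. So at each point F has a supergradient (P, q) with P ≥ 0, q ≤ 0, tr P ≥ c₀ >
0 and |q| ≤ tr P (`exists_matrix_supergradient`).

Barrier. Fix the supergradient at the point x. Then Φ = (tr(P M) + q t + β) / tr P is nonnegative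
near x and zero at x. It is a quasilinear expression in v whose coefficients are bounded, thanks to
the division by tr P. The summand Δv/(n-2) g of 𝒲 adds g⁻¹/(n-2) to its leading coefficients L, so L
is uniformly elliptic even if P is degenerate (`exists_barrier`). In place of the twice
differentiated equation one uses ∂Φ = 0 and ∂²Φ ≥ 0 at x.

Maximum principle. Since |M|² = σ₁² - 2σ₂, the Hessian is bounded by a multiple of 1 + w, with w a
trace of D²v (`exists_cone_bound`). Where D²v is large, Z = D²v + N w γ is therefore positive
semidefinite for a suitable N. Now 2Z is the derivative of u² = |D²v|² + N w² in D²v, so Z : ∂²Φ ≥ 0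
controls the fourth derivatives of v in L : ∂²(u²), while ellipticity yields a positive multiple of
|D³v|² that absorbs the third derivatives. Hence a function ϖ² touching u² from above satisfies L :
∂²(ϖ²) ≥ -C (1 + |D²v|)³ (`second_order_inequality`). At a maximum of χ² (u + N' |Dv|²) the function
ϖ contains -N' |Dv|², which contributes a negative cubic term, and a large N' makes it win
(`interior_hessian_estimate`).

Globalisation. Tensors at p are given in the preferred chart at p, so their transformation rules are
needed to work in one fixed chart near a point q. Each q then has a neighbourhood with its own
constant, and compactness leaves finitely many. The ball enters only through r₁. -/

namespace KRicci

/-! ### Real-rooted polynomials -/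

open Polynomial in
/-- Laguerre's inequality `P P'' ≤ P'²` for real-rooted polynomials. -/
theorem splits_eval_mul_derivative_le (P : ℝ[X]) (hP : P.Splits) (x : ℝ) :
    P.eval x * P.derivative.derivative.eval x ≤ (P.derivative.eval x) ^ 2 := by
  rw [hP.eq_prod_roots]
  generalize P.roots = s
  generalize P.leadingCoeff = c
  have key : (s.map fun a => X - C a).prod.eval x
      * (s.map fun a => X - C a).prod.derivative.derivative.eval x
      ≤ ((s.map fun a => X - C a).prod.derivative.eval x) ^ 2 := by
    induction s using Multiset.induction with
    | empty => simp
    | cons a s ih =>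
      simp only [Multiset.map_cons, Multiset.prod_cons, derivative_mul, derivative_sub,
        derivative_X, derivative_C, sub_zero, one_mul, derivative_add, eval_add, eval_mul,
        eval_sub, eval_X, eval_C]
      -- For P = (X - a) Q one has P'² - P P'' = Q² + (x - a)² (Q'² - Q Q'').
      nlinarith [mul_nonneg (sq_nonneg (x - a)) (sub_nonneg.2 ih),
        sq_nonneg (eval x (s.map fun a => X - C a).prod)]
  simp only [derivative_mul, derivative_C, zero_mul, zero_add, eval_mul, eval_C]
  nlinarith [mul_nonneg (sq_nonneg c) (sub_nonneg.2 key)]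

-- Rolle's theorem with multiplicities: differentiation loses at most one root, and the degree drops
-- as well.
open Polynomial in
theorem splits_derivative (P : ℝ[X]) (hP : P.Splits) : P.derivative.Splits := by
  by_cases h0 : P.derivative = 0
  · rw [h0]; exact Splits.zero
  rw [splits_iff_card_roots] at hP ⊢
  have h1 := card_roots_le_derivative P
  have h2 := P.derivative.card_roots'
  have h3 := natDegree_derivative_lt (p := P) (fun h => h0 (derivative_of_natDegree_zero h))
  omega

open Polynomial in
theorem splits_iterate_derivative (P : ℝ[X]) (hP : P.Splits) (j : ℕ) :
    (derivative^[j] P).Splits := by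
  induction j with
  | zero => exact hP
  | succ j ih => rw [Function.iterate_succ_apply']; exact splits_derivative _ ih

/-! ### Elementary symmetric functions and superadditivity of their quotients -/

section Esymm

variable {ι : Type*}

/-- The elementary symmetric function of the variables `x i`, `i ∈ s`. -/
noncomputable def es (s : Finset ι) (k : ℕ) (x : ι → ℝ) : ℝ :=
  ∑ t ∈ s.powersetCard k, ∏ i ∈ t, x i

@[simp] theorem es_zero (s : Finset ι) (x : ι → ℝ) : es s 0 x = 1 := by simp [es]

theorem es_eq_zero {s : Finset ι} {k : ℕ} (h : s.card < k) (x : ι → ℝ) : es s k x = 0 := by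
  simp [es, Finset.powersetCard_eq_empty.2 h]

theorem es_one (s : Finset ι) (x : ι → ℝ) : es s 1 x = ∑ i ∈ s, x i := by
  simp [es, Finset.powersetCard_one]

theorem es_insert [DecidableEq ι] {s : Finset ι} {a : ι} (ha : a ∉ s) (k : ℕ) (x : ι → ℝ) :
    es (insert a s) (k + 1) x = es s (k + 1) x + x a * es s k x := by
  unfold es
  rw [Finset.powersetCard_succ_insert ha, Finset.sum_union, Finset.mul_sum]
  · congr 1
    rw [Finset.sum_image]
    · refine Finset.sum_congr rfl fun t ht => ?_
      rw [Finset.prod_insert]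
      exact fun h => ha ((Finset.mem_powersetCard.1 ht).1 h)
    · intro t ht t' ht' h
      have h1 : a ∉ t := fun h => ha ((Finset.mem_powersetCard.1 ht).1 h)
      have h2 : a ∉ t' := fun h => ha ((Finset.mem_powersetCard.1 ht').1 h)
      rw [← Finset.erase_insert h1, ← Finset.erase_insert h2]
      exact congrArg (fun u => Finset.erase u a) h
  · rw [Finset.disjoint_left]
    intro t ht ht'
    obtain ⟨u, -, rfl⟩ := Finset.mem_image.1 ht'
    exact ha ((Finset.mem_powersetCard.1 ht).1 (Finset.mem_insert_self _ _))

theorem es_erase [DecidableEq ι] {s : Finset ι} {a : ι} (ha : a ∈ s) (k : ℕ) (x : ι → ℝ) :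
    es s (k + 1) x = es (s.erase a) (k + 1) x + x a * es (s.erase a) k x := by
  conv_lhs => rw [← Finset.insert_erase ha]
  exact es_insert (Finset.notMem_erase a s) k x

theorem es_smul (s : Finset ι) (k : ℕ) (c : ℝ) (x : ι → ℝ) :
    es s k (c • x) = c ^ k * es s k x := by
  unfold es
  rw [Finset.mul_sum]
  refine Finset.sum_congr rfl fun t ht => ?_
  simp [Finset.prod_mul_distrib, (Finset.mem_powersetCard.1 ht).2]

theorem es_perm [Fintype ι] (k : ℕ) (e : Equiv.Perm ι) (x : ι → ℝ) :
    es Finset.univ k (x ∘ e) = es Finset.univ k x := by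
  have h := Finset.esymm_map_val (R := ℝ) x Finset.univ k
  have h' := Finset.esymm_map_val (R := ℝ) (x ∘ e) Finset.univ k
  unfold es
  rw [← h, ← h', ← Multiset.map_map]
  congr 2
  exact congrArg Finset.val (Finset.map_univ_equiv e)

theorem es_differentiable [Fintype ι] (s : Finset ι) (k : ℕ) : Differentiable ℝ (es s k) := by
  have h : es s k = fun x : ι → ℝ => ∑ t ∈ s.powersetCard k, ∏ i ∈ t, x i := rfl
  rw [h]
  refine Differentiable.fun_sum fun t _ => ?_
  exact (contDiff_prod (𝕜 := ℝ) (n := 1) fun i _ => contDiff_apply ℝ ℝ i).differentiable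
    one_ne_zero

/-- Euler's identity. -/
theorem sum_mul_es_erase [DecidableEq ι] (s : Finset ι) (k : ℕ) (x : ι → ℝ) :
    ∑ i ∈ s, x i * es (s.erase i) k x = (k + 1) * es s (k + 1) x := by
  induction s using Finset.induction_on generalizing k with
  | empty => rw [es_eq_zero (by simp)]; simp
  | insert a s ha ih =>
    rw [Finset.sum_insert ha, Finset.erase_insert ha]
    have h1 : ∀ i ∈ s, (insert a s).erase i = insert a (s.erase i) := fun i hi =>
      Finset.erase_insert_of_ne (fun h => ha (h ▸ hi))
    have h2 : ∀ i ∈ s, a ∉ s.erase i := fun i _ h => ha (Finset.mem_of_mem_erase h)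
    cases k with
    | zero =>
      simp only [es_zero, mul_one, zero_add, es_one, Finset.sum_insert ha]
      simp
    | succ k =>
      have h3 : ∀ i ∈ s, x i * es ((insert a s).erase i) (k + 1) x
          = x i * es (s.erase i) (k + 1) x + x a * (x i * es (s.erase i) k x) := by
        intro i hi
        rw [h1 i hi, es_insert (h2 i hi)]; ring
      rw [Finset.sum_congr rfl h3, Finset.sum_add_distrib, ← Finset.mul_sum, ih, ih,
        es_insert ha]
      push_cast; ring

open Polynomial in
/-- The weak form of Newton's inequalities. -/
theorem es_newton (s : Finset ι) (j : ℕ) (x : ι → ℝ) :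
    es s (j + 2) x * es s j x ≤ es s (j + 1) x ^ 2 := by
  by_cases hj : s.card < j + 2
  · rw [es_eq_zero hj]; simpa using sq_nonneg _
  by_cases hneg : es s (j + 2) x * es s j x ≤ 0
  · exact hneg.trans (sq_nonneg _)
  push Not at hj hneg
  set P : ℝ[X] := ∏ i ∈ s, (X + C (x i)) with hPdef
  have hP : P.Splits := Splits.prod fun i _ => Splits.X_add_C _
  obtain ⟨m, hm⟩ := Nat.exists_eq_add_of_le hj
  have hc : ∀ i ≤ s.card, P.coeff i = es s (s.card - i) x := fun i hi =>
    Finset.prod_X_add_C_coeff s x hi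
  -- With m = |s| - (j + 2), the derivatives of P of orders m, m + 1, m + 2 at 0 are, up to
  -- factorials, σ_{j+2}, σ_{j+1}, σ_j.
  have key := splits_eval_mul_derivative_le _ (splits_iterate_derivative P hP m) 0
  rw [← Function.iterate_succ_apply' derivative m P,
    ← Function.iterate_succ_apply' derivative (m + 1) P] at key
  simp only [← coeff_zero_eq_eval_zero, coeff_iterate_derivative, zero_add] at key
  rw [hc m (by omega), hc (m + 1) (by omega), hc (m + 1 + 1) (by omega),
    show s.card - m = j + 2 by omega, show s.card - (m + 1) = j + 1 by omega,
    show s.card - (m + 1 + 1) = j by omega] at key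
  simp only [Nat.descFactorial_self, nsmul_eq_mul, Nat.factorial_succ, Nat.cast_mul] at key
  have hf : (0 : ℝ) < m.factorial := by exact_mod_cast m.factorial_pos
  set A := es s (j + 2) x
  set B := es s (j + 1) x
  set D := es s j x
  push_cast at key
  have h1 : ((m : ℝ) + 1 + 1) * (A * D) ≤ (m + 1) * B ^ 2 := by
    have : ((m : ℝ) + 1) * (m.factorial : ℝ) ^ 2 * (((m : ℝ) + 1 + 1) * (A * D))
        ≤ ((m : ℝ) + 1) * (m.factorial : ℝ) ^ 2 * ((m + 1) * B ^ 2) := by nlinarith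
    exact le_of_mul_le_mul_left this (by positivity)
  -- The better factor m + 2 is given up, which is allowed because A * D > 0 in this case.
  have h2 : ((m : ℝ) + 1) * (A * D) ≤ (m + 1) * B ^ 2 := by nlinarith
  exact le_of_mul_le_mul_left h2 (by positivity)

/-- Gårding's cone `Γ_m` in the variables `x i`, `i ∈ s`. -/
def Gam (s : Finset ι) (m : ℕ) (x : ι → ℝ) : Prop := ∀ j ≤ m, 0 < es s j x

theorem Gam.mono {s : Finset ι} {m l : ℕ} {x : ι → ℝ} (h : Gam s m x) (hl : l ≤ m) :
    Gam s l x := fun j hj => h j (hj.trans hl)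

/-- Let b, a, c be σ_m, σ_{m+1}, σ_{m+2} of the remaining variables and suppose a ≤ 0 < b.
Positivity of a + x_i b forces x_i > 0, and positivity of c + x_i a gives c > -x_i a. Then c b > -a
x_i b ≥ a², against Newton's inequality. -/
theorem Gam.erase [DecidableEq ι] {s : Finset ι} {m : ℕ} {x : ι → ℝ} (h : Gam s (m + 1) x) {i : ι} (hi : i ∈ s) :
    Gam (s.erase i) m x := by
  induction m with
  | zero =>
    intro j hj
    obtain rfl : j = 0 := by omega
    simp
  | succ m ih =>
    have ih' := ih (h.mono (by omega))
    intro j hj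
    rcases hj.lt_or_eq with hj | rfl
    · exact ih' j (by omega)
    by_contra hneg
    push Not at hneg
    have h1 := h (m + 1 + 1) le_rfl
    have h2 := h (m + 1) (by omega)
    rw [es_erase hi] at h1 h2
    have h3 := ih' m le_rfl
    have hN := es_newton (s.erase i) m x
    set a := es (s.erase i) (m + 1) x
    set b := es (s.erase i) m x
    set c := es (s.erase i) (m + 1 + 1) x
    have hx : 0 < x i := by
      by_contra hx
      push Not at hx
      nlinarith [mul_nonneg (neg_nonneg.2 hx) h3.le]
    have hc : 0 < c := by nlinarith [mul_nonneg hx.le (neg_nonneg.2 hneg)]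
    have : c * b ≤ a ^ 2 := hN
    nlinarith [mul_pos hc h3, mul_pos h3 hx, mul_nonneg hx.le (neg_nonneg.2 hneg),
      mul_nonneg (neg_nonneg.2 hneg) h2.le, mul_pos h1 h3]

theorem div_add_sq_le {a b u w : ℝ} (hu : 0 < u) (hw : 0 < w) :
    (a + b) ^ 2 / (u + w) ≤ a ^ 2 / u + b ^ 2 / w := by
  rw [div_add_div _ _ hu.ne' hw.ne', div_le_div_iff₀ (by positivity) (by positivity)]
  nlinarith [sq_nonneg (a * w - b * u)]

/-- Euler's identity combined with the expansion of σ_{k+1} along each x_i. It expresses the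
quotient of order k + 1 through quotients of order k in one variable less, which is what makes an
induction on k possible. -/
theorem es_quot_eq [DecidableEq ι] {s : Finset ι} {k : ℕ} {x : ι → ℝ} (h : Gam s (k + 1) x) :
    ((k : ℝ) + 2) * (es s (k + 2) x / es s (k + 1) x)
      = ∑ i ∈ s, x i - ∑ i ∈ s, x i ^ 2 / (x i + es (s.erase i) (k + 1) x / es (s.erase i) k x) := by
  have h1 : 0 < es s (k + 1) x := h _ le_rfl
  have hE := sum_mul_es_erase s (k + 1) x
  have h2 : ∀ i ∈ s, x i ^ 2 / (x i + es (s.erase i) (k + 1) x / es (s.erase i) k x)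
      = x i - x i * es (s.erase i) (k + 1) x / es s (k + 1) x := by
    intro i hi
    have h3 : 0 < es (s.erase i) k x := h.erase hi k le_rfl
    have h4 := es_erase hi k x
    rw [show x i + es (s.erase i) (k + 1) x / es (s.erase i) k x
      = es s (k + 1) x / es (s.erase i) k x by rw [h4]; field_simp; ring]
    field_simp
    rw [h4]; ring
  rw [Finset.sum_congr rfl h2, Finset.sum_sub_distrib, ← Finset.sum_div, hE]
  push_cast
  field_simp
  ring

/-- Superadditivity of `σ_{k+1}/σ_k` on `Γ_k` (Marcus–Lopes) and convexity of `Γ_k`. -/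
theorem es_quot_superadd [DecidableEq ι] (k : ℕ) : ∀ (s : Finset ι) (x y : ι → ℝ), Gam s k x → Gam s k y →
    Gam s k (x + y) ∧ es s (k + 1) x / es s k x + es s (k + 1) y / es s k y
      ≤ es s (k + 1) (x + y) / es s k (x + y) := by
  induction k with
  | zero =>
    intro s x y _ _
    refine ⟨fun j hj => ?_, ?_⟩
    · obtain rfl : j = 0 := by omega
      simp
    · simp [es_one, Finset.sum_add_distrib]
  | succ k ih =>
    intro s x y hx hy
    obtain ⟨hG, hq⟩ := ih s x y (hx.mono (by omega)) (hy.mono (by omega))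
    have hG' : Gam s (k + 1) (x + y) := by
      intro j hj
      rcases hj.lt_or_eq with hj | rfl
      · exact hG j (by omega)
      -- Superadditivity one order below also gives the convexity of the cone at the present order.
      have h1 : 0 < es s (k + 1) (x + y) / es s k (x + y) :=
        lt_of_lt_of_le (add_pos (div_pos (hx _ le_rfl) (hx _ (by omega)))
          (div_pos (hy _ le_rfl) (hy _ (by omega)))) hq
      have h2 : 0 < es s k (x + y) := hG k le_rfl
      rwa [div_pos_iff_of_pos_right h2] at h1
    refine ⟨hG', ?_⟩
    have e1 := es_quot_eq hx
    have e2 := es_quot_eq hy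
    have e3 := es_quot_eq hG'
    have hpos : ∀ z : ι → ℝ, Gam s (k + 1) z → ∀ i ∈ s,
        0 < z i + es (s.erase i) (k + 1) z / es (s.erase i) k z := by
      intro z hz i hi
      have h3 : 0 < es (s.erase i) k z := hz.erase hi k le_rfl
      rw [show z i + es (s.erase i) (k + 1) z / es (s.erase i) k z
        = es s (k + 1) z / es (s.erase i) k z by rw [es_erase hi k z]; field_simp; ring]
      exact div_pos (hz _ le_rfl) h3
    -- The map (a, u) ↦ a²/u is subadditive and decreasing in u, and the denominators are
    -- superadditive by the induction hypothesis on `s.erase i`.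
    have hsum : ∑ i ∈ s, (x + y) i ^ 2 /
          ((x + y) i + es (s.erase i) (k + 1) (x + y) / es (s.erase i) k (x + y))
        ≤ ∑ i ∈ s, x i ^ 2 / (x i + es (s.erase i) (k + 1) x / es (s.erase i) k x)
          + ∑ i ∈ s, y i ^ 2 / (y i + es (s.erase i) (k + 1) y / es (s.erase i) k y) := by
      rw [← Finset.sum_add_distrib]
      refine Finset.sum_le_sum fun i hi => ?_
      refine le_trans ?_ (div_add_sq_le (hpos x hx i hi) (hpos y hy i hi))
      have hi' := (ih (s.erase i) x y (hx.erase hi) (hy.erase hi)).2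
      refine div_le_div_of_nonneg_left (sq_nonneg _)
        (add_pos (hpos x hx i hi) (hpos y hy i hi)) ?_
      simp only [Pi.add_apply]
      linarith
    have hxy : ∑ i ∈ s, (x + y) i = ∑ i ∈ s, x i + ∑ i ∈ s, y i := by
      simp [Finset.sum_add_distrib]
    have hk : (0 : ℝ) < k + 2 := by positivity
    refine le_of_mul_le_mul_left ?_ hk
    rw [mul_add]
    show ((k : ℝ) + 2) * (es s (k + 2) x / es s (k + 1) x)
      + ((k : ℝ) + 2) * (es s (k + 2) y / es s (k + 1) y)
      ≤ ((k : ℝ) + 2) * (es s (k + 2) (x + y) / es s (k + 1) (x + y))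
    rw [e1, e2, e3, hxy]
    linarith

end Esymm

/-! ### Concavity and supergradients of (σ_{m+1} - t^{m+1}) / σ_m -/

/-- Mahler's inequality. -/
theorem add_pow_le_prod_add {N : ℕ} (hN : N ≠ 0) {b c : ℕ → ℝ} {t t' : ℝ}
    (hb : ∀ j ∈ Finset.range N, 0 < b j) (hc : ∀ j ∈ Finset.range N, 0 < c j)
    (ht : 0 < t) (ht' : 0 < t') (htb : ∏ j ∈ Finset.range N, b j = t ^ N)
    (htc : ∏ j ∈ Finset.range N, c j = t' ^ N) :
    (t + t') ^ N ≤ ∏ j ∈ Finset.range N, (b j + c j) := by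
  set B := ∏ j ∈ Finset.range N, (b j + c j) with hB
  have hBpos : 0 < B := Finset.prod_pos fun j hj => add_pos (hb j hj) (hc j hj)
  set R := B ^ ((N : ℝ)⁻¹) with hR
  have hRpos : 0 < R := Real.rpow_pos_of_pos hBpos _
  have hRN : R ^ N = B := Real.rpow_inv_natCast_pow hBpos.le hN
  have hN0 : (N : ℝ) ≠ 0 := Nat.cast_ne_zero.2 hN
  -- AM-GM for the ratios d_j / (b_j + c_j). Applied to d = b and d = c, the two arithmetic means
  -- add up to 1, so (t + t') / R ≤ 1.
  have amgm : ∀ (d : ℕ → ℝ) (u : ℝ), (∀ j ∈ Finset.range N, 0 < d j) → 0 < u →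
      ∏ j ∈ Finset.range N, d j = u ^ N →
      u / R ≤ ∑ j ∈ Finset.range N, (N : ℝ)⁻¹ * (d j / (b j + c j)) := by
    intro d u hd hu hdu
    have h := Real.geom_mean_le_arith_mean_weighted (Finset.range N) (fun _ => (N : ℝ)⁻¹)
      (fun j => d j / (b j + c j)) (fun _ _ => by positivity) (by simp [hN0])
      (fun j hj => (div_pos (hd j hj) (add_pos (hb j hj) (hc j hj))).le)
    refine le_trans (le_of_eq ?_) h
    rw [Real.finsetProd_rpow _ _
      (fun j hj => (div_pos (hd j hj) (add_pos (hb j hj) (hc j hj))).le),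
      Finset.prod_div_distrib, hdu, ← hB, Real.div_rpow (by positivity) hBpos.le, ← hR,
      Real.pow_rpow_inv_natCast hu.le hN]
  have h1 := amgm b t hb ht htb
  have h2 := amgm c t' hc ht' htc
  have h3 : ∑ j ∈ Finset.range N, (N : ℝ)⁻¹ * (b j / (b j + c j))
      + ∑ j ∈ Finset.range N, (N : ℝ)⁻¹ * (c j / (b j + c j)) = 1 := by
    rw [← Finset.sum_add_distrib]
    have : ∀ j ∈ Finset.range N, (N : ℝ)⁻¹ * (b j / (b j + c j))
        + (N : ℝ)⁻¹ * (c j / (b j + c j)) = (N : ℝ)⁻¹ := by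
      intro j hj
      have := (add_pos (hb j hj) (hc j hj)).ne'
      field_simp
    rw [Finset.sum_congr rfl this]
    simp [hN0]
  have h4 : (t + t') / R ≤ 1 := by rw [add_div]; linarith
  rw [div_le_one hRpos] at h4
  rw [← hRN]
  exact pow_le_pow_left₀ (by positivity) h4 N

section

variable {ι : Type*}

theorem prod_quot_es {s : Finset ι} {m : ℕ} {x : ι → ℝ} (hx : Gam s m x) :
    ∏ j ∈ Finset.range m, es s (j + 1) x / es s j x = es s m x := by
  induction m with
  | zero => simp
  | succ m ih =>
    rw [Finset.prod_range_succ, ih (hx.mono (by omega))]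
    have := hx m (by omega)
    field_simp

theorem prod_add_quot_es_le [DecidableEq ι] {s : Finset ι} {m : ℕ} {x y : ι → ℝ} (hx : Gam s m x)
    (hy : Gam s m y) :
    ∏ j ∈ Finset.range m, (es s (j + 1) x / es s j x + es s (j + 1) y / es s j y)
      ≤ es s m (x + y) := by
  rw [← prod_quot_es (es_quot_superadd m s x y hx hy).1]
  refine Finset.prod_le_prod (fun j hj => ?_) fun j hj => ?_
  · have hj' := Finset.mem_range.1 hj
    exact (add_pos (div_pos (hx _ (by omega)) (hx _ (by omega)))
      (div_pos (hy _ (by omega)) (hy _ (by omega)))).le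
  · have hj' := Finset.mem_range.1 hj
    exact (es_quot_superadd j s x y (hx.mono (by omega)) (hy.mono (by omega))).2

/-- Mahler's inequality with m + 1 factors: the m quotients σ_{j+1}/σ_j, whose product is σ_m, and
the extra factor t^{m+1}/σ_m, chosen so that the whole product is the perfect power t^{m+1}. -/
theorem pow_div_es_subadd [DecidableEq ι] {s : Finset ι} {m : ℕ} {x y : ι → ℝ} (hx : Gam s m x)
    (hy : Gam s m y) {t t' : ℝ} (ht : 0 < t) (ht' : 0 < t') :
    (t + t') ^ (m + 1) / es s m (x + y) ≤ t ^ (m + 1) / es s m x + t' ^ (m + 1) / es s m y := by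
  have hxm := hx m le_rfl
  have hym := hy m le_rfl
  have hxy := (es_quot_superadd m s x y hx hy).1 m le_rfl
  set b : ℕ → ℝ := fun j => if j = m then t ^ (m + 1) / es s m x else es s (j + 1) x / es s j x
    with hb
  set c : ℕ → ℝ := fun j => if j = m then t' ^ (m + 1) / es s m y else es s (j + 1) y / es s j y
    with hc
  have hb1 : ∀ j ∈ Finset.range m, b j = es s (j + 1) x / es s j x := fun j hj => by
    simp [hb, (Finset.mem_range.1 hj).ne]
  have hc1 : ∀ j ∈ Finset.range m, c j = es s (j + 1) y / es s j y := fun j hj => by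
    simp [hc, (Finset.mem_range.1 hj).ne]
  have h := add_pow_le_prod_add (N := m + 1) (b := b) (c := c) (by omega) (t := t) (t' := t') ?_ ?_
    ht ht' ?_ ?_
  · rw [Finset.prod_range_succ, Finset.prod_congr rfl fun j hj => by rw [hb1 j hj, hc1 j hj]] at h
    have h2 : b m + c m = t ^ (m + 1) / es s m x + t' ^ (m + 1) / es s m y := by simp [hb, hc]
    rw [h2] at h
    rw [div_le_iff₀ hxy, mul_comm]
    exact h.trans (mul_le_mul_of_nonneg_right (prod_add_quot_es_le hx hy) (by positivity))
  · intro j hj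
    rcases eq_or_ne j m with rfl | hj'
    · simp only [hb, if_true]; positivity
    · simp only [hb, if_neg hj']
      have := Finset.mem_range.1 hj
      exact div_pos (hx _ (by omega)) (hx _ (by omega))
  · intro j hj
    rcases eq_or_ne j m with rfl | hj'
    · simp only [hc, if_true]; positivity
    · simp only [hc, if_neg hj']
      have := Finset.mem_range.1 hj
      exact div_pos (hy _ (by omega)) (hy _ (by omega))
  · rw [Finset.prod_range_succ, Finset.prod_congr rfl hb1, prod_quot_es hx]
    simp only [hb, if_true]; field_simp
  · rw [Finset.prod_range_succ, Finset.prod_congr rfl hc1, prod_quot_es hy]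
    simp only [hc, if_true]; field_simp

theorem Gam.smul {s : Finset ι} {m : ℕ} {x : ι → ℝ} (h : Gam s m x) {c : ℝ} (hc : 0 < c) :
    Gam s m (c • x) := fun j hj => by
  rw [es_smul]; exact mul_pos (pow_pos hc j) (h j hj)

variable [Fintype ι]

/-- The operator `(σ_{m+1} - t^{m+1}) / σ_m`. -/
noncomputable def quotOp (m : ℕ) (x : ι → ℝ) (t : ℝ) : ℝ :=
  (es Finset.univ (m + 1) x - t ^ (m + 1)) / es Finset.univ m x

theorem quotOp_superadd [DecidableEq ι] {m : ℕ} {x y : ι → ℝ} (hx : Gam Finset.univ m x)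
    (hy : Gam Finset.univ m y) {t t' : ℝ} (ht : 0 < t) (ht' : 0 < t') :
    quotOp m x t + quotOp m y t' ≤ quotOp m (x + y) (t + t') := by
  have h1 := (es_quot_superadd m Finset.univ x y hx hy).2
  have h2 := pow_div_es_subadd hx hy ht ht'
  simp only [quotOp, sub_div]
  linarith

theorem quotOp_smul (m : ℕ) (x : ι → ℝ) (t : ℝ) {c : ℝ} (hc : c ≠ 0) :
    quotOp m (c • x) (c * t) = c * quotOp m x t := by
  simp only [quotOp, es_smul, mul_pow]
  rw [← mul_sub, pow_succ, mul_assoc, mul_div_mul_left _ _ (pow_ne_zero _ hc), mul_div_assoc]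

theorem quotOp_perm (m : ℕ) (e : Equiv.Perm ι) (x : ι → ℝ) (t : ℝ) :
    quotOp m (x ∘ e) t = quotOp m x t := by
  simp only [quotOp, es_perm]

theorem es_pos {x : ι → ℝ} (hx : ∀ i, 0 < x i) {j : ℕ} (hj : j ≤ Fintype.card ι) :
    0 < es Finset.univ j x := by
  refine Finset.sum_pos (fun t _ => Finset.prod_pos fun i _ => hx i) ?_
  rw [Finset.powersetCard_nonempty]
  simpa using hj

/-- A superadditive function homogeneous of degree one lies below its differential at any point,
with equality at that point. The signs and sizes of p and q are read off by evaluating this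
inequality at well chosen points. No upper bound for p holds uniformly on the cone, so q is bounded
relative to ∑ p. -/
theorem exists_supergradient [DecidableEq ι] {m : ℕ} (hm : m + 1 ≤ Fintype.card ι) :
    ∃ c₀ : ℝ, 0 < c₀ ∧ ∀ (x₀ : ι → ℝ) (t₀ : ℝ), Gam Finset.univ m x₀ → 0 < t₀ →
      ∃ (p : ι → ℝ) (q : ℝ), (∀ i, 0 ≤ p i) ∧ q ≤ 0 ∧ c₀ ≤ ∑ i, p i ∧ -q ≤ ∑ i, p i ∧
        quotOp m x₀ t₀ = ∑ i, p i * x₀ i + q * t₀ ∧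
        ∀ (y : ι → ℝ) (t : ℝ), Gam Finset.univ m y → 0 < t →
          quotOp m y t ≤ ∑ i, p i * y i + q * t := by
  have hone : ∀ j, es Finset.univ j (1 : ι → ℝ) = ((Fintype.card ι).choose j : ℝ) := by
    intro j; simp [es]
  have hch : (0 : ℝ) < ((Fintype.card ι).choose m : ℝ) := by
    exact_mod_cast Nat.choose_pos (by omega)
  have hch1 : (1 : ℝ) ≤ ((Fintype.card ι).choose (m + 1) : ℝ) := by
    exact_mod_cast Nat.choose_pos hm
  have hG1 : Gam Finset.univ m (1 : ι → ℝ) := fun j hj =>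
    es_pos (fun _ => by simp) (by omega)
  refine ⟨1 / 2 / ((Fintype.card ι).choose m : ℝ), by positivity, fun x₀ t₀ hx₀ ht₀ => ?_⟩
  set F : (ι → ℝ) × ℝ → ℝ := fun z => quotOp m z.1 z.2 with hF
  have hd : DifferentiableAt ℝ F (x₀, t₀) := by
    have h1 : ∀ k, DifferentiableAt ℝ (fun z : (ι → ℝ) × ℝ => es Finset.univ k z.1) (x₀, t₀) :=
      fun k => DifferentiableAt.comp (g := es Finset.univ k) (f := Prod.fst) (x₀, t₀)
        (es_differentiable Finset.univ k x₀)
        differentiableAt_fst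
    have h2 : DifferentiableAt ℝ (fun z : (ι → ℝ) × ℝ => (es Finset.univ m z.1)⁻¹) (x₀, t₀) :=
      DifferentiableAt.fun_inv (h1 m) (hx₀ m le_rfl).ne'
    simp only [hF, quotOp, div_eq_mul_inv]
    exact ((h1 (m + 1)).sub (differentiableAt_snd.pow (m + 1))).mul h2
  set l := fderiv ℝ F (x₀, t₀) with hl
  have hline : ∀ w : (ι → ℝ) × ℝ, HasDerivAt (fun s : ℝ => F ((x₀, t₀) + s • w)) (l w) 0 := by
    intro w
    have h1 : HasDerivAt (fun s : ℝ => (x₀, t₀) + s • w) w 0 := by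
      simpa using ((hasDerivAt_id (0 : ℝ)).smul_const w).const_add (x₀, t₀)
    have h2 : HasFDerivAt F l ((x₀, t₀) + (0 : ℝ) • w) := by simpa using hd.hasFDerivAt
    exact h2.comp_hasDerivAt (0 : ℝ) h1
  have hle : ∀ (y : ι → ℝ) (t : ℝ), Gam Finset.univ m y → 0 < t → quotOp m y t ≤ l (y, t) := by
    intro y t hy ht
    -- Superadditivity and homogeneity give F((x₀, t₀) + s (y, t)) ≥ F(x₀, t₀) + s F(y, t); divide
    -- by s and let s decrease to 0.
    have h := (hline (y, t)).tendsto_slope_zero_right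
    refine ge_of_tendsto h ?_
    filter_upwards [self_mem_nhdsWithin] with s hs
    have hs' : (0 : ℝ) < s := hs
    have h1 := quotOp_superadd hx₀ (hy.smul hs') ht₀ (mul_pos hs' ht)
    rw [quotOp_smul _ _ _ hs'.ne'] at h1
    simp only [hF, zero_add, zero_smul, add_zero, Prod.fst_add, Prod.snd_add, Prod.smul_fst,
      Prod.smul_snd, smul_eq_mul]
    rw [le_inv_mul_iff₀ hs']
    linarith
  have heq : quotOp m x₀ t₀ = l (x₀, t₀) := by
    have h := hline (x₀, t₀)
    have h' : HasDerivAt (fun s : ℝ => (1 + s) * quotOp m x₀ t₀) (quotOp m x₀ t₀) 0 := by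
      simpa using ((hasDerivAt_id (0 : ℝ)).const_add 1).mul_const (quotOp m x₀ t₀)
    refine h'.unique (h.congr_of_eventuallyEq ?_)
    have : ∀ᶠ s : ℝ in nhds 0, -1 < s := Ioi_mem_nhds (by norm_num)
    filter_upwards [this] with s hs
    have h1 := quotOp_smul m x₀ t₀ (c := 1 + s) (by linarith)
    rw [← h1]
    simp [hF, add_smul, add_mul]
  set p : ι → ℝ := fun i => l (Pi.single i 1, 0) with hp
  set q : ℝ := l (0, 1) with hq
  have hlin : ∀ (y : ι → ℝ) (t : ℝ), l (y, t) = ∑ i, p i * y i + q * t := by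
    intro y t
    have h1 : (y, t) = ∑ i, y i • ((Pi.single i 1 : ι → ℝ), (0 : ℝ)) + t • ((0 : ι → ℝ), (1 : ℝ)) := by
      ext i
      · simp [Prod.fst_sum, Finset.sum_apply, Pi.single_apply]
      · simp [Prod.snd_sum]
    rw [h1, map_add, map_sum, map_smul]
    simp only [map_smul, smul_eq_mul, hp, hq]
    congr 1
    · exact Finset.sum_congr rfl fun i _ => mul_comm _ _
    · ring
  simp only [hlin] at hle heq
  have hq0 : q ≤ 0 := by
    -- F decreases in t, so lowering t at the contact point shows q ≤ 0.
    have h1 := hle x₀ (t₀ / 2) hx₀ (by positivity)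
    have h2 : quotOp m x₀ t₀ ≤ quotOp m x₀ (t₀ / 2) := by
      unfold quotOp
      have := hx₀ m le_rfl
      gcongr
      linarith
    nlinarith
  have hsum1 : ∑ i, p i * (1 : ι → ℝ) i = ∑ i, p i := by simp
  refine ⟨p, q, ?_, hq0, ?_, ?_, heq, hle⟩
  · intro i
    by_contra hneg
    push Not at hneg
    -- The test point is y = e_i + δ (1, …, 1) with t^{m+1} = σ_{m+1}(y), where F vanishes. This δ
    -- keeps δ ∑ p below -p_i / 2, so a negative p_i contradicts 0 ≤ p_i + δ ∑ p + q t.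
    set δ : ℝ := -p i / (2 * (|∑ j, p j| + 1)) with hδ
    have hδ0 : 0 < δ := by
      have : 0 < |∑ j, p j| + 1 := by positivity
      exact div_pos (by linarith) (by linarith)
    set y : ι → ℝ := Pi.single i 1 + fun _ => δ with hy
    have hy0 : ∀ j, 0 < y j := by
      intro j
      have : 0 ≤ (Pi.single i 1 : ι → ℝ) j := by
        rw [Pi.single_apply]; split_ifs <;> norm_num
      simp only [hy, Pi.add_apply]; linarith
    have hyG : Gam Finset.univ m y := fun j hj => es_pos hy0 (by omega)
    have he := es_pos hy0 hm
    set t := (es Finset.univ (m + 1) y) ^ (((m + 1 : ℕ) : ℝ)⁻¹) with ht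
    have ht0 : 0 < t := Real.rpow_pos_of_pos he _
    have htm : t ^ (m + 1) = es Finset.univ (m + 1) y :=
      Real.rpow_inv_natCast_pow he.le (by omega)
    have h := hle y t hyG ht0
    rw [quotOp, htm, sub_self, zero_div] at h
    have h3 : ∑ j, p j * y j = p i + δ * ∑ j, p j := by
      simp [hy, mul_add, Finset.sum_add_distrib, Pi.single_apply, ← Finset.sum_mul, mul_comm]
    rw [h3] at h
    have h4 : δ * ∑ j, p j ≤ -p i / 2 := by
      have h5 : δ * ∑ j, p j ≤ δ * (|∑ j, p j| + 1) := by
        apply mul_le_mul_of_nonneg_left _ hδ0.le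
        linarith [le_abs_self (∑ j, p j)]
      refine h5.trans (le_of_eq ?_)
      have : |∑ j, p j| + 1 ≠ 0 := by positivity
      rw [hδ]; field_simp
    nlinarith [mul_nonneg (neg_nonneg.2 hq0) ht0.le]
  -- At x = (1, …, 1), t = 1/2 the numerator is at least 1 - 1/2, and q ≤ 0 may be dropped.
  · have h := hle 1 (1 / 2) hG1 (by norm_num)
    rw [hsum1, quotOp, hone, hone] at h
    refine le_trans ?_ (le_trans h (by linarith))
    have : ((1 : ℝ) / 2) ^ (m + 1) ≤ 1 / 2 := by
      rw [pow_succ]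
      have := pow_le_one₀ (n := m) (by norm_num : (0 : ℝ) ≤ 1 / 2) (by norm_num)
      linarith
    gcongr
    linarith
  -- At x = (1, …, 1), t = 1 the value is nonnegative, which compares -q with ∑ p.
  · have h := hle 1 1 hG1 one_pos
    rw [hsum1, quotOp, hone, hone, one_pow] at h
    have : 0 ≤ (((Fintype.card ι).choose (m + 1) : ℝ) - 1) / ((Fintype.card ι).choose m : ℝ) :=
      div_nonneg (by linarith) hch.le
    linarith

end

/-! ### Passage from eigenvalues to symmetric matrices -/

section

variable {n : ℕ}

theorem exists_orthogonal_diagonalization {M : Matrix (Fin n) (Fin n) ℝ} (hM : M.IsHermitian) :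
    ∃ (O : Matrix (Fin n) (Fin n) ℝ) (d : Fin n → ℝ), Oᵀ * O = 1 ∧ O * Oᵀ = 1 ∧
      M = O * Matrix.diagonal d * Oᵀ ∧ ∀ k, sigma k M = es Finset.univ k d := by
  refine ⟨hM.eigenvectorUnitary, hM.eigenvalues, ?_, ?_, ?_, fun k => ?_⟩
  · have := Unitary.coe_star_mul_self hM.eigenvectorUnitary
    rwa [Matrix.star_eq_conjTranspose, Matrix.conjTranspose_eq_transpose_of_trivial] at this
  · have := Unitary.coe_mul_star_self hM.eigenvectorUnitary
    rwa [Unitary.coe_star, Matrix.star_eq_conjTranspose, Matrix.conjTranspose_eq_transpose_of_trivial] at this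
  · have := hM.spectral_theorem
    rwa [Unitary.conjStarAlgAut_apply, Matrix.star_eq_conjTranspose,
      Matrix.conjTranspose_eq_transpose_of_trivial] at this
  · rw [sigma, hM.roots_charpoly_eq_eigenvalues, Finset.esymm_map_val]
    rfl

theorem sigma_conj {A B P Q : Matrix (Fin n) (Fin n) ℝ} (hPQ : P * Q = 1) (h : A = Q * B * P)
    (k : ℕ) : sigma k A = sigma k B := by
  rw [sigma, sigma, h, Matrix.charpoly_mul_comm, ← mul_assoc, hPQ, one_mul]

theorem sigma_smul {M : Matrix (Fin n) (Fin n) ℝ} (hM : M.IsHermitian) (c : ℝ) (k : ℕ) :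
    sigma k (c • M) = c ^ k * sigma k M := by
  obtain ⟨O, d, h1, h2, h3, h4⟩ := exists_orthogonal_diagonalization hM
  have h5 : c • M = O * Matrix.diagonal (c • d) * Oᵀ := by
    rw [h3, Matrix.diagonal_smul, Matrix.mul_smul, Matrix.smul_mul]
  rw [h4, ← es_smul, sigma_conj h1 h5, sigma, Matrix.charpoly_diagonal, Polynomial.roots_prod]
  · simp only [Polynomial.roots_X_sub_C, Multiset.bind_singleton]
    rw [Finset.esymm_map_val]; rfl
  · exact Finset.prod_ne_zero_iff.2 fun i _ => Polynomial.X_sub_C_ne_zero _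

/-- The operator `(σ_{m+1} - t^{m+1}) / σ_m` on symmetric matrices. -/
noncomputable def matOp (m : ℕ) (M : Matrix (Fin n) (Fin n) ℝ) (t : ℝ) : ℝ :=
  (sigma (m + 1) M - t ^ (m + 1)) / sigma m M

/-- Membership of a symmetric matrix in the cone `Γ_m`. -/
def MatGam (m : ℕ) (M : Matrix (Fin n) (Fin n) ℝ) : Prop := ∀ j ≤ m, 0 < sigma j M

theorem sq_mem_doublyStochastic {U : Matrix (Fin n) (Fin n) ℝ} (h1 : Uᵀ * U = 1)
    (h2 : U * Uᵀ = 1) :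
    (Matrix.of fun i j => U i j ^ 2) ∈ doublyStochastic ℝ (Fin n) := by
  rw [mem_doublyStochastic_iff_sum]
  refine ⟨fun i j => sq_nonneg _, fun i => ?_, fun j => ?_⟩
  · have := congrFun (congrFun h2 i) i
    simpa [Matrix.mul_apply, sq] using this
  · have := congrFun (congrFun h1 j) j
    simpa [Matrix.mul_apply, sq] using this

/-- Schur's inequality for the symmetric concave function `(σ_{m+1} - t^{m+1}) / σ_m`. -/
theorem quotOp_le_of_orthogonal {m : ℕ} {p d : Fin n → ℝ} {q t : ℝ}
    (hp : ∀ y : Fin n → ℝ, Gam Finset.univ m y → quotOp m y t ≤ ∑ i, p i * y i + q)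
    (hd : Gam Finset.univ m d) {U : Matrix (Fin n) (Fin n) ℝ} (h1 : Uᵀ * U = 1)
    (h2 : U * Uᵀ = 1) : quotOp m d t ≤ ∑ i, p i * ∑ j, U i j ^ 2 * d j + q := by
  -- Birkhoff: the doubly stochastic matrix (U_ij²) is a convex combination of permutation matrices.
  -- The assertion is the average of the hypothesis at the permuted vectors d ∘ s, where the
  -- symmetric function keeps its value.
  obtain ⟨w, hw0, hw1, hw⟩ :=
    exists_eq_sum_perm_of_mem_doublyStochastic (sq_mem_doublyStochastic h1 h2)
  have h3 : ∀ i, ∑ j, U i j ^ 2 * d j = ∑ s : Equiv.Perm (Fin n), w s * d (s i) := by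
    intro i
    have h4 : ∀ j, U i j ^ 2 = ∑ s : Equiv.Perm (Fin n), w s * (if s i = j then 1 else 0) := by
      intro j
      have := congrFun (congrFun hw i) j
      simp only [Matrix.sum_apply, Matrix.smul_apply, smul_eq_mul, Matrix.of_apply] at this
      rw [← this]
      refine Finset.sum_congr rfl fun s _ => ?_
      simp [Equiv.Perm.permMatrix, PEquiv.toMatrix_apply, Equiv.toPEquiv_apply, eq_comm]
    simp only [h4, Finset.sum_mul]
    rw [Finset.sum_comm]
    refine Finset.sum_congr rfl fun s _ => ?_
    simp
  have h5 : ∀ s : Equiv.Perm (Fin n), w s * quotOp m d t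
      ≤ w s * (∑ i, p i * d (s i) + q) := by
    intro s
    refine mul_le_mul_of_nonneg_left ?_ (hw0 s)
    have := hp (d ∘ s) (fun j hj => by rw [es_perm]; exact hd j hj)
    rw [quotOp_perm] at this
    simpa using this
  have h6 := Finset.sum_le_sum fun s (_ : s ∈ Finset.univ) => h5 s
  rw [← Finset.sum_mul, hw1, one_mul] at h6
  refine h6.trans (le_of_eq ?_)
  simp only [mul_add, Finset.sum_add_distrib, ← Finset.sum_mul, hw1, one_mul, h3, Finset.mul_sum]
  rw [Finset.sum_comm]
  congr 1
  exact Finset.sum_congr rfl fun _ _ => Finset.sum_congr rfl fun _ _ => by ring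

/-- Supergradients of the operator `(σ_{m+1} - t^{m+1}) / σ_m` on `Γ_m`. -/
theorem exists_matrix_supergradient {m : ℕ} (hm : m + 1 ≤ n) :
    ∃ c₀ : ℝ, 0 < c₀ ∧ ∀ (M₀ : Matrix (Fin n) (Fin n) ℝ) (t₀ : ℝ), M₀.IsHermitian →
      MatGam m M₀ → 0 < t₀ →
      ∃ (P : Matrix (Fin n) (Fin n) ℝ) (q : ℝ), P.PosSemidef ∧ q ≤ 0 ∧ c₀ ≤ P.trace ∧
        -q ≤ P.trace ∧ matOp m M₀ t₀ = (P * M₀).trace + q * t₀ ∧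
        ∀ (M : Matrix (Fin n) (Fin n) ℝ) (t : ℝ), M.IsHermitian → MatGam m M → 0 < t →
          matOp m M t ≤ (P * M).trace + q * t := by
  obtain ⟨c₀, hc₀, H⟩ := exists_supergradient (ι := Fin n) (m := m) (by simpa using hm)
  refine ⟨c₀, hc₀, fun M₀ t₀ hM₀ hG ht₀ => ?_⟩
  obtain ⟨O, d, hO1, hO2, hMd, hs⟩ := exists_orthogonal_diagonalization hM₀
  obtain ⟨p, q, hp, hq, hc, hqp, heq, hle⟩ := H d t₀ (fun j hj => by rw [← hs]; exact hG j hj) ht₀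
  have htr : ∀ M : Matrix (Fin n) (Fin n) ℝ, (O * Matrix.diagonal p * Oᵀ * M).trace
      = ∑ i, p i * (Oᵀ * M * O) i i := by
    intro M
    rw [mul_assoc, mul_assoc, Matrix.trace_mul_comm, mul_assoc, Matrix.trace]
    simp [Matrix.diagonal_mul]
  have htrP : (O * Matrix.diagonal p * Oᵀ).trace = ∑ i, p i := by
    have := htr 1
    rw [mul_one] at this
    rw [this, mul_one, hO1]; simp
  -- P is diagonal in the eigenbasis of M₀. For M = V diag(e) Vᵀ one has tr(P M) = ∑ p_i (OᵀV)_ij²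
  -- e_j, so the general bound is Schur's inequality for the orthogonal matrix OᵀV.
  refine ⟨O * Matrix.diagonal p * Oᵀ, q, ?_, hq, by rwa [htrP], by rwa [htrP], ?_, ?_⟩
  · have := (Matrix.PosSemidef.diagonal (n := Fin n) (d := p) hp).mul_mul_conjTranspose_same O
    rwa [Matrix.conjTranspose_eq_transpose_of_trivial] at this
  · rw [htr, hMd]
    have : Oᵀ * (O * Matrix.diagonal d * Oᵀ) * O = Matrix.diagonal d := by
      calc Oᵀ * (O * Matrix.diagonal d * Oᵀ) * O
          = (Oᵀ * O) * Matrix.diagonal d * (Oᵀ * O) := by noncomm_ring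
        _ = _ := by rw [hO1]; simp
    rw [this]
    simp only [Matrix.diagonal_apply_eq]
    rw [← heq, ← hMd, matOp, quotOp, hs, hs]
  · intro M t hM hGM ht
    obtain ⟨V, e, hV1, hV2, hMe, hse⟩ := exists_orthogonal_diagonalization hM
    have hGe : Gam Finset.univ m e := fun j hj => by rw [← hse]; exact hGM j hj
    have h1 := quotOp_le_of_orthogonal (t := t) (p := p) (q := q * t) (fun y hy => hle y t hy ht) hGe
      (U := Oᵀ * V) ?_ ?_
    · rw [htr, matOp, hse, hse]
      refine h1.trans (le_of_eq ?_)
      congr 1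
      refine Finset.sum_congr rfl fun i _ => ?_
      congr 1
      have : Oᵀ * M * O = (Oᵀ * V) * Matrix.diagonal e * (Oᵀ * V)ᵀ := by
        rw [hMe, Matrix.transpose_mul, Matrix.transpose_transpose]; noncomm_ring
      rw [this, Matrix.mul_apply]
      simp only [Matrix.mul_diagonal, Matrix.transpose_apply]
      exact Finset.sum_congr rfl fun j _ => by ring
    · rw [Matrix.transpose_mul, Matrix.transpose_transpose]
      calc Vᵀ * O * (Oᵀ * V) = Vᵀ * (O * Oᵀ) * V := by noncomm_ring
        _ = 1 := by rw [hO2, mul_one, hV1]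
    · rw [Matrix.transpose_mul, Matrix.transpose_transpose]
      calc Oᵀ * V * (Vᵀ * O) = Oᵀ * (V * Vᵀ) * O := by noncomm_ring
        _ = 1 := by rw [hV2, mul_one, hO1]

/-- The squared norm of a symmetric matrix is `σ₁² - 2 σ₂`. -/
theorem trace_sq_eq {M : Matrix (Fin n) (Fin n) ℝ} (hM : M.IsHermitian) :
    sigma 1 M = M.trace ∧ ∑ i, ∑ j, M i j ^ 2 = M.trace ^ 2 - 2 * sigma 2 M := by
  obtain ⟨O, d, hO1, hO2, hMd, hs⟩ := exists_orthogonal_diagonalization hM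
  have htr : M.trace = ∑ i, d i := by
    rw [hMd, Matrix.trace_mul_comm, ← mul_assoc, hO1, one_mul, Matrix.trace_diagonal]
  have hsq : ∑ i, ∑ j, M i j ^ 2 = ∑ i, d i ^ 2 := by
    have h1 : (M * M).trace = ∑ i, ∑ j, M i j ^ 2 := by
      simp only [Matrix.trace, Matrix.diag, Matrix.mul_apply]
      refine Finset.sum_congr rfl fun i _ => Finset.sum_congr rfl fun j _ => ?_
      have : M j i = M i j := by simpa using hM.apply i j
      rw [this, sq]
    rw [← h1]
    have : M * M = O * (Matrix.diagonal d * Matrix.diagonal d) * Oᵀ := by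
      calc M * M = O * Matrix.diagonal d * (Oᵀ * O) * Matrix.diagonal d * Oᵀ := by
            rw [hMd]; noncomm_ring
        _ = _ := by rw [hO1]; noncomm_ring
    rw [this, Matrix.trace_mul_comm, ← mul_assoc, hO1, one_mul, Matrix.diagonal_mul_diagonal,
      Matrix.trace_diagonal]
    exact Finset.sum_congr rfl fun i _ => (sq _).symm
  have h2 : (∑ i, d i) ^ 2 = ∑ i, d i ^ 2 + 2 * es Finset.univ 2 d := by
    have h := sum_mul_es_erase Finset.univ 1 d
    have h3 : ∀ i ∈ Finset.univ, d i * es (Finset.univ.erase i) 1 d = d i * ∑ j, d j - d i ^ 2 := by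
      intro i _
      rw [es_one, ← Finset.add_sum_erase Finset.univ d (Finset.mem_univ i)]; ring
    rw [Finset.sum_congr rfl h3, Finset.sum_sub_distrib, ← Finset.sum_mul] at h
    norm_num at h
    linarith
  refine ⟨by rw [hs, es_one, htr], ?_⟩
  rw [hsq, htr, hs, h2]; ring

end

section

variable {n : ℕ}

local notation "𝔼" => EuclideanSpace ℝ (Fin n)

/-! ### Calculus of partial derivatives -/

theorem pd_congr {f g : 𝔼 → ℝ} {x : 𝔼} (h : f =ᶠ[𝓝 x] g) (i : Fin n) : pd i f x = pd i g x := by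
  rw [pd, pd, h.fderiv_eq]

theorem pd_congr_eventually {f g : 𝔼 → ℝ} {x : 𝔼} (h : f =ᶠ[𝓝 x] g) (i : Fin n) :
    pd i f =ᶠ[𝓝 x] pd i g := by
  filter_upwards [h.eventuallyEq_nhds] with y hy using pd_congr hy i

theorem contDiffAt_pd {f : 𝔼 → ℝ} {x : 𝔼} {k l : ℕ∞ω} (h : ContDiffAt ℝ l f x)
    (hk : k + 1 ≤ l) (i : Fin n) : ContDiffAt ℝ k (pd i f) x :=
  (h.fderiv_right hk).clm_apply contDiffAt_const

theorem eventually_differentiableAt {f : 𝔼 → ℝ} {x : 𝔼} (h : ContDiffAt ℝ 2 f x) :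
    ∀ᶠ y in 𝓝 x, DifferentiableAt ℝ f y := by
  filter_upwards [h.eventually (by simp)] with y hy using hy.differentiableAt (by simp)

theorem pd_comm {f : 𝔼 → ℝ} {x : 𝔼} (h : ContDiffAt ℝ 2 f x) (i j : Fin n) :
    pd i (pd j f) x = pd j (pd i f) x := by
  have h1 : DifferentiableAt ℝ (fderiv ℝ f) x :=
    (h.fderiv_right (m := 1) (by norm_num)).differentiableAt (by norm_num)
  have h2 : ∀ a b : Fin n, pd a (pd b f) x
      = fderiv ℝ (fderiv ℝ f) x (EuclideanSpace.single a 1) (EuclideanSpace.single b 1) := by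
    intro a b
    have : pd b f = fun y => fderiv ℝ f y (EuclideanSpace.single b 1) := rfl
    rw [pd, this, fderiv_clm_apply h1 (differentiableAt_const _)]
    simp
  rw [h2, h2]
  exact (h.isSymmSndFDerivAt (by simp)).eq _ _

theorem pd_const (c : ℝ) (i : Fin n) (x : 𝔼) : pd i (fun _ => c) x = 0 := by
  simp [pd]

theorem pd_add {f g : 𝔼 → ℝ} {x : 𝔼} (hf : DifferentiableAt ℝ f x) (hg : DifferentiableAt ℝ g x)
    (i : Fin n) : pd i (fun y => f y + g y) x = pd i f x + pd i g x := by
  simp [pd, fderiv_fun_add hf hg]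

theorem pd_sub {f g : 𝔼 → ℝ} {x : 𝔼} (hf : DifferentiableAt ℝ f x) (hg : DifferentiableAt ℝ g x)
    (i : Fin n) : pd i (fun y => f y - g y) x = pd i f x - pd i g x := by
  simp [pd, fderiv_fun_sub hf hg]

theorem pd_mul {f g : 𝔼 → ℝ} {x : 𝔼} (hf : DifferentiableAt ℝ f x) (hg : DifferentiableAt ℝ g x)
    (i : Fin n) : pd i (fun y => f y * g y) x = pd i f x * g x + f x * pd i g x := by
  simp [pd, fderiv_fun_mul hf hg]; ring

theorem pd_const_mul {f : 𝔼 → ℝ} {x : 𝔼} (hf : DifferentiableAt ℝ f x) (c : ℝ)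
    (i : Fin n) : pd i (fun y => c * f y) x = c * pd i f x := by
  rw [pd_mul (differentiableAt_const c) hf, pd_const]; ring

theorem pd_sum {ι : Type*} {s : Finset ι} {f : ι → 𝔼 → ℝ} {x : 𝔼}
    (hf : ∀ a ∈ s, DifferentiableAt ℝ (f a) x) (i : Fin n) :
    pd i (fun y => ∑ a ∈ s, f a y) x = ∑ a ∈ s, pd i (f a) x := by
  simp [pd, fderiv_fun_sum hf]

theorem pd_comp {f : 𝔼 → ℝ} {x : 𝔼} {g : ℝ → ℝ} {g' : ℝ} (hg : HasDerivAt g g' (f x))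
    (hf : DifferentiableAt ℝ f x) (i : Fin n) : pd i (fun y => g (f y)) x = g' * pd i f x := by
  have h := (hg.comp_hasFDerivAt x hf.hasFDerivAt).fderiv
  have h' : fderiv ℝ (fun y => g (f y)) x = g' • fderiv ℝ f x := h
  simp [pd, h']

theorem pd_pd_add {f g : 𝔼 → ℝ} {x : 𝔼} (hf : ContDiffAt ℝ 2 f x) (hg : ContDiffAt ℝ 2 g x)
    (i j : Fin n) : pd i (pd j (fun y => f y + g y)) x = pd i (pd j f) x + pd i (pd j g) x := by
  have h : pd j (fun y => f y + g y) =ᶠ[𝓝 x] fun y => pd j f y + pd j g y := by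
    filter_upwards [eventually_differentiableAt hf, eventually_differentiableAt hg] with y h1 h2
      using pd_add h1 h2 j
  rw [pd_congr h, pd_add]
  · exact (contDiffAt_pd (k := 1) hf (by norm_num) j).differentiableAt (by norm_num)
  · exact (contDiffAt_pd (k := 1) hg (by norm_num) j).differentiableAt (by norm_num)

theorem pd_pd_mul {f g : 𝔼 → ℝ} {x : 𝔼} (hf : ContDiffAt ℝ 2 f x) (hg : ContDiffAt ℝ 2 g x)
    (i j : Fin n) : pd i (pd j (fun y => f y * g y)) x
      = pd i (pd j f) x * g x + pd j f x * pd i g x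
        + (pd i f x * pd j g x + f x * pd i (pd j g) x) := by
  have h : pd j (fun y => f y * g y) =ᶠ[𝓝 x] fun y => pd j f y * g y + f y * pd j g y := by
    filter_upwards [eventually_differentiableAt hf, eventually_differentiableAt hg] with y h1 h2
      using pd_mul h1 h2 j
  have h1 := (contDiffAt_pd (k := 1) hf (by norm_num) j).differentiableAt (by norm_num)
  have h2 := (contDiffAt_pd (k := 1) hg (by norm_num) j).differentiableAt (by norm_num)
  have h3 := hf.differentiableAt (by norm_num)
  have h4 := hg.differentiableAt (by norm_num)
  rw [pd_congr h, pd_add (h1.fun_mul h4) (h3.fun_mul h2), pd_mul h1 h4, pd_mul h3 h2]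

theorem pd_pd_const_mul {f : 𝔼 → ℝ} {x : 𝔼} (hf : ContDiffAt ℝ 2 f x) (c : ℝ)
    (i j : Fin n) : pd i (pd j (fun y => c * f y)) x = c * pd i (pd j f) x := by
  have h0 : pd j (fun _ : 𝔼 => c) = fun _ => 0 := by ext y; exact pd_const c j y
  rw [pd_pd_mul contDiffAt_const hf, h0, pd_const, pd_const]; ring

theorem pd_pd_sum {ι : Type*} {s : Finset ι} {f : ι → 𝔼 → ℝ} {x : 𝔼}
    (hf : ∀ a ∈ s, ContDiffAt ℝ 2 (f a) x) (i j : Fin n) :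
    pd i (pd j (fun y => ∑ a ∈ s, f a y)) x = ∑ a ∈ s, pd i (pd j (f a)) x := by
  have h : pd j (fun y => ∑ a ∈ s, f a y) =ᶠ[𝓝 x] fun y => ∑ a ∈ s, pd j (f a) y := by
    have : ∀ᶠ y in 𝓝 x, ∀ a ∈ s, DifferentiableAt ℝ (f a) y :=
      (Filter.eventually_all_finset s).2 fun a ha => eventually_differentiableAt (hf a ha)
    filter_upwards [this] with y hy using pd_sum hy j
  rw [pd_congr h, pd_sum]
  exact fun a ha => (contDiffAt_pd (k := 1) (hf a ha) (by norm_num) j).differentiableAt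
    (by norm_num)

theorem pd_pd_comp {f : 𝔼 → ℝ} {x : 𝔼} {g g' : ℝ → ℝ} {g'' : ℝ}
    (hg : ∀ᶠ t in 𝓝 (f x), HasDerivAt g (g' t) t) (hg' : HasDerivAt g' g'' (f x))
    (hf : ContDiffAt ℝ 2 f x) (i j : Fin n) :
    pd i (pd j (fun y => g (f y))) x
      = g'' * pd i f x * pd j f x + g' (f x) * pd i (pd j f) x := by
  have hd := hf.differentiableAt (by norm_num)
  have h : pd j (fun y => g (f y)) =ᶠ[𝓝 x] fun y => g' (f y) * pd j f y := by
    filter_upwards [eventually_differentiableAt hf, hd.continuousAt.eventually hg] with y h1 h2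
      using pd_comp h2 h1 j
  have h1 := (contDiffAt_pd (k := 1) hf (by norm_num) j).differentiableAt (by norm_num)
  have h2 : DifferentiableAt ℝ (fun y => g' (f y)) x :=
    (hg'.comp_hasFDerivAt x hd.hasFDerivAt).differentiableAt
  rw [pd_congr h, pd_mul h2 h1, pd_comp hg' hd]

theorem fderiv_apply_eq_sum_pd (f : 𝔼 → ℝ) (x e : 𝔼) :
    fderiv ℝ f x e = ∑ i, e i * pd i f x := by
  have h : e = ∑ i, e i • EuclideanSpace.single i (1 : ℝ) := by
    ext j; simp [Finset.sum_apply, Pi.single_apply]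
  conv_lhs => rw [h]
  simp [pd]

/-- If g'' were negative, 0 would be a local maximum too, so g would be locally constant and g'' =
0. -/
theorem second_deriv_nonneg_of_isLocalMin {g g' : ℝ → ℝ} {g'' : ℝ} (hmin : IsLocalMin g 0)
    (hg : ∀ᶠ t in 𝓝 0, HasDerivAt g (g' t) t) (hg' : HasDerivAt g' g'' 0) : 0 ≤ g'' := by
  by_contra hneg
  push Not at hneg
  have h1 : deriv g =ᶠ[𝓝 0] g' := by filter_upwards [hg] with t ht using ht.deriv
  have h2 : deriv (deriv g) 0 = g'' := by rw [h1.deriv_eq, hg'.deriv]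
  have h3 := isLocalMax_of_deriv_deriv_neg (by rw [h2]; exact hneg) hmin.deriv_eq_zero
    hg.self_of_nhds.continuousAt
  have h4 : g =ᶠ[𝓝 0] fun _ => g 0 := by
    filter_upwards [hmin, h3] with t ht ht' using le_antisymm ht' ht
  have h5 : deriv g =ᶠ[𝓝 0] fun _ => 0 := by
    filter_upwards [h4.eventuallyEq_nhds] with t ht
    rw [ht.deriv_eq]; simp
  rw [h5.deriv_eq] at h2
  simp at h2
  linarith

/-- Z is a sum of rank one matrices w ⊗ w, and each of them contributes a second derivative along a
line. -/
theorem sum_mul_pd_pd_nonneg {ψ : 𝔼 → ℝ} {x : 𝔼} (hψ : ContDiffAt ℝ 2 ψ x)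
    (hmin : IsLocalMin ψ x) {Z : Matrix (Fin n) (Fin n) ℝ} (hZ : Z.PosSemidef) :
    0 ≤ ∑ c, ∑ d, Z c d * pd c (pd d ψ) x := by
  have hdir : ∀ e : 𝔼, 0 ≤ ∑ c, ∑ d, e c * e d * pd c (pd d ψ) x := by
    intro e
    have hl : ∀ t : ℝ, HasDerivAt (fun s : ℝ => x + s • e) e t := fun t => by
      simpa using ((hasDerivAt_id t).smul_const e).const_add x
    have hc : Filter.Tendsto (fun s : ℝ => x + s • e) (𝓝 0) (𝓝 x) := by
      have := (hl 0).continuousAt.tendsto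
      simpa using this
    refine second_deriv_nonneg_of_isLocalMin (g := fun s : ℝ => ψ (x + s • e))
      (g' := fun s : ℝ => ∑ d, e d * pd d ψ (x + s • e)) ?_ ?_ ?_
    · have := hc.eventually hmin
      simpa [IsLocalMin, IsMinFilter] using this
    · filter_upwards [hc.eventually (eventually_differentiableAt hψ)] with t ht
      rw [← fderiv_apply_eq_sum_pd]
      exact ht.hasFDerivAt.comp_hasDerivAt t (hl t)
    · have h1 : ∀ d, HasDerivAt (fun s : ℝ => e d * pd d ψ (x + s • e))
          (e d * ∑ c, e c * pd c (pd d ψ) x) 0 := by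
        intro d
        have h2 := (contDiffAt_pd (k := 1) hψ (by norm_num) d).differentiableAt (by norm_num)
        have h3 : HasFDerivAt (pd d ψ) (fderiv ℝ (pd d ψ) x) (x + (0 : ℝ) • e) := by
          simpa using h2.hasFDerivAt
        have h4 := (h3.comp_hasDerivAt (0 : ℝ) (hl 0)).const_mul (e d)
        rwa [fderiv_apply_eq_sum_pd] at h4
      have h5 := HasDerivAt.fun_sum fun d (_ : d ∈ Finset.univ) => h1 d
      convert! h5 using 1
      rw [Finset.sum_comm]
      refine Finset.sum_congr rfl fun d _ => ?_
      rw [Finset.mul_sum]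
      exact Finset.sum_congr rfl fun c _ => by ring
  obtain ⟨N, w, rfl⟩ := Matrix.posSemidef_iff_eq_sum_vecMulVec.1 hZ
  have h : ∑ c, ∑ d, (∑ m, Matrix.vecMulVec (w m) (star (w m))) c d * pd c (pd d ψ) x
      = ∑ m, ∑ c, ∑ d, w m c * w m d * pd c (pd d ψ) x := by
    simp only [Matrix.sum_apply, Matrix.vecMulVec_apply, star_trivial, Finset.sum_mul]
    rw [Finset.sum_comm_cycle]
  rw [h]
  exact Finset.sum_nonneg fun m _ => hdir (WithLp.toLp 2 (w m))

/-! ### Bounds for 2-jets -/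

/-- The function `f` is `C²` at `x` and its derivatives there of order at most two are bounded
by `Λ`. -/
def JetBound (Λ : ℝ) (f : 𝔼 → ℝ) (x : 𝔼) : Prop :=
  ContDiffAt ℝ 2 f x ∧ |f x| ≤ Λ ∧ (∀ c, |pd c f x| ≤ Λ) ∧ ∀ c d, |pd c (pd d f) x| ≤ Λ

theorem JetBound.mono {Λ Λ' : ℝ} {f : 𝔼 → ℝ} {x : 𝔼} (h : JetBound Λ f x) (hΛ : Λ ≤ Λ') :
    JetBound Λ' f x :=
  ⟨h.1, h.2.1.trans hΛ, fun c => (h.2.2.1 c).trans hΛ, fun c d => (h.2.2.2 c d).trans hΛ⟩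

theorem JetBound.nonneg {Λ : ℝ} {f : 𝔼 → ℝ} {x : 𝔼} (h : JetBound Λ f x) : 0 ≤ Λ :=
  (abs_nonneg _).trans h.2.1

theorem JetBound.add {Λ Λ' : ℝ} {f g : 𝔼 → ℝ} {x : 𝔼} (hf : JetBound Λ f x)
    (hg : JetBound Λ' g x) : JetBound (Λ + Λ') (fun y => f y + g y) x := by
  refine ⟨hf.1.add hg.1, (abs_add_le _ _).trans (add_le_add hf.2.1 hg.2.1), fun c => ?_,
    fun c d => ?_⟩
  · rw [pd_add (hf.1.differentiableAt (by norm_num)) (hg.1.differentiableAt (by norm_num))]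
    exact (abs_add_le _ _).trans (add_le_add (hf.2.2.1 c) (hg.2.2.1 c))
  · rw [pd_pd_add hf.1 hg.1]
    exact (abs_add_le _ _).trans (add_le_add (hf.2.2.2 c d) (hg.2.2.2 c d))

theorem JetBound.mul {Λ Λ' : ℝ} {f g : 𝔼 → ℝ} {x : 𝔼} (hf : JetBound Λ f x)
    (hg : JetBound Λ' g x) : JetBound (4 * (Λ * Λ')) (fun y => f y * g y) x := by
  have h0 := hf.nonneg
  have h0' := hg.nonneg
  have hm : ∀ {a b : ℝ}, |a| ≤ Λ → |b| ≤ Λ' → |a * b| ≤ Λ * Λ' := fun ha hb => by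
    rw [abs_mul]; exact mul_le_mul ha hb (abs_nonneg _) h0
  have hp := mul_nonneg h0 h0'
  refine ⟨hf.1.mul hg.1, (hm hf.2.1 hg.2.1).trans (by linarith), fun c => ?_, fun c d => ?_⟩
  · rw [pd_mul (hf.1.differentiableAt (by norm_num)) (hg.1.differentiableAt (by norm_num))]
    have := (abs_add_le _ _).trans (add_le_add (hm (hf.2.2.1 c) hg.2.1) (hm hf.2.1 (hg.2.2.1 c)))
    linarith
  · rw [pd_pd_mul hf.1 hg.1]
    have h1 := (abs_add_le _ _).trans
      (add_le_add (hm (hf.2.2.2 c d) hg.2.1) (hm (hf.2.2.1 d) (hg.2.2.1 c)))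
    have h2 := (abs_add_le _ _).trans
      (add_le_add (hm (hf.2.2.1 c) (hg.2.2.1 d)) (hm hf.2.1 (hg.2.2.2 c d)))
    have := (abs_add_le _ _).trans (add_le_add h1 h2)
    linarith

theorem JetBound.const_mul {Λ : ℝ} {f : 𝔼 → ℝ} {x : 𝔼} (hf : JetBound Λ f x) (a : ℝ) :
    JetBound (|a| * Λ) (fun y => a * f y) x := by
  have hm : ∀ {b : ℝ}, |b| ≤ Λ → |a * b| ≤ |a| * Λ := fun hb => by
    rw [abs_mul]; exact mul_le_mul_of_nonneg_left hb (abs_nonneg _)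
  refine ⟨contDiffAt_const.mul hf.1, hm hf.2.1, fun c => ?_, fun c d => ?_⟩
  · rw [pd_const_mul (hf.1.differentiableAt (by norm_num))]; exact hm (hf.2.2.1 c)
  · rw [pd_pd_const_mul hf.1]; exact hm (hf.2.2.2 c d)

theorem JetBound.sum {ι : Type*} (s : Finset ι) {Λ : ι → ℝ} {f : ι → 𝔼 → ℝ} {x : 𝔼}
    (hf : ∀ a ∈ s, JetBound (Λ a) (f a) x) :
    JetBound (∑ a ∈ s, Λ a) (fun y => ∑ a ∈ s, f a y) x := by
  refine ⟨ContDiffAt.sum fun a ha => (hf a ha).1, ?_, fun c => ?_, fun c d => ?_⟩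
  · exact (Finset.abs_sum_le_sum_abs _ _).trans (Finset.sum_le_sum fun a ha => (hf a ha).2.1)
  · rw [pd_sum fun a ha => (hf a ha).1.differentiableAt (by norm_num)]
    exact (Finset.abs_sum_le_sum_abs _ _).trans (Finset.sum_le_sum fun a ha => (hf a ha).2.2.1 c)
  · rw [pd_pd_sum fun a ha => (hf a ha).1]
    exact (Finset.abs_sum_le_sum_abs _ _).trans
      (Finset.sum_le_sum fun a ha => (hf a ha).2.2.2 c d)

theorem JetBound.comp {Λ B : ℝ} {f : 𝔼 → ℝ} {x : 𝔼} {g g' g'' : ℝ → ℝ} (hf : JetBound Λ f x)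
    (hgC : ContDiffAt ℝ 2 g (f x))
    (hg : ∀ᶠ t in 𝓝 (f x), HasDerivAt g (g' t) t) (hg' : HasDerivAt g' (g'' (f x)) (f x))
    (h0 : |g (f x)| ≤ B) (h1 : |g' (f x)| ≤ B) (h2 : |g'' (f x)| ≤ B) :
    JetBound (B * (1 + Λ + Λ ^ 2)) (fun y => g (f y)) x := by
  have hΛ := hf.nonneg
  have hB := (abs_nonneg _).trans h0
  refine ⟨hgC.comp x hf.1, h0.trans (by nlinarith [mul_nonneg hB hΛ, mul_nonneg hB (sq_nonneg Λ)]),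
    fun c => ?_, fun c d => ?_⟩
  · rw [pd_comp hg.self_of_nhds (hf.1.differentiableAt (by norm_num)), abs_mul]
    have := mul_le_mul h1 (hf.2.2.1 c) (abs_nonneg _) hB
    nlinarith [mul_nonneg hB (sq_nonneg Λ)]
  · rw [pd_pd_comp hg hg' hf.1]
    have e1 : |g'' (f x) * pd c f x * pd d f x| ≤ B * Λ * Λ := by
      rw [abs_mul, abs_mul]
      exact mul_le_mul (mul_le_mul h2 (hf.2.2.1 c) (abs_nonneg _) hB) (hf.2.2.1 d)
        (abs_nonneg _) (mul_nonneg hB hΛ)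
    have e2 : |g' (f x) * pd c (pd d f) x| ≤ B * Λ := by
      rw [abs_mul]; exact mul_le_mul h1 (hf.2.2.2 c d) (abs_nonneg _) hB
    have := (abs_add_le _ _).trans (add_le_add e1 e2)
    nlinarith

end

/-! ### Derivatives of quasilinear expressions -/

section

variable {n : ℕ}

local notation "𝔼" => EuclideanSpace ℝ (Fin n)

theorem pd_comm_eventually {f : 𝔼 → ℝ} {x : 𝔼} (h : ContDiffAt ℝ 2 f x) (i j : Fin n) :
    pd i (pd j f) =ᶠ[𝓝 x] pd j (pd i f) := by
  filter_upwards [h.eventually (by simp)] with y hy using pd_comm hy i j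

theorem pd_pd_pd_comm {f : 𝔼 → ℝ} {x : 𝔼} (h : ContDiffAt ℝ 3 f x) (i j a : Fin n) :
    pd i (pd j (pd a f)) x = pd a (pd i (pd j f)) x := by
  rw [pd_congr (pd_comm_eventually (h.of_le (by norm_num)) j a),
    pd_comm (contDiffAt_pd (k := 2) h (by norm_num) j)]

theorem pd_pd_pd_pd_comm {f : 𝔼 → ℝ} {x : 𝔼} (h : ContDiffAt ℝ 4 f x) (i j a b : Fin n) :
    pd i (pd j (pd a (pd b f))) x = pd a (pd b (pd i (pd j f))) x := by
  have h3 : ∀ c, ContDiffAt ℝ 3 (pd c f) x := fun c => contDiffAt_pd h (by norm_num) c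
  rw [pd_pd_pd_comm (h3 b)]
  have : pd i (pd j (pd b f)) =ᶠ[𝓝 x] pd b (pd i (pd j f)) := by
    have h' := h.eventually (by simp)
    filter_upwards [h'] with y hy using pd_pd_pd_comm (hy.of_le (by norm_num)) i j b
  rw [pd_congr this]

/-- Bounds for a function and its derivatives of orders one and two at a point. -/
structure JetBounds (w : 𝔼 → ℝ) (x : 𝔼) (w₀ w₁ w₂ : ℝ) : Prop where
  contDiffAt : ContDiffAt ℝ 2 w x
  zero : |w x| ≤ w₀
  one : ∀ c, |pd c w x| ≤ w₁
  two : ∀ c d, |pd c (pd d w) x| ≤ w₂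

theorem abs_add_five_sub_le {a b c d e s A B C D E : ℝ} (ha : |a - s| ≤ A) (hb : |b| ≤ B)
    (hc : |c| ≤ C) (hd : |d| ≤ D) (he : |e| ≤ E) :
    |a + b + c + d + e - s| ≤ A + B + C + D + E := by
  rw [abs_le] at *
  constructor <;> linarith [ha.1, ha.2, hb.1, hb.2, hc.1, hc.2, hd.1, hd.2, he.1, he.2]

section products

variable {ι : Type*} {s : Finset ι} {f w : ι → EuclideanSpace ℝ (Fin n) → ℝ}
  {x : EuclideanSpace ℝ (Fin n)} {Λ w₀ w₁ w₂ : ℝ}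

theorem abs_pd_sum_mul_sub_le (hf : ∀ a ∈ s, JetBound Λ (f a) x)
    (hw : ∀ a ∈ s, JetBounds (w a) x w₀ w₁ w₂) (c : Fin n) :
    |pd c (fun y => ∑ a ∈ s, f a y * w a y) x - ∑ a ∈ s, f a x * pd c (w a) x|
      ≤ s.card * (Λ * w₀) := by
  have h1 : ∀ a ∈ s, DifferentiableAt ℝ (f a) x := fun a ha =>
    (hf a ha).1.differentiableAt (by norm_num)
  have h2 : ∀ a ∈ s, DifferentiableAt ℝ (w a) x := fun a ha =>
    (hw a ha).contDiffAt.differentiableAt (by norm_num)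
  rw [pd_sum fun a ha => (h1 a ha).fun_mul (h2 a ha), ← Finset.sum_sub_distrib, ← nsmul_eq_mul]
  refine (Finset.abs_sum_le_sum_abs _ _).trans (Finset.sum_le_card_nsmul _ _ _ fun a ha => ?_)
  rw [pd_mul (h1 a ha) (h2 a ha), add_sub_cancel_right, abs_mul]
  exact mul_le_mul ((hf a ha).2.2.1 c) (hw a ha).zero (abs_nonneg _) (hf a ha).nonneg

/-- The terms with both derivatives on w are kept exactly, so w₂ does not enter the error. When w is
a second derivative of v, w₂ bounds fourth derivatives, over which there is no control. -/
theorem abs_pd_pd_sum_mul_sub_le (hf : ∀ a ∈ s, JetBound Λ (f a) x)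
    (hw : ∀ a ∈ s, JetBounds (w a) x w₀ w₁ w₂) (c d : Fin n) :
    |pd c (pd d (fun y => ∑ a ∈ s, f a y * w a y)) x - ∑ a ∈ s, f a x * pd c (pd d (w a)) x|
      ≤ s.card * (Λ * (w₀ + 2 * w₁)) := by
  rw [pd_pd_sum fun a ha => (hf a ha).1.mul (hw a ha).contDiffAt, ← Finset.sum_sub_distrib,
    ← nsmul_eq_mul]
  refine (Finset.abs_sum_le_sum_abs _ _).trans (Finset.sum_le_card_nsmul _ _ _ fun a ha => ?_)
  rw [pd_pd_mul (hf a ha).1 (hw a ha).contDiffAt]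
  have hΛ := (hf a ha).nonneg
  have e1 : |pd c (pd d (f a)) x * w a x| ≤ Λ * w₀ := by
    rw [abs_mul]; exact mul_le_mul ((hf a ha).2.2.2 c d) (hw a ha).zero (abs_nonneg _) hΛ
  have e2 : |pd d (f a) x * pd c (w a) x| ≤ Λ * w₁ := by
    rw [abs_mul]; exact mul_le_mul ((hf a ha).2.2.1 d) ((hw a ha).one c) (abs_nonneg _) hΛ
  have e3 : |pd c (f a) x * pd d (w a) x| ≤ Λ * w₁ := by
    rw [abs_mul]; exact mul_le_mul ((hf a ha).2.2.1 c) ((hw a ha).one d) (abs_nonneg _) hΛ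
  rw [abs_le] at e1 e2 e3 ⊢
  constructor <;> linarith [e1.1, e1.2, e2.1, e2.2, e3.1, e3.2]

theorem abs_pd_sum_mul_le (hf : ∀ a ∈ s, JetBound Λ (f a) x)
    (hw : ∀ a ∈ s, JetBounds (w a) x w₀ w₁ w₂) (c : Fin n) :
    |pd c (fun y => ∑ a ∈ s, f a y * w a y) x| ≤ s.card * (Λ * (w₀ + w₁)) := by
  have h1 := abs_pd_sum_mul_sub_le hf hw c
  have h2 : |∑ a ∈ s, f a x * pd c (w a) x| ≤ s.card * (Λ * w₁) := by
    rw [← nsmul_eq_mul]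
    refine (Finset.abs_sum_le_sum_abs _ _).trans (Finset.sum_le_card_nsmul _ _ _ fun a ha => ?_)
    rw [abs_mul]
    exact mul_le_mul (hf a ha).2.1 ((hw a ha).one c) (abs_nonneg _) (hf a ha).nonneg
  rw [abs_le] at h1 h2 ⊢
  constructor <;> nlinarith [h1.1, h1.2, h2.1, h2.2]

theorem abs_pd_pd_sum_mul_le (hf : ∀ a ∈ s, JetBound Λ (f a) x)
    (hw : ∀ a ∈ s, JetBounds (w a) x w₀ w₁ w₂) (c d : Fin n) :
    |pd c (pd d (fun y => ∑ a ∈ s, f a y * w a y)) x| ≤ s.card * (Λ * (w₀ + 2 * w₁ + w₂)) := by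
  have h1 := abs_pd_pd_sum_mul_sub_le hf hw c d
  have h2 : |∑ a ∈ s, f a x * pd c (pd d (w a)) x| ≤ s.card * (Λ * w₂) := by
    rw [← nsmul_eq_mul]
    refine (Finset.abs_sum_le_sum_abs _ _).trans (Finset.sum_le_card_nsmul _ _ _ fun a ha => ?_)
    rw [abs_mul]
    exact mul_le_mul (hf a ha).2.1 ((hw a ha).two c d) (abs_nonneg _) (hf a ha).nonneg
  rw [abs_le] at h1 h2 ⊢
  constructor <;> nlinarith [h1.1, h1.2, h2.1, h2.2]

end products

/-- The bounds on the jet of `v` at `x` used below: `|v|, |∂v| ≤ K`, `|∂²v| ≤ h`, `|∂³v| ≤ τ`. -/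
structure SolJet (v : 𝔼 → ℝ) (x : 𝔼) (K h τ : ℝ) : Prop where
  contDiffAt : ContDiffAt ℝ 4 v x
  zero : |v x| ≤ K
  one : ∀ a, |pd a v x| ≤ K
  two : ∀ a b, |pd a (pd b v) x| ≤ h
  three : ∀ a b c, |pd a (pd b (pd c v)) x| ≤ τ

namespace SolJet

variable {v : EuclideanSpace ℝ (Fin n) → ℝ} {x : EuclideanSpace ℝ (Fin n)} {K h τ : ℝ}

theorem hess (H : SolJet v x K h τ) (a b : Fin n) :
    ContDiffAt ℝ 2 (pd a (pd b v)) x :=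
  contDiffAt_pd (l := 3) (contDiffAt_pd (l := 4) H.contDiffAt (by norm_num) b) (by norm_num) a

theorem grad (H : SolJet v x K h τ) (a : Fin n) : JetBounds (pd a v) x K h τ :=
  ⟨(contDiffAt_pd (k := 3) H.contDiffAt (by norm_num) a).of_le (by norm_num), H.one a,
    fun c => H.two c a, fun c d => H.three c d a⟩

theorem grad_mul_grad (H : SolJet v x K h τ) (a b : Fin n) :
    JetBounds (fun y => pd a v y * pd b v y) x (K ^ 2) (2 * K * h) (2 * (K * τ + h ^ 2)) := by
  have ha := H.grad a
  have hb := H.grad b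
  have hK := (abs_nonneg _).trans H.zero
  have hh := (abs_nonneg _).trans (H.two a a)
  have hm : ∀ {p q P Q : ℝ}, |p| ≤ P → |q| ≤ Q → 0 ≤ P → |p * q| ≤ P * Q := fun hp hq hP => by
    rw [abs_mul]; exact mul_le_mul hp hq (abs_nonneg _) hP
  refine ⟨ha.contDiffAt.mul hb.contDiffAt, ?_, fun c => ?_, fun c d => ?_⟩
  · rw [sq]; exact hm ha.zero hb.zero hK
  · rw [pd_mul (ha.contDiffAt.differentiableAt (by norm_num))
      (hb.contDiffAt.differentiableAt (by norm_num))]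
    refine (abs_add_le _ _).trans ?_
    linarith [hm (ha.one c) hb.zero hh, hm ha.zero (hb.one c) hK]
  · rw [pd_pd_mul ha.contDiffAt hb.contDiffAt]
    have hτ := (abs_nonneg _).trans (ha.two c d)
    have e1 := hm (ha.two c d) hb.zero hτ
    have e2 := hm (ha.one d) (hb.one c) hh
    have e3 := hm (ha.one c) (hb.one d) hh
    have e4 := hm ha.zero (hb.two c d) hK
    rw [abs_le] at e1 e2 e3 e4 ⊢
    constructor <;> nlinarith [e1.1, e1.2, e2.1, e2.2, e3.1, e3.2, e4.1, e4.2]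

theorem exp (H : SolJet v x K h τ) :
    JetBounds (fun y => Real.exp (2 * v y)) x (Real.exp (2 * K)) (Real.exp (2 * K) * (2 * K))
      (Real.exp (2 * K) * (4 * K ^ 2 + 2 * h)) := by
  have hd : ∀ t : ℝ, HasDerivAt (fun t => Real.exp (2 * t)) (2 * Real.exp (2 * t)) t := fun t => by
    have := ((hasDerivAt_id t).const_mul 2).exp
    simpa [mul_comm] using this
  have hC : ContDiffAt ℝ 2 v x := H.contDiffAt.of_le (by norm_num)
  have hK := (abs_nonneg _).trans H.zero
  have he : Real.exp (2 * v x) ≤ Real.exp (2 * K) :=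
    Real.exp_le_exp.2 (by linarith [(abs_le.1 H.zero).2])
  have he0 := Real.exp_pos (2 * v x)
  refine ⟨(contDiffAt_const.mul hC).exp, ?_, fun c => ?_, fun c d => ?_⟩
  · rwa [abs_of_pos he0]
  · rw [pd_comp (hd _) (hC.differentiableAt (by norm_num)), abs_mul, abs_of_pos (by positivity)]
    have := mul_le_mul he (H.one c) (abs_nonneg _) (Real.exp_pos _).le
    linarith
  · rw [pd_pd_comp (Filter.Eventually.of_forall hd) ((hd _).const_mul 2) hC]
    have hh := (abs_nonneg _).trans (H.two c d)
    have e1 : |pd c v x * pd d v x| ≤ K ^ 2 := by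
      rw [abs_mul, sq]; exact mul_le_mul (H.one c) (H.one d) (abs_nonneg _) hK
    have e2 : |4 * (pd c v x * pd d v x) + 2 * pd c (pd d v) x| ≤ 4 * K ^ 2 + 2 * h := by
      have e4 := H.two c d
      rw [abs_le] at e1 e4 ⊢
      constructor <;> linarith [e1.1, e1.2, e4.1, e4.2]
    have e3 := mul_le_mul he e2 (abs_nonneg _) (Real.exp_pos _).le
    rw [← abs_of_pos he0, ← abs_mul] at e3
    refine le_trans (le_of_eq ?_) e3
    congr 1; ring

theorem hessian (H : SolJet v x K h τ) (a b : Fin n) {Q : ℝ}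
    (hQ : ∀ c d a b, |pd c (pd d (pd a (pd b v))) x| ≤ Q) : JetBounds (pd a (pd b v)) x h τ Q :=
  ⟨H.hess a b, H.two a b, fun c => H.three c a b, fun c d => hQ c d a b⟩

end SolJet

/-- A quasilinear expression `L^{ab} v_{ab} + B^{ab} v_a v_b + C^a v_a + D + s e^{2v}`. -/
noncomputable def quasi (v : 𝔼 → ℝ) (L B : Fin n × Fin n → 𝔼 → ℝ) (C : Fin n → 𝔼 → ℝ) (D s : 𝔼 → ℝ) (y : 𝔼) :
    ℝ :=
  ∑ z, L z y * pd z.1 (pd z.2 v) y + ∑ z, B z y * (pd z.1 v y * pd z.2 v y)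
    + ∑ a, C a y * pd a v y + D y + s y * Real.exp (2 * v y)

/-- The pointwise constant in the estimates for the derivatives of a quasilinear expression. -/
noncomputable def quasiConst (n : ℕ) (Λ K : ℝ) : ℝ :=
  Λ * (2 * (n * n) + n * n * (K ^ 2 + 6 * K + 2) + n * (K + 3) + 1
    + Real.exp (2 * K) * (3 + 4 * K + 4 * K ^ 2))

-- Only the counting of orders matters. Apart from the leading terms, one derivative is linear in h,
-- and two derivatives are quadratic in h and linear in τ. The linear growth in τ is what allows it
-- to be absorbed by a multiple of τ² later.
set_option maxHeartbeats 1000000 in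
theorem quasi_jet {v : 𝔼 → ℝ} {x : 𝔼} {K h τ Λ : ℝ} (H : SolJet v x K h τ) (hh : 0 ≤ h)
    (hτ : 0 ≤ τ) {L B : Fin n × Fin n → 𝔼 → ℝ} {C : Fin n → 𝔼 → ℝ} {D s : 𝔼 → ℝ}
    (hL : ∀ z, JetBound Λ (L z) x) (hB : ∀ z, JetBound Λ (B z) x) (hC : ∀ a, JetBound Λ (C a) x)
    (hD : JetBound Λ D x) (hs : JetBound Λ s x) :
    ContDiffAt ℝ 2 (quasi v L B C D s) x ∧
    (∀ c, |pd c (quasi v L B C D s) x - ∑ z, L z x * pd c (pd z.1 (pd z.2 v)) x|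
      ≤ quasiConst n Λ K * (1 + h)) ∧
    ∀ c d, |pd c (pd d (quasi v L B C D s)) x
      - ∑ z, L z x * pd c (pd d (pd z.1 (pd z.2 v))) x|
      ≤ quasiConst n Λ K * (1 + h ^ 2 + τ) := by
  have hΛ := hD.nonneg
  have hK := (abs_nonneg _).trans H.zero
  -- Any bound for the fourth derivatives at x will do: it fills a field of `JetBounds` and drops
  -- out, since the leading part is subtracted.
  obtain ⟨Q, hQ⟩ : ∃ Q, ∀ c d a b, |pd c (pd d (pd a (pd b v))) x| ≤ Q := by
    refine ⟨∑ c, ∑ d, ∑ a, ∑ b, |pd c (pd d (pd a (pd b v))) x|, fun c d a b => ?_⟩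
    refine le_trans ?_ (Finset.single_le_sum (f := fun c => ∑ d, ∑ a, ∑ b,
      |pd c (pd d (pd a (pd b v))) x|) (fun _ _ => by positivity) (Finset.mem_univ c))
    refine le_trans ?_ (Finset.single_le_sum (f := fun d => ∑ a, ∑ b,
      |pd c (pd d (pd a (pd b v))) x|) (fun _ _ => by positivity) (Finset.mem_univ d))
    refine le_trans ?_ (Finset.single_le_sum (f := fun a => ∑ b,
      |pd c (pd d (pd a (pd b v))) x|) (fun _ _ => by positivity) (Finset.mem_univ a))
    exact Finset.single_le_sum (f := fun b => |pd c (pd d (pd a (pd b v))) x|)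
      (fun _ _ => by positivity) (Finset.mem_univ b)
  have j1 : ∀ z ∈ (Finset.univ : Finset (Fin n × Fin n)),
      JetBounds (pd z.1 (pd z.2 v)) x h τ Q := fun z _ => H.hessian z.1 z.2 hQ
  have j2 : ∀ z ∈ (Finset.univ : Finset (Fin n × Fin n)),
      JetBounds (fun y => pd z.1 v y * pd z.2 v y) x _ _ _ := fun z _ => H.grad_mul_grad z.1 z.2
  have j3 : ∀ a ∈ (Finset.univ : Finset (Fin n)), JetBounds (pd a v) x _ _ _ := fun a _ => H.grad a
  -- The exponential term is treated as a sum over one index so that the same product estimates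
  -- apply to it.
  have j4 : ∀ a ∈ ({0} : Finset ℕ), JetBounds (fun y => Real.exp (2 * v y)) x _ _ _ :=
    fun a _ => H.exp
  have k1 : ∀ z ∈ (Finset.univ : Finset (Fin n × Fin n)), JetBound Λ (L z) x := fun z _ => hL z
  have k2 : ∀ z ∈ (Finset.univ : Finset (Fin n × Fin n)), JetBound Λ (B z) x := fun z _ => hB z
  have k3 : ∀ a ∈ (Finset.univ : Finset (Fin n)), JetBound Λ (C a) x := fun a _ => hC a
  have k4 : ∀ a ∈ ({0} : Finset ℕ), JetBound Λ s x := fun a _ => hs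
  set F1 : 𝔼 → ℝ := fun y => ∑ z, L z y * pd z.1 (pd z.2 v) y with hF1
  set F2 : 𝔼 → ℝ := fun y => ∑ z, B z y * (pd z.1 v y * pd z.2 v y) with hF2
  set F3 : 𝔼 → ℝ := fun y => ∑ a, C a y * pd a v y with hF3
  set F4 : 𝔼 → ℝ := fun y => ∑ a ∈ ({0} : Finset ℕ), s y * Real.exp (2 * v y) with hF4
  have c1 : ContDiffAt ℝ 2 F1 x :=
    ContDiffAt.sum fun z hz => (k1 z hz).1.mul (j1 z hz).contDiffAt
  have c2 : ContDiffAt ℝ 2 F2 x :=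
    ContDiffAt.sum fun z hz => (k2 z hz).1.mul (j2 z hz).contDiffAt
  have c3 : ContDiffAt ℝ 2 F3 x :=
    ContDiffAt.sum fun z hz => (k3 z hz).1.mul (j3 z hz).contDiffAt
  have c4 : ContDiffAt ℝ 2 F4 x :=
    ContDiffAt.sum fun z hz => (k4 z hz).1.mul (j4 z hz).contDiffAt
  have hΦ : quasi v L B C D s = fun y => F1 y + F2 y + F3 y + D y + F4 y := by
    ext y; simp [quasi, hF1, hF2, hF3, hF4]
  have c12 := c1.add c2
  have c123 := c12.add c3
  have c123D := c123.add hD.1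
  have hcard : ((Finset.univ : Finset (Fin n × Fin n)).card : ℝ) = n * n := by simp
  have hcard' : ((Finset.univ : Finset (Fin n)).card : ℝ) = n := by simp
  have hcard'' : (({0} : Finset ℕ).card : ℝ) = 1 := by simp
  have he := Real.exp_pos (2 * K)
  have hn : (0 : ℝ) ≤ n := Nat.cast_nonneg n
  have hnn : (0 : ℝ) ≤ n * n := by positivity
  have hd2 : ∀ {f : 𝔼 → ℝ}, ContDiffAt ℝ 2 f x → DifferentiableAt ℝ f x := fun h =>
    h.differentiableAt (by norm_num)
  have hh1 : 2 * h ≤ 1 + h ^ 2 := by nlinarith [sq_nonneg (h - 1)]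
  refine ⟨by rw [hΦ]; exact c123D.add c4, fun c => ?_, fun c d => ?_⟩
  · rw [hΦ, pd_add (hd2 c123D) (hd2 c4), pd_add (hd2 c123) (hd2 hD.1), pd_add (hd2 c12) (hd2 c3),
      pd_add (hd2 c1) (hd2 c2)]
    have e1 := abs_pd_sum_mul_sub_le k1 j1 c
    have e2 := abs_pd_sum_mul_le k2 j2 c
    have e3 := abs_pd_sum_mul_le k3 j3 c
    have e4 := abs_pd_sum_mul_le k4 j4 c
    have e5 := hD.2.2.1 c
    rw [hcard] at e1 e2
    rw [hcard'] at e3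
    rw [hcard''] at e4
    have b1 : n * n * (Λ * h) ≤ n * n * (Λ * (2 * (1 + h))) := by
      gcongr; linarith
    have b2 : n * n * (Λ * (K ^ 2 + 2 * K * h)) ≤ n * n * (Λ * ((K ^ 2 + 6 * K + 2) * (1 + h))) := by
      gcongr; nlinarith [mul_nonneg hK hh, mul_nonneg (sq_nonneg K) hh]
    have b3 : n * (Λ * (K + h)) ≤ n * (Λ * ((K + 3) * (1 + h))) := by
      gcongr; nlinarith [mul_nonneg hK hh]
    have b4 : 1 * (Λ * (Real.exp (2 * K) + Real.exp (2 * K) * (2 * K)))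
        ≤ Λ * (Real.exp (2 * K) * ((3 + 4 * K + 4 * K ^ 2) * (1 + h))) := by
      rw [one_mul, ← mul_one_add]
      gcongr
      nlinarith [mul_nonneg hK hh, mul_nonneg (sq_nonneg K) hh]
    have b5 : Λ ≤ Λ * (1 + h) := le_mul_of_one_le_right hΛ (by linarith)
    have b6 : quasiConst n Λ K * (1 + h) = n * n * (Λ * (2 * (1 + h)))
        + n * n * (Λ * ((K ^ 2 + 6 * K + 2) * (1 + h))) + n * (Λ * ((K + 3) * (1 + h)))
        + Λ * (1 + h) + Λ * (Real.exp (2 * K) * ((3 + 4 * K + 4 * K ^ 2) * (1 + h))) := by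
      unfold quasiConst; ring
    rw [b6]
    exact (abs_add_five_sub_le e1 e2 e3 e5 e4).trans (by linarith)
  · rw [hΦ, pd_pd_add c123D c4, pd_pd_add c123 hD.1, pd_pd_add c12 c3, pd_pd_add c1 c2]
    have e1 := abs_pd_pd_sum_mul_sub_le k1 j1 c d
    have e2 := abs_pd_pd_sum_mul_le k2 j2 c d
    have e3 := abs_pd_pd_sum_mul_le k3 j3 c d
    have e4 := abs_pd_pd_sum_mul_le k4 j4 c d
    have e5 := hD.2.2.2 c d
    rw [hcard] at e1 e2
    rw [hcard'] at e3
    rw [hcard''] at e4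
    have b1 : n * n * (Λ * (h + 2 * τ)) ≤ n * n * (Λ * (2 * (1 + h ^ 2 + τ))) := by
      gcongr; nlinarith
    have b2 : n * n * (Λ * (K ^ 2 + 2 * (2 * K * h) + 2 * (K * τ + h ^ 2)))
        ≤ n * n * (Λ * ((K ^ 2 + 6 * K + 2) * (1 + h ^ 2 + τ))) := by
      gcongr
      nlinarith [mul_nonneg hK hτ, mul_nonneg (sq_nonneg K) (sq_nonneg h),
        mul_nonneg (sq_nonneg K) hτ, mul_nonneg hK (sq_nonneg h), mul_le_mul_of_nonneg_left hh1 hK]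
    have b3 : n * (Λ * (K + 2 * h + τ)) ≤ n * (Λ * ((K + 3) * (1 + h ^ 2 + τ))) := by
      gcongr; nlinarith [mul_nonneg hK hτ, mul_nonneg hK (sq_nonneg h)]
    have b4 : 1 * (Λ * (Real.exp (2 * K) + 2 * (Real.exp (2 * K) * (2 * K))
          + Real.exp (2 * K) * (4 * K ^ 2 + 2 * h)))
        ≤ Λ * (Real.exp (2 * K) * ((3 + 4 * K + 4 * K ^ 2) * (1 + h ^ 2 + τ))) := by
      have : Real.exp (2 * K) + 2 * (Real.exp (2 * K) * (2 * K))
          + Real.exp (2 * K) * (4 * K ^ 2 + 2 * h)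
          = Real.exp (2 * K) * (1 + 4 * K + (4 * K ^ 2 + 2 * h)) := by ring
      rw [one_mul, this]
      gcongr
      nlinarith [mul_nonneg hK hτ, mul_nonneg hK (sq_nonneg h),
        mul_nonneg (sq_nonneg K) (sq_nonneg h), mul_nonneg (sq_nonneg K) hτ]
    have b5 : Λ ≤ Λ * (1 + h ^ 2 + τ) :=
      le_mul_of_one_le_right hΛ (by nlinarith [sq_nonneg h])
    have b6 : quasiConst n Λ K * (1 + h ^ 2 + τ) = n * n * (Λ * (2 * (1 + h ^ 2 + τ)))
        + n * n * (Λ * ((K ^ 2 + 6 * K + 2) * (1 + h ^ 2 + τ)))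
        + n * (Λ * ((K + 3) * (1 + h ^ 2 + τ)))
        + Λ * (1 + h ^ 2 + τ)
        + Λ * (Real.exp (2 * K) * ((3 + 4 * K + 4 * K ^ 2) * (1 + h ^ 2 + τ))) := by
      unfold quasiConst; ring
    rw [b6]
    exact (abs_add_five_sub_le e1 e2 e3 e5 e4).trans (by linarith)

end

/-! ### The second order inequality at a contact point -/

section

variable {n : ℕ}

local notation "𝔼" => EuclideanSpace ℝ (Fin n)

/-- At `x` the function `v` satisfies a quasilinear relation of the form `quasi v L B C D s ≥ 0`
near `x` with equality at `x`, whose coefficients have `2`-jets bounded by `Λ` and whose leading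
part is elliptic with constant `c`. -/
def HasBarrier (v : 𝔼 → ℝ) (Λ c : ℝ) (x : 𝔼) : Prop :=
  ∃ (L B : Fin n × Fin n → 𝔼 → ℝ) (C : Fin n → 𝔼 → ℝ) (D s : 𝔼 → ℝ),
    (∀ z, JetBound Λ (L z) x) ∧ (∀ z, JetBound Λ (B z) x) ∧ (∀ a, JetBound Λ (C a) x) ∧
    JetBound Λ D x ∧ JetBound Λ s x ∧ (∀ a b, L (a, b) x = L (b, a) x) ∧
    (∀ ξ : Fin n → ℝ, c * ∑ i, ξ i ^ 2 ≤ ∑ z : Fin n × Fin n, L z x * (ξ z.1 * ξ z.2)) ∧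
    (∀ᶠ y in 𝓝 x, 0 ≤ quasi v L B C D s y) ∧ quasi v L B C D s x = 0

/-- The trace of the Hessian with respect to `γ`. -/
noncomputable def trHess (γ : Fin n × Fin n → 𝔼 → ℝ) (v : 𝔼 → ℝ) (y : 𝔼) : ℝ :=
  ∑ z, γ z y * pd z.1 (pd z.2 v) y

theorem abs_sum_mul_le {ι : Type*} [Fintype ι] {a b : ι → ℝ} {A B : ℝ} (hA : 0 ≤ A)
    (ha : ∀ z, |a z| ≤ A) (hb : ∀ z, |b z| ≤ B) :
    |∑ z, a z * b z| ≤ Fintype.card ι * (A * B) := by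
  rw [← nsmul_eq_mul]
  refine (Finset.abs_sum_le_sum_abs _ _).trans (Finset.sum_le_card_nsmul _ _ _ fun z _ => ?_)
  rw [abs_mul]
  exact mul_le_mul (ha z) (hb z) (abs_nonneg _) hA

theorem posSemidef_of_quadratic {L : Fin n × Fin n → ℝ} (hs : ∀ a b, L (a, b) = L (b, a))
    (h : ∀ ξ : Fin n → ℝ, 0 ≤ ∑ z : Fin n × Fin n, L z * (ξ z.1 * ξ z.2)) :
    (Matrix.of fun a b => L (a, b)).PosSemidef := by
  refine Matrix.PosSemidef.of_dotProduct_mulVec_nonneg ?_ fun ξ => ?_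
  · ext a b; simp [hs a b]
  · refine (h ξ).trans (le_of_eq ?_)
    rw [Fintype.sum_prod_type]
    simp only [dotProduct, Matrix.mulVec, Matrix.of_apply, star_trivial, Finset.mul_sum]
    exact Finset.sum_congr rfl fun a _ => Finset.sum_congr rfl fun b _ => by ring

/-- The gap ϖ² - (|D²v|² + N w²) is minimal where ϖ² touches from above. Its Hessian separates the
quadratic third order terms, which become favourable after contraction with L, from the fourth order
ones. -/
theorem pd_pd_gap {v : 𝔼 → ℝ} {γ : Fin n × Fin n → 𝔼 → ℝ} {ϖ : 𝔼 → ℝ} {x : 𝔼} {N : ℝ}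
    (hv : ∀ a b, ContDiffAt ℝ 2 (pd a (pd b v)) x) (hw : ContDiffAt ℝ 2 (trHess γ v) x)
    (hϖ : ContDiffAt ℝ 2 (fun y => ϖ y ^ 2) x) (i j : Fin n) :
    ContDiffAt ℝ 2 (fun y => ϖ y ^ 2 + (-1) * (∑ z : Fin n × Fin n,
      pd z.1 (pd z.2 v) y * pd z.1 (pd z.2 v) y + N * (trHess γ v y * trHess γ v y))) x ∧
    pd i (pd j (fun y => ϖ y ^ 2 + (-1) * (∑ z : Fin n × Fin n,
      pd z.1 (pd z.2 v) y * pd z.1 (pd z.2 v) y + N * (trHess γ v y * trHess γ v y)))) x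
      = pd i (pd j (fun y => ϖ y ^ 2)) x
        - 2 * ∑ z : Fin n × Fin n, pd i (pd z.1 (pd z.2 v)) x * pd j (pd z.1 (pd z.2 v)) x
        - 2 * ∑ z : Fin n × Fin n, pd z.1 (pd z.2 v) x * pd i (pd j (pd z.1 (pd z.2 v))) x
        - 2 * N * (pd i (trHess γ v) x * pd j (trHess γ v) x)
        - 2 * N * (trHess γ v x * pd i (pd j (trHess γ v)) x) := by
  have h1 : ∀ z ∈ (Finset.univ : Finset (Fin n × Fin n)), ContDiffAt ℝ 2
      (fun y => pd z.1 (pd z.2 v) y * pd z.1 (pd z.2 v) y) x :=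
    fun z _ => (hv z.1 z.2).mul (hv z.1 z.2)
  have h2 : ContDiffAt ℝ 2 (fun y => ∑ z : Fin n × Fin n,
      pd z.1 (pd z.2 v) y * pd z.1 (pd z.2 v) y) x := ContDiffAt.sum h1
  have h3 := hw.mul hw
  have h4 : ContDiffAt ℝ 2 (fun y => N * (trHess γ v y * trHess γ v y)) x :=
    contDiffAt_const.mul h3
  have h5 := h2.add h4
  refine ⟨hϖ.add (contDiffAt_const.mul h5), ?_⟩
  rw [pd_pd_add hϖ (contDiffAt_const.mul h5), pd_pd_const_mul h5, pd_pd_add h2 h4,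
    pd_pd_const_mul h3, pd_pd_sum h1, pd_pd_mul hw hw]
  have h6 : ∀ z ∈ (Finset.univ : Finset (Fin n × Fin n)),
      pd i (pd j (fun y => pd z.1 (pd z.2 v) y * pd z.1 (pd z.2 v) y)) x
      = 2 * (pd i (pd z.1 (pd z.2 v)) x * pd j (pd z.1 (pd z.2 v)) x)
        + 2 * (pd z.1 (pd z.2 v) x * pd i (pd j (pd z.1 (pd z.2 v))) x) := by
    intro z _
    rw [pd_pd_mul (hv z.1 z.2) (hv z.1 z.2)]; ring
  rw [Finset.sum_congr rfl h6, Finset.sum_add_distrib, ← Finset.mul_sum, ← Finset.mul_sum]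
  ring

/-- Young's inequality 2 h C₃ τ ≤ 2 c τ² + C₃² h² / (2c); what remains is cubic in h. -/
theorem absorb_third_order {c C₃ h τ S : ℝ} (hc : 0 < c) (hC : 0 ≤ C₃) (hh : 0 ≤ h)
    (H : 0 ≤ S - 2 * (c * τ ^ 2) + 2 * (h * C₃ * (1 + h ^ 2 + τ))) :
    0 ≤ S + (2 * C₃ + C₃ ^ 2 / (2 * c)) * (1 + h) ^ 3 := by
  have h1 : 2 * (h * C₃ * τ) ≤ 2 * (c * τ ^ 2) + C₃ ^ 2 / (2 * c) * h ^ 2 := by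
    have h2 : C₃ ^ 2 / (2 * c) * h ^ 2 = (C₃ * h) ^ 2 / (2 * c) := by ring
    rw [h2, ← sub_le_iff_le_add', le_div_iff₀ (by positivity)]
    nlinarith [sq_nonneg (2 * c * τ - C₃ * h)]
  have h3 : 0 ≤ C₃ ^ 2 / (2 * c) := by positivity
  have h4 : h * (1 + h ^ 2) ≤ (1 + h) ^ 3 := by nlinarith [pow_nonneg hh 2, pow_nonneg hh 3]
  have h5 : h ^ 2 ≤ (1 + h) ^ 3 := by nlinarith [pow_nonneg hh 2, pow_nonneg hh 3]
  have h6 := mul_le_mul_of_nonneg_left h4 hC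
  have h7 := mul_le_mul_of_nonneg_left h5 h3
  nlinarith

-- Two functions are minimal at x: the barrier Φ and the gap between ϖ² and |D²v|² + N w².
-- Contracting ∂²Φ ≥ 0 with Z = D²v + N w γ, and the Hessian of the gap with L, produces the same
-- fourth order term Z : L : ∂⁴v with opposite signs, so it cancels. The vanishing of ∂Φ gives the
-- bound for L : ∂_a D²v.
set_option maxHeartbeats 1000000 in
theorem second_order_inequality (n : ℕ) {Λ K c N : ℝ} (hΛ : 0 ≤ Λ) (hK : 0 ≤ K) (hc : 0 < c)
    (hN : 0 ≤ N) : ∃ C : ℝ, 0 ≤ C ∧ ∀ (v : EuclideanSpace ℝ (Fin n) → ℝ)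
      (γ : Fin n × Fin n → EuclideanSpace ℝ (Fin n) → ℝ) (x : EuclideanSpace ℝ (Fin n))
      (ϖ : EuclideanSpace ℝ (Fin n) → ℝ) (h : ℝ),
      ContDiffAt ℝ 4 v x → |v x| ≤ K → (∀ a, |pd a v x| ≤ K) → (∀ z, JetBound Λ (γ z) x) →
      HasBarrier v Λ c x → 0 ≤ h → h ^ 2 = ∑ z : Fin n × Fin n, pd z.1 (pd z.2 v) x ^ 2 →
      (Matrix.of fun a b => pd a (pd b v) x + N * trHess γ v x * γ (a, b) x).PosSemidef →
      ContDiffAt ℝ 2 (fun y => ϖ y ^ 2) x →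
      (∀ᶠ y in 𝓝 x, ∑ z : Fin n × Fin n, pd z.1 (pd z.2 v) y ^ 2 + N * trHess γ v y ^ 2
        ≤ ϖ y ^ 2) →
      ∑ z : Fin n × Fin n, pd z.1 (pd z.2 v) x ^ 2 + N * trHess γ v x ^ 2 = ϖ x ^ 2 →
      ∃ L : Fin n × Fin n → ℝ, (∀ z, |L z| ≤ Λ) ∧
        (∀ ξ : Fin n → ℝ, c * ∑ i, ξ i ^ 2 ≤ ∑ z : Fin n × Fin n, L z * (ξ z.1 * ξ z.2)) ∧
        (∀ a, |∑ z : Fin n × Fin n, L z * pd a (pd z.1 (pd z.2 v)) x| ≤ C * (1 + h)) ∧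
        0 ≤ ∑ z : Fin n × Fin n, L z * pd z.1 (pd z.2 (fun y => ϖ y ^ 2)) x
          + C * (1 + h) ^ 3 := by
  have hC₀ : 0 ≤ quasiConst n Λ K := by unfold quasiConst; positivity
  set C₀ := quasiConst n Λ K with hC₀def
  set m : ℝ := n * n with hm
  have hm0 : 0 ≤ m := by positivity
  set C₃ := m * ((1 + N * m * Λ ^ 2) * C₀) + 2 * N * m ^ 3 * Λ ^ 3 with hC₃
  have hC₃0 : 0 ≤ C₃ := by positivity
  have hC₃c : 0 ≤ C₃ ^ 2 / (2 * c) := by positivity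
  refine ⟨C₀ + (2 * C₃ + C₃ ^ 2 / (2 * c)), by positivity, ?_⟩
  intro v γ x ϖ h hv hv0 hv1 hγ hbar hh hh2 hZ hϖ hle heq
  obtain ⟨L, B, C, D, s, hL, hB, hC, hD, hs, hsym, hell, hnn, h0⟩ := hbar
  set T : Fin n → Fin n × Fin n → ℝ := fun i z => pd i (pd z.1 (pd z.2 v)) x with hT
  set τ := √(∑ z, ∑ i, T i z ^ 2) with hτdef
  have hτ2 : τ ^ 2 = ∑ z, ∑ i, T i z ^ 2 := Real.sq_sqrt (by positivity)
  have hτ0 : 0 ≤ τ := Real.sqrt_nonneg _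
  have hcard : (Fintype.card (Fin n × Fin n) : ℝ) = m := by simp [hm]
  have hH : ∀ a b, |pd a (pd b v) x| ≤ h := by
    intro a b
    refine abs_le_of_sq_le_sq ?_ hh
    rw [hh2]
    exact Finset.single_le_sum (f := fun z : Fin n × Fin n => pd z.1 (pd z.2 v) x ^ 2)
      (fun _ _ => sq_nonneg _) (Finset.mem_univ (a, b))
  have hT' : ∀ a b c, |pd a (pd b (pd c v)) x| ≤ τ := by
    intro a b c
    refine abs_le_of_sq_le_sq ?_ hτ0
    rw [hτ2]
    refine le_trans ?_ (Finset.single_le_sum (f := fun z => ∑ i, T i z ^ 2)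
      (fun _ _ => by positivity) (Finset.mem_univ (b, c)))
    exact Finset.single_le_sum (f := fun i => T i (b, c) ^ 2)
      (fun _ _ => sq_nonneg _) (Finset.mem_univ a)
  have J : SolJet v x K h τ := ⟨hv, hv0, hv1, hH, hT'⟩
  obtain ⟨hΦC, hΦ1, hΦ2⟩ := quasi_jet J hh hτ0 hL hB hC hD hs
  have hΦmin : IsLocalMin (quasi v L B C D s) x := by
    filter_upwards [hnn] with y hy
    rw [h0]; exact hy
  have hd1 : ∀ a, pd a (quasi v L B C D s) x = 0 := fun a => by
    rw [pd, hΦmin.fderiv_eq_zero]; rfl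
  refine ⟨fun z => L z x, fun z => (hL z).2.1, hell, fun a => ?_, ?_⟩
  · have := hΦ1 a
    rw [hd1, zero_sub, abs_neg] at this
    refine this.trans ?_
    have : 0 ≤ (2 * C₃ + C₃ ^ 2 / (2 * c)) * (1 + h) := by positivity
    linarith
  set Q : Fin n × Fin n → Fin n × Fin n → ℝ :=
    fun z z' => pd z.1 (pd z.2 (pd z'.1 (pd z'.2 v))) x with hQ
  have hQc : ∀ z z', Q z z' = Q z' z := fun z z' => pd_pd_pd_pd_comm hv _ _ _ _
  set w := trHess γ v x with hw
  have hwC : ContDiffAt ℝ 2 (trHess γ v) x :=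
    ContDiffAt.sum fun z _ => (hγ z).1.mul (J.hess z.1 z.2)
  set W : Fin n × Fin n → ℝ := fun z => pd z.1 (pd z.2 (fun y => ϖ y ^ 2)) x with hW
  set w1 : Fin n → ℝ := fun i => pd i (trHess γ v) x with hw1
  set w2 : Fin n × Fin n → ℝ := fun z => pd z.1 (pd z.2 (trHess γ v)) x with hw2
  set X := 1 + h ^ 2 + τ with hX
  have hX0 : 0 ≤ X := by positivity
  -- the three contributions of the second derivatives of the gap function
  have hA1 : c * τ ^ 2 ≤ ∑ z, L z x * ∑ z', T z.1 z' * T z.2 z' := by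
    rw [hτ2, Finset.mul_sum]
    refine (Finset.sum_le_sum fun z' _ => hell fun i => T i z').trans (le_of_eq ?_)
    rw [Finset.sum_comm]
    exact Finset.sum_congr rfl fun z _ => by rw [Finset.mul_sum]
  have hA2 : 0 ≤ ∑ z, L z x * (w1 z.1 * w1 z.2) :=
    le_trans (by positivity) (hell w1)
  have hwabs : |w| ≤ m * (Λ * h) := by
    have := abs_sum_mul_le (ι := Fin n × Fin n) hΛ (fun z => (hγ z).2.1) (fun z => hH z.1 z.2)
    rwa [hcard] at this
  -- The error made in ∂²w when both derivatives are put on D²v; it is linear in h and τ.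
  set e : Fin n × Fin n → ℝ := fun z => w2 z - ∑ z', γ z' x * Q z z' with he
  obtain ⟨q, hq⟩ : ∃ q, ∀ c d a b, |pd c (pd d (pd a (pd b v))) x| ≤ q := by
    refine ⟨∑ z, ∑ z', |Q z z'|, fun c d a b => ?_⟩
    refine le_trans ?_ (Finset.single_le_sum (f := fun z => ∑ z', |Q z z'|)
      (fun _ _ => by positivity) (Finset.mem_univ (c, d)))
    exact Finset.single_le_sum (f := fun z' => |Q (c, d) z'|)
      (fun _ _ => by positivity) (Finset.mem_univ (a, b))
  have heabs : ∀ z, |e z| ≤ m * (Λ * (h + 2 * τ)) := by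
    intro z
    have := abs_pd_pd_sum_mul_sub_le (s := Finset.univ) (f := γ)
      (w := fun z : Fin n × Fin n => pd z.1 (pd z.2 v)) (fun z _ => hγ z)
      (fun z _ => J.hessian z.1 z.2 hq) z.1 z.2
    rw [Finset.card_univ, hcard] at this
    exact this
  have hLe : |∑ z, L z x * e z| ≤ m * (Λ * (m * (Λ * (h + 2 * τ)))) := by
    have := abs_sum_mul_le hΛ (fun z => (hL z).2.1) heabs
    rwa [hcard] at this
  set Z : Fin n × Fin n → ℝ := fun z => pd z.1 (pd z.2 v) x + N * w * γ z x with hZdef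
  have hZabs : ∀ z, |Z z| ≤ h * (1 + N * m * Λ ^ 2) := by
    intro z
    refine (abs_add_le _ _).trans ?_
    have h1 : |N * w * γ z x| ≤ N * (m * (Λ * h)) * Λ := by
      rw [abs_mul, abs_mul, abs_of_nonneg hN]
      exact mul_le_mul (mul_le_mul_of_nonneg_left hwabs hN) (hγ z).2.1 (abs_nonneg _)
        (by positivity)
    have := hH z.1 z.2
    linarith
  have hZΦ : 0 ≤ ∑ z, Z z * pd z.1 (pd z.2 (quasi v L B C D s)) x := by
    have := sum_mul_pd_pd_nonneg hΦC hΦmin hZ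
    rw [Fintype.sum_prod_type]
    exact this
  have hZQ : -(m * (h * (1 + N * m * Λ ^ 2) * (C₀ * X))) ≤ ∑ z, Z z * ∑ z', L z' x * Q z z' := by
    have h1 := abs_sum_mul_le (a := Z) (by positivity) hZabs (fun z => hΦ2 z.1 z.2)
    rw [hcard] at h1
    simp only [mul_sub, Finset.sum_sub_distrib] at h1
    have := (abs_le.1 h1).2
    linarith
  -- Partial derivatives commute, so the fourth order term of the gap is the one controlled by the
  -- barrier.
  have hswap : ∑ z, L z x * ∑ z', Z z' * Q z z' = ∑ z, Z z * ∑ z', L z' x * Q z z' := by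
    simp only [Finset.mul_sum]
    rw [Finset.sum_comm]
    refine Finset.sum_congr rfl fun z _ => Finset.sum_congr rfl fun z' _ => ?_
    rw [hQc]; ring
  have hA3 : ∑ z, L z x * (∑ z', pd z'.1 (pd z'.2 v) x * Q z z' + N * (w * w2 z))
      = ∑ z, L z x * ∑ z', Z z' * Q z z' + N * w * ∑ z, L z x * e z := by
    rw [Finset.mul_sum, ← Finset.sum_add_distrib]
    refine Finset.sum_congr rfl fun z _ => ?_
    simp only [hZdef, he, add_mul, Finset.sum_add_distrib]
    have : ∑ z', N * w * γ z' x * Q z z' = N * w * ∑ z', γ z' x * Q z z' := by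
      rw [Finset.mul_sum]; exact Finset.sum_congr rfl fun _ _ => by ring
    rw [this]; ring
  have hA3' : -(h * C₃ * X) ≤
      ∑ z, L z x * (∑ z', pd z'.1 (pd z'.2 v) x * Q z z' + N * (w * w2 z)) := by
    rw [hA3, hswap]
    have h1 : |N * w * ∑ z, L z x * e z|
        ≤ N * (m * (Λ * h)) * (m * (Λ * (m * (Λ * (h + 2 * τ))))) := by
      rw [abs_mul, abs_mul, abs_of_nonneg hN]
      exact mul_le_mul (mul_le_mul_of_nonneg_left hwabs hN) hLe (abs_nonneg _) (by positivity)
    have h2 : N * (m * (Λ * h)) * (m * (Λ * (m * (Λ * (h + 2 * τ)))))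
        ≤ N * (m * (Λ * h)) * (m * (Λ * (m * (Λ * (2 * X))))) := by
      gcongr
      nlinarith [sq_nonneg (h - 1)]
    have h3 := (abs_le.1 h1).1
    have h4 : h * C₃ * X = m * (h * (1 + N * m * Λ ^ 2) * (C₀ * X))
        + N * (m * (Λ * h)) * (m * (Λ * (m * (Λ * (2 * X))))) := by rw [hC₃]; ring
    linarith
  -- the gap function has a local minimum at `x`
  set ψ : EuclideanSpace ℝ (Fin n) → ℝ := fun y => ϖ y ^ 2 + (-1) * (∑ z : Fin n × Fin n,
      pd z.1 (pd z.2 v) y * pd z.1 (pd z.2 v) y + N * (trHess γ v y * trHess γ v y)) with hψ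
  have hψeq : ∀ y, ψ y = ϖ y ^ 2
      - (∑ z : Fin n × Fin n, pd z.1 (pd z.2 v) y ^ 2 + N * trHess γ v y ^ 2) := by
    intro y; simp only [hψ, sq]; ring
  have hψmin : IsLocalMin ψ x := by
    filter_upwards [hle] with y hy
    rw [hψeq, hψeq, heq]; linarith
  have hgap := fun i j => pd_pd_gap (N := N) (γ := γ) J.hess hwC hϖ i j
  have hLpsd := posSemidef_of_quadratic (L := fun z => L z x) hsym
    fun ξ => le_trans (by positivity) (hell ξ)
  have hsum : 0 ≤ ∑ z, L z x * pd z.1 (pd z.2 ψ) x := by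
    -- `hgap` yields the regularity of ψ only for a given pair of indices, so the empty index set is
    -- treated apart.
    rcases isEmpty_or_nonempty (Fin n) with hn | ⟨⟨i⟩⟩
    · simp
    · have := sum_mul_pd_pd_nonneg (hgap i i).1 hψmin hLpsd
      rw [Fintype.sum_prod_type]
      exact this
  have hexp : ∑ z, L z x * pd z.1 (pd z.2 ψ) x = ∑ z, L z x * W z
      - 2 * ∑ z, L z x * ∑ z', T z.1 z' * T z.2 z'
      - 2 * N * ∑ z, L z x * (w1 z.1 * w1 z.2)
      - 2 * ∑ z, L z x * (∑ z', pd z'.1 (pd z'.2 v) x * Q z z' + N * (w * w2 z)) := by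
    simp only [Finset.mul_sum (a := (2 : ℝ)), Finset.mul_sum (a := 2 * N), ← Finset.sum_sub_distrib]
    refine Finset.sum_congr rfl fun z _ => ?_
    rw [(hgap z.1 z.2).2]
    simp only [hT, hQ, hW, hw1, hw2, hw]
    ring
  rw [hexp] at hsum
  have hfin := absorb_third_order (S := ∑ z, L z x * W z) (τ := τ) hc hC₃0 hh (by
    have := mul_nonneg (mul_nonneg zero_le_two hN) hA2
    linarith)
  have : 0 ≤ C₀ * (1 + h) ^ 3 := by positivity
  linarith

end

/-! ### The cut-off function and the auxiliary terms -/

section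

variable {n : ℕ}

local notation "𝔼" => EuclideanSpace ℝ (Fin n)

/-- The cut-off function `R² - |y - y₀|²`. -/
noncomputable def cutoff (y₀ : 𝔼) (R : ℝ) (y : 𝔼) : ℝ := R ^ 2 - ∑ a, (y a - y₀ a) ^ 2

theorem cutoff_eq (y₀ y : 𝔼) (R : ℝ) : cutoff y₀ R y = R ^ 2 - dist y y₀ ^ 2 := by
  rw [cutoff, EuclideanSpace.dist_eq, Real.sq_sqrt (by positivity)]
  simp [Real.dist_eq]

theorem contDiff_cutoff (y₀ : 𝔼) (R : ℝ) : ContDiff ℝ 2 (cutoff y₀ R) := by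
  have : cutoff y₀ R = fun y => R ^ 2 - ∑ a, (y a - y₀ a) ^ 2 := rfl
  rw [this]
  fun_prop

theorem pd_coord (i a : Fin n) (y : 𝔼) : pd i (fun y : 𝔼 => y a) y = if i = a then 1 else 0 := by
  have h : fderiv ℝ (fun y : 𝔼 => y a) y = EuclideanSpace.proj a :=
    (EuclideanSpace.proj a : 𝔼 →L[ℝ] ℝ).fderiv
  rw [pd, h]
  simp [eq_comm]

theorem pd_cutoff (y₀ : 𝔼) (R : ℝ) (i : Fin n) (y : 𝔼) :
    pd i (cutoff y₀ R) y = -2 * (y i - y₀ i) := by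
  have hd : ∀ a : Fin n, DifferentiableAt ℝ (fun y : 𝔼 => y a - y₀ a) y := fun a => by fun_prop
  have hd' : ∀ a : Fin n, DifferentiableAt ℝ (fun y : 𝔼 => y a) y := fun a => by fun_prop
  have h1 : ∀ a ∈ Finset.univ, pd i (fun y : 𝔼 => (y a - y₀ a) ^ 2) y
      = if i = a then 2 * (y a - y₀ a) else 0 := by
    intro a _
    rw [pd_comp (g := fun t => t ^ 2) (hasDerivAt_pow 2 _) (hd a),
      pd_sub (hd' a) (differentiableAt_const _), pd_const, pd_coord]
    split_ifs <;> simp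
  have : cutoff y₀ R = fun y => R ^ 2 - ∑ a, (y a - y₀ a) ^ 2 := rfl
  rw [this, pd_sub (differentiableAt_const _) (by fun_prop), pd_const,
    pd_sum (fun a _ => (hd a).fun_pow 2), Finset.sum_congr rfl h1]
  simp

theorem pd_pd_cutoff (y₀ : 𝔼) (R : ℝ) (i j : Fin n) (y : 𝔼) :
    pd i (pd j (cutoff y₀ R)) y = if i = j then -2 else 0 := by
  have : pd j (cutoff y₀ R) = fun y => -2 * (y j - y₀ j) := funext fun y => pd_cutoff y₀ R j y
  have hd' : ∀ a : Fin n, DifferentiableAt ℝ (fun y : 𝔼 => y a) y := fun a => by fun_prop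
  rw [this, pd_const_mul (by fun_prop), pd_sub (hd' j) (differentiableAt_const _), pd_const,
    pd_coord]
  split_ifs <;> simp

theorem cutoff_inv_sq_jet (y₀ x : 𝔼) {R : ℝ} (hR : 0 < R) (hx : 0 < cutoff y₀ R x) :
    ContDiffAt ℝ 2 (fun y => (cutoff y₀ R y ^ 2)⁻¹) x ∧
    (∀ i, |pd i (fun y => (cutoff y₀ R y ^ 2)⁻¹) x| ≤ 4 * R * (cutoff y₀ R x ^ 3)⁻¹) ∧
    ∀ i j, |pd i (pd j (fun y => (cutoff y₀ R y ^ 2)⁻¹)) x|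
      ≤ 28 * R ^ 2 * (cutoff y₀ R x ^ 4)⁻¹ := by
  set X := cutoff y₀ R x with hX
  have hXR : X ≤ R ^ 2 := by rw [hX, cutoff_eq]; nlinarith [sq_nonneg (dist x y₀)]
  have hdist : dist x y₀ ≤ R := by
    rw [hX, cutoff_eq] at hx
    exact abs_le_of_sq_le_sq' (by linarith) hR.le |>.2
  have hc : ∀ i, |pd i (cutoff y₀ R) x| ≤ 2 * R := by
    intro i
    rw [pd_cutoff, abs_mul]
    have h1 : |x i - y₀ i| ≤ R := by
      refine (le_trans ?_ hdist)
      rw [dist_eq_norm]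
      exact PiLp.norm_apply_le (x - y₀) i
    norm_num
    linarith
  have hC := (contDiff_cutoff y₀ R).contDiffAt (x := x)
  have hg : ∀ t : ℝ, t ≠ 0 → HasDerivAt (fun t : ℝ => (t ^ 2)⁻¹) (-2 * (t ^ 3)⁻¹) t := by
    intro t ht
    have := (hasDerivAt_pow 2 t).inv (pow_ne_zero 2 ht)
    convert! this using 1
    field_simp
    norm_num
  have hg' : ∀ t : ℝ, t ≠ 0 → HasDerivAt (fun t : ℝ => -2 * (t ^ 3)⁻¹) (6 * (t ^ 4)⁻¹) t := by
    intro t ht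
    have := ((hasDerivAt_pow 3 t).inv (pow_ne_zero 3 ht)).const_mul (-2)
    convert! this using 1
    field_simp
    norm_num
  refine ⟨(hC.pow 2).inv (pow_ne_zero 2 hx.ne'), fun i => ?_, fun i j => ?_⟩
  · rw [pd_comp (g := fun t => (t ^ 2)⁻¹) (hg _ hx.ne') (hC.differentiableAt (by norm_num)),
      abs_mul, abs_mul, ← hX, abs_of_pos (inv_pos.2 (pow_pos hx 3))]
    norm_num
    have := mul_le_mul_of_nonneg_left (hc i) (inv_pos.2 (pow_pos hx 3)).le
    linarith
  · have hev : ∀ᶠ t in 𝓝 (cutoff y₀ R x),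
        HasDerivAt (fun t : ℝ => (t ^ 2)⁻¹) (-2 * (t ^ 3)⁻¹) t := by
      filter_upwards [eventually_ne_nhds hx.ne'] with t ht using hg t ht
    rw [pd_pd_comp (g := fun t => (t ^ 2)⁻¹) hev (hg' _ hx.ne') hC, ← hX]
    have e1 : |6 * (X ^ 4)⁻¹ * pd i (cutoff y₀ R) x * pd j (cutoff y₀ R) x|
        ≤ 6 * (X ^ 4)⁻¹ * (2 * R) * (2 * R) := by
      have h6 : 0 ≤ 6 * (X ^ 4)⁻¹ := by positivity
      rw [abs_mul, abs_mul, abs_of_nonneg h6]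
      exact mul_le_mul (mul_le_mul_of_nonneg_left (hc i) h6) (hc j) (abs_nonneg _) (by positivity)
    have e2 : |-2 * (X ^ 3)⁻¹ * pd i (pd j (cutoff y₀ R)) x| ≤ 4 * (X ^ 3)⁻¹ := by
      have h3 : |pd i (pd j (cutoff y₀ R)) x| ≤ 2 := by
        rw [pd_pd_cutoff]; split_ifs <;> norm_num
      have h6 : 0 ≤ (X ^ 3)⁻¹ := by positivity
      rw [abs_mul, abs_mul, abs_of_nonneg h6]
      norm_num
      nlinarith
    have e3 : (X ^ 3)⁻¹ ≤ R ^ 2 * (X ^ 4)⁻¹ := by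
      rw [show (X ^ 3)⁻¹ = X * (X ^ 4)⁻¹ by field_simp]
      gcongr
    refine (abs_add_le _ _).trans ?_
    nlinarith

/-- The square of the length of the gradient in coordinates. -/
noncomputable def gradSum (v : 𝔼 → ℝ) (y : 𝔼) : ℝ := ∑ a, pd a v y * pd a v y

/-- In the third derivatives the index a is moved outside, so that contraction with L produces L :
∂_a D²v, which the first order condition on the barrier controls. -/
theorem gradSum_jet {v : 𝔼 → ℝ} {x : 𝔼} (hv : ContDiffAt ℝ 4 v x) :
    ContDiffAt ℝ 2 (gradSum v) x ∧
    (∀ i, pd i (gradSum v) x = 2 * ∑ a, pd a v x * pd i (pd a v) x) ∧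
    ∀ i j, pd i (pd j (gradSum v)) x
      = 2 * ∑ a, pd i (pd a v) x * pd j (pd a v) x
        + 2 * ∑ a, pd a v x * pd a (pd i (pd j v)) x := by
  have h1 : ∀ a, ContDiffAt ℝ 2 (pd a v) x := fun a =>
    (contDiffAt_pd (k := 3) hv (by norm_num) a).of_le (by norm_num)
  have hd : ∀ a, DifferentiableAt ℝ (pd a v) x := fun a => (h1 a).differentiableAt (by norm_num)
  have he : gradSum v = fun y => ∑ a, pd a v y * pd a v y := rfl
  refine ⟨ContDiffAt.sum fun a _ => (h1 a).mul (h1 a), fun i => ?_, fun i j => ?_⟩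
  · rw [he, pd_sum fun a _ => (hd a).fun_mul (hd a), Finset.mul_sum]
    refine Finset.sum_congr rfl fun a _ => ?_
    rw [pd_mul (hd a) (hd a)]; ring
  · rw [he, pd_pd_sum fun a _ => (h1 a).mul (h1 a), Finset.mul_sum, Finset.mul_sum,
      ← Finset.sum_add_distrib]
    refine Finset.sum_congr rfl fun a _ => ?_
    rw [pd_pd_mul (h1 a) (h1 a), pd_pd_pd_comm (hv.of_le (by norm_num)) i j a]; ring

theorem pd_pd_sq_sub {f g : 𝔼 → ℝ} {x : 𝔼} (hf : ContDiffAt ℝ 2 f x) (hg : ContDiffAt ℝ 2 g x)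
    (κ N : ℝ) :
    ContDiffAt ℝ 2 (fun y => (κ * f y + -N * g y) ^ 2) x ∧
    ∀ i j, pd i (pd j (fun y => (κ * f y + -N * g y) ^ 2)) x
      = 2 * ((κ * pd i f x + -N * pd i g x) * (κ * pd j f x + -N * pd j g x))
        + 2 * (κ * f x + -N * g x) * (κ * pd i (pd j f) x + -N * pd i (pd j g) x) := by
  have h1 : ContDiffAt ℝ 2 (fun y => κ * f y) x := contDiffAt_const.mul hf
  have h2 : ContDiffAt ℝ 2 (fun y => -N * g y) x := contDiffAt_const.mul hg
  have h3 := h1.add h2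
  have hp : ∀ i, pd i (fun y => κ * f y + -N * g y) x = κ * pd i f x + -N * pd i g x := by
    intro i
    rw [pd_add (h1.differentiableAt (by norm_num)) (h2.differentiableAt (by norm_num)),
      pd_const_mul (hf.differentiableAt (by norm_num)),
      pd_const_mul (hg.differentiableAt (by norm_num))]
  refine ⟨h3.pow 2, fun i j => ?_⟩
  have : (fun y => (κ * f y + -N * g y) ^ 2)
      = fun y => (κ * f y + -N * g y) * (κ * f y + -N * g y) := funext fun y => sq _
  rw [this, pd_pd_mul h3 h3, hp, hp, pd_pd_add h1 h2, pd_pd_const_mul hf, pd_pd_const_mul hg]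
  ring

theorem abs_quadratic_le {A : Fin n × Fin n → ℝ} {h : ℝ} (hh : 0 ≤ h) (hA : ∑ z, A z ^ 2 = h ^ 2)
    (ξ : Fin n → ℝ) : |∑ z : Fin n × Fin n, A z * (ξ z.1 * ξ z.2)| ≤ h * ∑ i, ξ i ^ 2 := by
  refine abs_le_of_sq_le_sq ?_ (mul_nonneg hh (by positivity))
  refine (Finset.sum_mul_sq_le_sq_mul_sq _ _ _).trans (le_of_eq ?_)
  rw [hA, mul_pow]
  congr 1
  rw [Fintype.sum_prod_type, sq, Finset.sum_mul_sum]
  exact Finset.sum_congr rfl fun i _ => Finset.sum_congr rfl fun j _ => by ring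

end

/-! ### The interior Hessian estimate -/

section

variable {n : ℕ}

local notation "𝔼" => EuclideanSpace ℝ (Fin n)

/-- Since 1 ≤ h ≤ u, the cubic error is at most 8 C u h². The value of N' makes 4 N' c = 8 C + 1, so
the good term exceeds it by exactly u h². The remaining terms are of the form X⁻² u² and u h;
division by u and then by h gives the bound. -/
theorem final_absorption {h u X R b d c C N' P d₂ d₃ : ℝ} (hh : 1 ≤ h) (hu : h ≤ u)
    (hX : 0 < X) {C₃ : ℝ} (huC : u ≤ C₃ * h) (hd₂ : 0 ≤ d₂) (hd₃ : 0 ≤ d₃) (hXR : X ≤ R ^ 2)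
    (hC : 0 ≤ C) (hc : 0 < c) (hN : N' = (8 * C + 1) / (4 * c)) (hP : 0 ≤ P)
    (hd₂e : 2 * d + 2 * b ≤ d₂) (hd₃e : 8 * N' * P ≤ d₃)
    (H : 0 ≤ 2 * (d * (X⁻¹ ^ 2 * u ^ 2))
      + 2 * u * (b * (X⁻¹ ^ 2 * u) - N' * (2 * (c * h ^ 2) - 2 * (P * (1 + h))))
      + C * (1 + h) ^ 3) : X ^ 2 * h ≤ d₂ * C₃ + d₃ * R ^ 4 := by
  have hu0 : 0 < u := by linarith
  have hN0 : 0 ≤ N' := by rw [hN]; positivity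
  have hN4 : 4 * N' * c = 8 * C + 1 := by rw [hN]; field_simp
  set t := X⁻¹ with ht
  have ht0 : 0 < t := inv_pos.2 hX
  have h1 : (1 + h) ^ 3 ≤ 8 * (u * h ^ 2) := by
    have e1 : (1 + h) ^ 3 ≤ (2 * h) ^ 3 := pow_le_pow_left₀ (by linarith) (by linarith) 3
    nlinarith [mul_le_mul_of_nonneg_right hu (sq_nonneg h)]
  have h2 : C * (1 + h) ^ 3 ≤ C * (8 * (u * h ^ 2)) := mul_le_mul_of_nonneg_left h1 hC
  have h3 : 4 * u * N' * (P * (1 + h)) ≤ d₃ * (u * h) := by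
    have : 4 * u * N' * (P * (1 + h)) ≤ 4 * u * N' * (P * (2 * h)) := by gcongr; linarith
    nlinarith [mul_le_mul_of_nonneg_right hd₃e (mul_nonneg hu0.le (by linarith : 0 ≤ h))]
  have h4 : (2 * d + 2 * b) * (t ^ 2 * u ^ 2) ≤ d₂ * (t ^ 2 * u ^ 2) :=
    mul_le_mul_of_nonneg_right hd₂e (by positivity)
  have h5 : u * h ^ 2 ≤ d₂ * (t ^ 2 * u ^ 2) + d₃ * (u * h) := by
    have : 4 * u * N' * (c * h ^ 2) = (8 * C + 1) * (u * h ^ 2) := by rw [← hN4]; ring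
    nlinarith
  have h6 : h ^ 2 ≤ d₂ * (t ^ 2 * u) + d₃ * h := by
    refine le_of_mul_le_mul_left ?_ hu0
    nlinarith
  have h7 : h ^ 2 ≤ (d₂ * C₃ * t ^ 2 + d₃) * h := by
    have : d₂ * (t ^ 2 * u) ≤ d₂ * (t ^ 2 * (C₃ * h)) := by gcongr
    nlinarith
  have h8 : h ≤ d₂ * C₃ * t ^ 2 + d₃ := by
    refine le_of_mul_le_mul_right ?_ (by linarith : 0 < h)
    nlinarith
  have h9 : X ^ 2 * t ^ 2 = 1 := by rw [ht]; field_simp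
  calc X ^ 2 * h ≤ X ^ 2 * (d₂ * C₃ * t ^ 2 + d₃) := by gcongr
    _ = d₂ * C₃ * (X ^ 2 * t ^ 2) + d₃ * X ^ 2 := by ring
    _ ≤ d₂ * C₃ + d₃ * R ^ 4 := by
      rw [h9, mul_one]
      have : X ^ 2 ≤ R ^ 4 := by nlinarith
      gcongr

/-- The barrier inequality at a maximum point of `χ² (√(|D²v|² + N w²) + N' |Dv|²)`. -/
theorem cutoff_sq_mul_le {v : 𝔼 → ℝ} {x y₀ : 𝔼} {L : Fin n × Fin n → ℝ}
    {Λ K c C R h u N' C₃ : ℝ} (hR : 0 < R) (hΛ : 0 ≤ Λ) (hc : 0 < c) (hC : 0 ≤ C)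
    (hv : ContDiffAt ℝ 4 v x) (hK : 0 ≤ K) (hv1 : ∀ a, |pd a v x| ≤ K)
    (hX : 0 < cutoff y₀ R x) (hh : 1 ≤ h) (hu : h ≤ u) (huC : u ≤ C₃ * h)
    (hh2 : h ^ 2 = ∑ z : Fin n × Fin n, pd z.1 (pd z.2 v) x ^ 2)
    (hN' : N' = (8 * C + 1) / (4 * c)) (hL : ∀ z, |L z| ≤ Λ)
    (hell : ∀ ξ : Fin n → ℝ, c * ∑ i, ξ i ^ 2 ≤ ∑ z : Fin n × Fin n, L z * (ξ z.1 * ξ z.2))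
    (hfirst : ∀ a, |∑ z : Fin n × Fin n, L z * pd a (pd z.1 (pd z.2 v)) x| ≤ C * (1 + h))
    (hκ : cutoff y₀ R x ^ 2 * (u + N' * gradSum v x) * (cutoff y₀ R x ^ 2)⁻¹
      + -N' * gradSum v x = u)
    (hsecond : 0 ≤ ∑ z : Fin n × Fin n, L z * pd z.1 (pd z.2 (fun y =>
        (cutoff y₀ R x ^ 2 * (u + N' * gradSum v x) * (cutoff y₀ R y ^ 2)⁻¹
          + -N' * gradSum v y) ^ 2)) x + C * (1 + h) ^ 3) :
    cutoff y₀ R x ^ 2 * h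
      ≤ (2 * (n * n * Λ * (4 * R * (1 + N' * (n * K ^ 2)) + 2 * n * N' * K * R ^ 2) ^ 2)
          + 2 * (n * n * Λ * (28 * R ^ 2 * (1 + N' * (n * K ^ 2))))) * C₃
        + 8 * N' * (n * (K * C)) * R ^ 4 := by
  have hN0 : 0 ≤ N' := by rw [hN']; positivity
  have hu0 : 0 < u := by linarith
  set X := cutoff y₀ R x with hXdef
  -- κ is the value at x of χ² (u + N' |Dv|²), and κ χ⁻² - N' |Dv|² is the function whose square
  -- enters `hsecond`.
  set κ := X ^ 2 * (u + N' * gradSum v x) with hκdef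
  set b := 1 + N' * (n * K ^ 2) with hb
  have hb1 : 0 ≤ b := by positivity
  have hXR : X ≤ R ^ 2 := by rw [hXdef, cutoff_eq]; nlinarith [sq_nonneg (dist x y₀)]
  obtain ⟨hη, hη1, hη2⟩ := cutoff_inv_sq_jet y₀ x hR hX
  obtain ⟨hg, hg1, hg2⟩ := gradSum_jet hv
  obtain ⟨-, hϖ⟩ := pd_pd_sq_sub hη hg κ N'
  have hH : ∀ a b, |pd a (pd b v) x| ≤ h := by
    intro a b
    refine abs_le_of_sq_le_sq ?_ (by linarith)
    rw [hh2]
    exact Finset.single_le_sum (f := fun z : Fin n × Fin n => pd z.1 (pd z.2 v) x ^ 2)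
      (fun _ _ => sq_nonneg _) (Finset.mem_univ (a, b))
  have hg0 : 0 ≤ gradSum v x := Finset.sum_nonneg fun a _ => mul_self_nonneg _
  have hgK : gradSum v x ≤ n * K ^ 2 := by
    have h1 : gradSum v x ≤ ∑ _a : Fin n, K ^ 2 := Finset.sum_le_sum fun a _ => by
      rw [← sq]; exact sq_le_sq' (abs_le.1 (hv1 a)).1 (abs_le.1 (hv1 a)).2
    simpa using h1
  have hGu : u + N' * gradSum v x ≤ b * u := by
    have h1 : N' * gradSum v x ≤ N' * (n * K ^ 2) := by gcongr
    have h2 : N' * (n * K ^ 2) * 1 ≤ N' * (n * K ^ 2) * u := by gcongr; linarith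
    rw [hb]; linarith
  have hκ0 : 0 ≤ κ := by positivity
  have hκX : κ ≤ X ^ 2 * (b * u) := by rw [hκdef]; gcongr
  set t := X⁻¹ with ht
  have ht0 : 0 < t := inv_pos.2 hX
  have hκη1 : ∀ i, |κ * pd i (fun y => (cutoff y₀ R y ^ 2)⁻¹) x| ≤ 4 * R * b * (t * u) := by
    intro i
    rw [abs_mul, abs_of_nonneg hκ0]
    refine (mul_le_mul hκX (hη1 i) (abs_nonneg _) (by positivity)).trans (le_of_eq ?_)
    rw [ht, ← hXdef]; field_simp
  have hκη2 : ∀ z : Fin n × Fin n, |κ * pd z.1 (pd z.2 (fun y => (cutoff y₀ R y ^ 2)⁻¹)) x|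
      ≤ 28 * R ^ 2 * b * (t ^ 2 * u) := by
    intro z
    rw [abs_mul, abs_of_nonneg hκ0]
    refine (mul_le_mul hκX (hη2 z.1 z.2) (abs_nonneg _) (by positivity)).trans (le_of_eq ?_)
    rw [ht, ← hXdef]; field_simp
  -- Terms without a factor X⁻¹ are brought to the same scale at the cost of R².
  have htR : 1 ≤ R ^ 2 * t := by
    rw [ht, ← div_eq_mul_inv, one_le_div hX]; exact hXR
  have hgi : ∀ i, |-N' * pd i (gradSum v) x| ≤ 2 * n * N' * K * R ^ 2 * (t * u) := by
    intro i
    rw [hg1, abs_mul, abs_neg, abs_of_nonneg hN0, abs_mul]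
    have h1 := abs_sum_mul_le (a := fun a => pd a v x) (b := fun a => pd i (pd a v) x) hK hv1
      (fun a => hH i a)
    simp only [Fintype.card_fin] at h1
    have h2 : K * h ≤ K * (R ^ 2 * t * u) := by
      refine mul_le_mul_of_nonneg_left ?_ hK
      nlinarith
    calc N' * (|2| * |∑ a, pd a v x * pd i (pd a v) x|) ≤ N' * (2 * (n * (K * h))) := by
          rw [abs_of_pos (by norm_num : (0 : ℝ) < 2)]; gcongr
      _ ≤ N' * (2 * (n * (K * (R ^ 2 * t * u)))) := by gcongr
      _ = _ := by ring
  set d₁ := 4 * R * b + 2 * n * N' * K * R ^ 2 with hd₁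
  set f : Fin n → ℝ := fun i => κ * pd i (fun y => (cutoff y₀ R y ^ 2)⁻¹) x
    + -N' * pd i (gradSum v) x with hf
  have hfabs : ∀ i, |f i| ≤ d₁ * (t * u) := fun i => by
    refine (abs_add_le _ _).trans ?_
    have := hκη1 i
    have := hgi i
    rw [hd₁]; linarith
  have hcard : (Fintype.card (Fin n × Fin n) : ℝ) = n * n := by simp
  have hS1 : ∑ z, L z * (f z.1 * f z.2) ≤ n * n * Λ * d₁ ^ 2 * (t ^ 2 * u ^ 2) := by
    have h1 := abs_sum_mul_le (a := L) (b := fun z : Fin n × Fin n => f z.1 * f z.2)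
      (B := (d₁ * (t * u)) * (d₁ * (t * u))) hΛ hL (fun z => by
        rw [abs_mul]
        exact mul_le_mul (hfabs _) (hfabs _) (abs_nonneg _) ((abs_nonneg _).trans (hfabs z.1)))
    rw [hcard] at h1
    refine ((abs_le.1 h1).2).trans (le_of_eq ?_)
    ring
  have hS2 : ∑ z, L z * (κ * pd z.1 (pd z.2 (fun y => (cutoff y₀ R y ^ 2)⁻¹)) x)
      ≤ n * n * Λ * (28 * R ^ 2 * b) * (t ^ 2 * u) := by
    have h1 := abs_sum_mul_le hΛ hL hκη2
    rw [hcard] at h1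
    refine ((abs_le.1 h1).2).trans (le_of_eq ?_)
    ring
  -- The good term: ellipticity applied to each ∂_a Dv gives 2 c |D²v|², and `hfirst` bounds the
  -- third order part.
  have hS3 : 2 * (c * h ^ 2) - 2 * (n * (K * C) * (1 + h))
      ≤ ∑ z, L z * pd z.1 (pd z.2 (gradSum v)) x := by
    have e1 : ∑ z, L z * pd z.1 (pd z.2 (gradSum v)) x
        = 2 * ∑ a, ∑ z, L z * (pd z.1 (pd a v) x * pd z.2 (pd a v) x)
          + 2 * ∑ a, pd a v x * ∑ z, L z * pd a (pd z.1 (pd z.2 v)) x := by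
      have e2 : ∀ z, L z * pd z.1 (pd z.2 (gradSum v)) x
          = ∑ a, (2 * (L z * (pd z.1 (pd a v) x * pd z.2 (pd a v) x))
            + 2 * (pd a v x * (L z * pd a (pd z.1 (pd z.2 v)) x))) := by
        intro z
        rw [hg2, Finset.sum_add_distrib, mul_add, Finset.mul_sum, Finset.mul_sum,
          Finset.mul_sum, Finset.mul_sum]
        congr 1
        · exact Finset.sum_congr rfl fun a _ => by ring
        · exact Finset.sum_congr rfl fun a _ => by ring
      rw [Finset.sum_congr rfl fun z _ => e2 z, Finset.sum_comm, Finset.mul_sum, Finset.mul_sum,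
        ← Finset.sum_add_distrib]
      refine Finset.sum_congr rfl fun a _ => ?_
      rw [Finset.sum_add_distrib, Finset.mul_sum, Finset.mul_sum, Finset.mul_sum]
    have e3 : c * h ^ 2 ≤ ∑ a, ∑ z, L z * (pd z.1 (pd a v) x * pd z.2 (pd a v) x) := by
      have e4 : c * h ^ 2 = ∑ a, c * ∑ i, pd i (pd a v) x ^ 2 := by
        rw [hh2, Fintype.sum_prod_type, Finset.sum_comm, Finset.mul_sum]
      rw [e4]
      exact Finset.sum_le_sum fun a _ => hell fun i => pd i (pd a v) x
    have e5 := abs_sum_mul_le (a := fun a => pd a v x) hK hv1 hfirst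
    simp only [Fintype.card_fin] at e5
    have e6 := (abs_le.1 e5).1
    rw [e1]
    linarith
  have hsum : ∑ z : Fin n × Fin n, L z * pd z.1 (pd z.2 (fun y =>
        (κ * (cutoff y₀ R y ^ 2)⁻¹ + -N' * gradSum v y) ^ 2)) x
      = 2 * ∑ z, L z * (f z.1 * f z.2)
        + 2 * u * (∑ z, L z * (κ * pd z.1 (pd z.2 (fun y => (cutoff y₀ R y ^ 2)⁻¹)) x)
          - N' * ∑ z, L z * pd z.1 (pd z.2 (gradSum v)) x) := by
    rw [mul_sub, Finset.mul_sum, Finset.mul_sum, Finset.mul_sum, Finset.mul_sum,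
      ← Finset.sum_sub_distrib, ← Finset.sum_add_distrib]
    refine Finset.sum_congr rfl fun z _ => ?_
    rw [hϖ, hκ]
    ring
  rw [hsum] at hsecond
  refine final_absorption (d := n * n * Λ * d₁ ^ 2) (b := n * n * Λ * (28 * R ^ 2 * b))
    (P := n * (K * C)) hh hu hX huC (by positivity) (by positivity) hXR hC hc hN'
    (by positivity) (le_refl _) le_rfl ?_
  refine hsecond.trans ?_
  rw [← ht]
  have e1 := mul_le_mul_of_nonneg_left hS3 hN0
  have e2 : 2 * u * (∑ z, L z * (κ * pd z.1 (pd z.2 (fun y => (cutoff y₀ R y ^ 2)⁻¹)) x)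
          - N' * ∑ z, L z * pd z.1 (pd z.2 (gradSum v)) x)
      ≤ 2 * u * (n * n * Λ * (28 * R ^ 2 * b) * (t ^ 2 * u)
        - N' * (2 * (c * h ^ 2) - 2 * (n * (K * C) * (1 + h)))) := by
    gcongr
  linarith

end

set_option maxHeartbeats 1000000 in
/-- Interior second derivative estimate for functions with barriers. -/
theorem interior_hessian_estimate (n : ℕ) {Λ K c C₁ R : ℝ} (hΛ : 0 ≤ Λ) (hK : 0 ≤ K) (hc : 0 < c)
    (hC₁ : 0 < C₁) (hR : 0 < R) : ∃ C : ℝ, ∀ (v : EuclideanSpace ℝ (Fin n) → ℝ)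
      (γ : Fin n × Fin n → EuclideanSpace ℝ (Fin n) → ℝ) (y₀ : EuclideanSpace ℝ (Fin n))
      (U : Set (EuclideanSpace ℝ (Fin n))), Metric.closedBall y₀ R ⊆ U →
      (∀ x ∈ U, ContDiffAt ℝ 4 v x) → (∀ x ∈ U, |v x| ≤ K) → (∀ x ∈ U, ∀ a, |pd a v x| ≤ K) →
      (∀ x ∈ U, ∀ z, JetBound Λ (γ z) x) → (∀ x ∈ U, ∀ a b, γ (a, b) x = γ (b, a) x) →
      (∀ x ∈ U, ∀ ξ : Fin n → ℝ,
        c * ∑ i, ξ i ^ 2 ≤ ∑ z : Fin n × Fin n, γ z x * (ξ z.1 * ξ z.2)) →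
      (∀ x ∈ U, HasBarrier v Λ c x) →
      (∀ x ∈ U, √(∑ z : Fin n × Fin n, pd z.1 (pd z.2 v) x ^ 2) ≤ C₁ * (1 + trHess γ v x)) →
      ∀ x ∈ Metric.ball y₀ (R / 2), √(∑ z : Fin n × Fin n, pd z.1 (pd z.2 v) x ^ 2) ≤ C := by
  -- Where h ≤ 2 C₁ w, this N gives N w γ ≥ 2 C₁ w ≥ h as quadratic forms, hence D²v + N w γ ≥ 0.
  set N := 2 * C₁ / c with hN
  have hN0 : 0 ≤ N := by positivity
  obtain ⟨C, hC, H⟩ := second_order_inequality n hΛ hK hc hN0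
  set N' := (8 * C + 1) / (4 * c) with hN'
  have hN'0 : 0 ≤ N' := by positivity
  set C₃ := 1 + √N * (n * n * Λ) with hC₃
  have hC₃0 : 0 ≤ C₃ := by positivity
  -- Beyond this threshold h ≤ C₁ (1 + w) improves to h ≤ 2 C₁ w, and also h ≥ 1.
  set h₀ := 1 + 2 * C₁ with hh₀
  -- A bound for the maximum of χ² (u + N' |Dv|²): R⁴ h₀ covers a small Hessian at the maximum
  -- point, the last bracket is the bound of `cutoff_sq_mul_le`.
  set κ₀ := R ^ 4 * (N' * (n * K ^ 2)) + C₃ * (R ^ 4 * h₀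
    + ((2 * (n * n * Λ * (4 * R * (1 + N' * (n * K ^ 2)) + 2 * n * N' * K * R ^ 2) ^ 2)
          + 2 * (n * n * Λ * (28 * R ^ 2 * (1 + N' * (n * K ^ 2))))) * C₃
        + 8 * N' * (n * (K * C)) * R ^ 4)) with hκ₀
  -- On the half ball the cut-off is at least 3/4 R².
  refine ⟨κ₀ / (9 / 16 * R ^ 4), ?_⟩
  intro v γ y₀ U hU hv hv0 hv1 hγ hγs hγe hbar hcone y hy
  set h : EuclideanSpace ℝ (Fin n) → ℝ :=
    fun y => √(∑ z : Fin n × Fin n, pd z.1 (pd z.2 v) y ^ 2) with hh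
  have hhsq : ∀ y, h y ^ 2 = ∑ z : Fin n × Fin n, pd z.1 (pd z.2 v) y ^ 2 := fun y =>
    Real.sq_sqrt (by positivity)
  have hhn : ∀ y, 0 ≤ h y := fun y => Real.sqrt_nonneg _
  set u : EuclideanSpace ℝ (Fin n) → ℝ := fun y => √(h y ^ 2 + N * trHess γ v y ^ 2) with hu
  have husq : ∀ y, u y ^ 2 = h y ^ 2 + N * trHess γ v y ^ 2 := fun y =>
    Real.sq_sqrt (by positivity)
  have hun : ∀ y, 0 ≤ u y := fun y => Real.sqrt_nonneg _
  have hhu : ∀ y, h y ≤ u y := fun y =>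
    Real.le_sqrt_of_sq_le (by have := mul_nonneg hN0 (sq_nonneg (trHess γ v y)); linarith)
  have hHC : ∀ x ∈ U, ∀ a b, ContDiffAt ℝ 2 (pd a (pd b v)) x := fun x hx a b =>
    contDiffAt_pd (l := 3) (contDiffAt_pd (l := 4) (hv x hx) (by norm_num) b) (by norm_num) a
  have hwC : ∀ x ∈ U, ContDiffAt ℝ 2 (trHess γ v) x := fun x hx =>
    ContDiffAt.sum fun z _ => (hγ x hx z).1.mul (hHC x hx z.1 z.2)
  have hwabs : ∀ x ∈ U, |trHess γ v x| ≤ n * n * Λ * h x := by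
    intro x hx
    have := abs_sum_mul_le (a := fun z => γ z x) hΛ (fun z => (hγ x hx z).2.1)
      (b := fun z : Fin n × Fin n => pd z.1 (pd z.2 v) x) (B := h x) (fun z => by
        refine abs_le_of_sq_le_sq ?_ (hhn x)
        rw [hhsq]
        exact Finset.single_le_sum (f := fun z : Fin n × Fin n => pd z.1 (pd z.2 v) x ^ 2)
          (fun _ _ => sq_nonneg _) (Finset.mem_univ z))
    have hcard : (Fintype.card (Fin n × Fin n) : ℝ) = n * n := by simp
    rw [hcard] at this
    rw [mul_assoc]; exact this
  have huC : ∀ x ∈ U, u x ≤ C₃ * h x := by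
    intro x hx
    have h1 := hwabs x hx
    refine Real.sqrt_le_iff.2 ⟨mul_nonneg hC₃0 (hhn x), ?_⟩
    have h2 : trHess γ v x ^ 2 ≤ (n * n * Λ * h x) ^ 2 :=
      sq_le_sq' (abs_le.1 h1).1 (abs_le.1 h1).2
    have h3 : N * trHess γ v x ^ 2 ≤ N * (n * n * Λ * h x) ^ 2 := by gcongr
    have h4 : √N ^ 2 = N := Real.sq_sqrt hN0
    have h5 : 0 ≤ √N * (n * n * Λ) * h x ^ 2 := by positivity
    rw [hC₃]
    nlinarith
  set F : EuclideanSpace ℝ (Fin n) → ℝ :=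
    fun y => cutoff y₀ R y ^ 2 * (u y + N' * gradSum v y) with hF
  have hFc : ContinuousOn F (Metric.closedBall y₀ R) := by
    intro x hx
    have hxU := hU hx
    refine ContinuousAt.continuousWithinAt ?_
    have c1 : ContinuousAt h x := by
      refine ContinuousAt.sqrt (tendsto_finsetSum _ fun z _ => ?_)
      exact (hHC x hxU z.1 z.2).continuousAt.pow 2
    have c2 : ContinuousAt u x :=
      ((c1.pow 2).add (continuousAt_const.mul ((hwC x hxU).continuousAt.pow 2))).sqrt
    exact (((contDiff_cutoff y₀ R).continuous.continuousAt).pow 2).mul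
      (c2.add (continuousAt_const.mul (gradSum_jet (hv x hxU)).1.continuousAt))
  obtain ⟨x, hx, hmax⟩ := (isCompact_closedBall y₀ R).exists_isMaxOn
    (Metric.nonempty_closedBall.2 hR.le) hFc
  have hxU := hU hx
  have hg0 : ∀ y, 0 ≤ gradSum v y := fun y => Finset.sum_nonneg fun a _ => mul_self_nonneg _
  have hgK : gradSum v x ≤ n * K ^ 2 := by
    have h1 : gradSum v x ≤ ∑ _a : Fin n, K ^ 2 := Finset.sum_le_sum fun a _ => by
      rw [← sq]; exact sq_le_sq' (abs_le.1 (hv1 x hxU a)).1 (abs_le.1 (hv1 x hxU a)).2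
    simpa using h1
  have hXn : 0 ≤ cutoff y₀ R x := by
    rw [cutoff_eq]
    have := Metric.mem_closedBall.1 hx
    nlinarith [dist_nonneg (x := x) (y := y₀)]
  have hXR : cutoff y₀ R x ^ 2 ≤ R ^ 4 := by
    have : cutoff y₀ R x ≤ R ^ 2 := by rw [cutoff_eq]; nlinarith [sq_nonneg (dist x y₀)]
    nlinarith
  have hbound : F x ≤ κ₀ := by
    have hsplit : ∀ T, 0 ≤ T → cutoff y₀ R x ^ 2 * h x ≤ T →
        F x ≤ R ^ 4 * (N' * (n * K ^ 2)) + C₃ * T := by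
      intro T hT hle
      have h1 : cutoff y₀ R x ^ 2 * u x ≤ cutoff y₀ R x ^ 2 * (C₃ * h x) := by
        gcongr; exact huC x hxU
      have h2 : cutoff y₀ R x ^ 2 * (N' * gradSum v x) ≤ R ^ 4 * (N' * (n * K ^ 2)) := by
        have := hg0 x
        gcongr
      have h3 := mul_le_mul_of_nonneg_left hle hC₃0
      simp only [hF]
      nlinarith
    have hbig : 0 ≤ (2 * (n * n * Λ * (4 * R * (1 + N' * (n * K ^ 2)) + 2 * n * N' * K * R ^ 2) ^ 2)
          + 2 * (n * n * Λ * (28 * R ^ 2 * (1 + N' * (n * K ^ 2))))) * C₃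
        + 8 * N' * (n * (K * C)) * R ^ 4 := by positivity
    by_cases hsmall : h x ≤ h₀
    · refine hsplit _ (by positivity) ?_
      have : cutoff y₀ R x ^ 2 * h x ≤ R ^ 4 * h₀ := mul_le_mul hXR hsmall (hhn x) (by positivity)
      linarith
    push Not at hsmall
    rcases hXn.eq_or_lt with hX | hX
    · have : F x = 0 := by simp [hF, ← hX]
      rw [this]; positivity
    refine hsplit _ (by positivity) ?_
    have hh1 : 1 ≤ h x := by linarith
    have hκe : ∀ y, 0 < cutoff y₀ R y →
        F x * (cutoff y₀ R y ^ 2)⁻¹ + -N' * gradSum v y - u y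
          = (F x - F y) * (cutoff y₀ R y ^ 2)⁻¹ := by
      intro y hy
      simp only [hF]
      field_simp
      ring
    have hϖx : F x * (cutoff y₀ R x ^ 2)⁻¹ + -N' * gradSum v x = u x := by
      have := hκe x hX
      rw [sub_self, zero_mul] at this
      linarith
    have hxball : x ∈ Metric.ball y₀ R := by
      rw [cutoff_eq] at hX
      rw [Metric.mem_ball]
      exact lt_of_pow_lt_pow_left₀ 2 hR.le (by linarith)
    -- Maximality of F at x, solved for u: the right-hand side touches u from above at x.
    have hnear : ∀ᶠ y in 𝓝 x, u y ≤ F x * (cutoff y₀ R y ^ 2)⁻¹ + -N' * gradSum v y := by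
      filter_upwards [Metric.isOpen_ball.mem_nhds hxball,
        (contDiff_cutoff y₀ R).continuous.continuousAt.eventually (lt_mem_nhds hX)] with y hy hyX
      have h1 := hκe y hyX
      have h2 : F y ≤ F x := hmax (Metric.ball_subset_closedBall hy)
      have h3 : 0 ≤ (F x - F y) * (cutoff y₀ R y ^ 2)⁻¹ :=
        mul_nonneg (by linarith) (by positivity)
      linarith
    have hZ : (Matrix.of fun a b => pd a (pd b v) x
        + N * trHess γ v x * γ (a, b) x).PosSemidef := by
      refine posSemidef_of_quadratic (L := fun z : Fin n × Fin n => pd z.1 (pd z.2 v) x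
        + N * trHess γ v x * γ z x) (fun a b => ?_) fun ξ => ?_
      · simp only [pd_comm ((hv x hxU).of_le (by norm_num)) a b, hγs x hxU a b]
      · have h1 := (abs_le.1 (abs_quadratic_le (hhn x) (hhsq x).symm ξ)).1
        have h2 := hγe x hxU ξ
        have h3 : h x ≤ C₁ * (1 + trHess γ v x) := hcone x hxU
        have h4 : h x ≤ 2 * C₁ * trHess γ v x := by nlinarith
        have h5 : 0 ≤ trHess γ v x := by
          by_contra hneg
          push Not at hneg
          nlinarith
        have h6 : 0 ≤ ∑ i, ξ i ^ 2 := by positivity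
        have h7 : N * trHess γ v x * (c * ∑ i, ξ i ^ 2)
            ≤ N * trHess γ v x * ∑ z : Fin n × Fin n, γ z x * (ξ z.1 * ξ z.2) :=
          mul_le_mul_of_nonneg_left h2 (mul_nonneg hN0 h5)
        have h8 : N * trHess γ v x * (c * ∑ i, ξ i ^ 2)
            = 2 * C₁ * trHess γ v x * ∑ i, ξ i ^ 2 := by rw [hN]; field_simp
        have h9 := mul_le_mul_of_nonneg_right h4 h6
        have h10 : ∑ z : Fin n × Fin n, (pd z.1 (pd z.2 v) x + N * trHess γ v x * γ z x)
            * (ξ z.1 * ξ z.2) = ∑ z : Fin n × Fin n, pd z.1 (pd z.2 v) x * (ξ z.1 * ξ z.2)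
              + N * trHess γ v x * ∑ z : Fin n × Fin n, γ z x * (ξ z.1 * ξ z.2) := by
          rw [Finset.mul_sum, ← Finset.sum_add_distrib]
          exact Finset.sum_congr rfl fun z _ => by ring
        rw [h10]
        linarith
    have hϖC := (pd_pd_sq_sub (cutoff_inv_sq_jet y₀ x hR hX).1 (gradSum_jet (hv x hxU)).1
      (F x) N').1
    obtain ⟨L, hL, hell, hfirst, hsecond⟩ := H v γ x
      (fun y => F x * (cutoff y₀ R y ^ 2)⁻¹ + -N' * gradSum v y) (h x) (hv x hxU) (hv0 x hxU)
      (hv1 x hxU) (hγ x hxU) (hbar x hxU) (hhn x) (hhsq x) hZ hϖC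
      (by
        filter_upwards [hnear] with y hy
        rw [← hhsq, ← husq]
        exact pow_le_pow_left₀ (hun y) hy 2)
      (by rw [← hhsq, ← husq, hϖx])
    have := cutoff_sq_mul_le hR hΛ hc hC (hv x hxU) hK (hv1 x hxU) hX hh1 (hhu x) (huC x hxU)
      (hhsq x) hN' hL hell hfirst hϖx hsecond
    have h1 : 0 ≤ R ^ 4 * h₀ := by positivity
    linarith
  have hyc : y ∈ Metric.closedBall y₀ R :=
    Metric.closedBall_subset_closedBall (by linarith) (Metric.ball_subset_closedBall hy)
  have h1 : F y ≤ κ₀ := le_trans (hmax hyc) hbound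
  have h2 : 9 / 16 * R ^ 4 ≤ cutoff y₀ R y ^ 2 := by
    have h3 : 3 / 4 * R ^ 2 ≤ cutoff y₀ R y := by
      rw [cutoff_eq]
      have := Metric.mem_ball.1 hy
      nlinarith [dist_nonneg (x := y) (y := y₀)]
    nlinarith [sq_nonneg R]
  have h3 : 9 / 16 * R ^ 4 * h y ≤ F y := by
    have := hg0 y
    have h4 : h y ≤ u y + N' * gradSum v y := by nlinarith [hhu y]
    exact mul_le_mul h2 h4 (hhn y) (by positivity)
  show h y ≤ _
  rw [le_div_iff₀ (by positivity)]
  linarith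

section

variable {n : ℕ}

local notation "𝔼" => EuclideanSpace ℝ (Fin n)

/-! ### Matrix-valued functions -/

/-- The entries of the matrix-valued function `A` are smooth at `x`. -/
def SmoothMat (A : 𝔼 → Matrix (Fin n) (Fin n) ℝ) (x : 𝔼) : Prop :=
  ∀ a b, ContDiffAt ℝ ∞ (fun y => A y a b) x

/-- The entrywise partial derivative of a matrix-valued function. -/
noncomputable def pdMat (i : Fin n) (A : 𝔼 → Matrix (Fin n) (Fin n) ℝ) (x : 𝔼) :
    Matrix (Fin n) (Fin n) ℝ :=
  Matrix.of fun a b => pd i (fun y => A y a b) x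

theorem contDiffAt_pd_infty {f : 𝔼 → ℝ} {x : 𝔼} (h : ContDiffAt ℝ ∞ f x) (i : Fin n) :
    ContDiffAt ℝ ∞ (pd i f) x := contDiffAt_pd h (by simp) i

theorem infty_differentiableAt {f : 𝔼 → ℝ} {x : 𝔼} (h : ContDiffAt ℝ ∞ f x) :
    DifferentiableAt ℝ f x := h.differentiableAt (by simp)

theorem infty_two {f : 𝔼 → ℝ} {x : 𝔼} (h : ContDiffAt ℝ ∞ f x) : ContDiffAt ℝ 2 f x :=
  contDiffAt_infty.1 h 2

theorem SmoothMat.mul {A B : 𝔼 → Matrix (Fin n) (Fin n) ℝ} {x : 𝔼} (hA : SmoothMat A x)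
    (hB : SmoothMat B x) : SmoothMat (fun y => A y * B y) x := fun a b => by
  simp only [Matrix.mul_apply]
  exact ContDiffAt.sum fun c _ => (hA a c).mul (hB c b)

theorem SmoothMat.smul {f : 𝔼 → ℝ} {A : 𝔼 → Matrix (Fin n) (Fin n) ℝ} {x : 𝔼}
    (hf : ContDiffAt ℝ ∞ f x) (hA : SmoothMat A x) : SmoothMat (fun y => f y • A y) x :=
  fun a b => hf.mul (hA a b)

theorem SmoothMat.sum {ι : Type*} {s : Finset ι} {A : ι → 𝔼 → Matrix (Fin n) (Fin n) ℝ} {x : 𝔼}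
    (hA : ∀ c ∈ s, SmoothMat (A c) x) : SmoothMat (fun y => ∑ c ∈ s, A c y) x := fun a b => by
  simp only [Matrix.sum_apply]
  exact ContDiffAt.sum fun c hc => hA c hc a b

theorem SmoothMat.transpose {A : 𝔼 → Matrix (Fin n) (Fin n) ℝ} {x : 𝔼} (hA : SmoothMat A x) :
    SmoothMat (fun y => (A y)ᵀ) x := fun a b => hA b a

theorem SmoothMat.pdMat {A : 𝔼 → Matrix (Fin n) (Fin n) ℝ} {x : 𝔼} (hA : SmoothMat A x)
    (i : Fin n) : SmoothMat (pdMat i A) x := fun a b => contDiffAt_pd_infty (hA a b) i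

theorem contDiffAt_det {A : 𝔼 → Matrix (Fin n) (Fin n) ℝ} {x : 𝔼} (hA : SmoothMat A x) :
    ContDiffAt ℝ ∞ (fun y => (A y).det) x := by
  simp only [Matrix.det_apply']
  exact ContDiffAt.sum fun σ _ => contDiffAt_const.mul (contDiffAt_prod fun i _ => hA _ _)

theorem SmoothMat.inv {A : 𝔼 → Matrix (Fin n) (Fin n) ℝ} {x : 𝔼} (hA : SmoothMat A x)
    (hdet : (A x).det ≠ 0) : SmoothMat (fun y => (A y)⁻¹) x := fun a b => by
  have h1 : ∀ y, (A y)⁻¹ a b = ((A y).det)⁻¹ * (A y).adjugate a b := fun y => by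
    rw [Matrix.inv_def, Ring.inverse_eq_inv']; rfl
  simp only [h1]
  refine ((contDiffAt_det hA).inv hdet).mul ?_
  simp only [Matrix.adjugate_apply]
  refine contDiffAt_det fun c d => ?_
  by_cases h : c = b
  · subst h; simp only [Matrix.updateRow_self]; exact contDiffAt_const
  · simp only [Matrix.updateRow_ne h]; exact hA c d

theorem pdMat_congr {A B : 𝔼 → Matrix (Fin n) (Fin n) ℝ} {x : 𝔼} (hAB : A =ᶠ[𝓝 x] B)
    (i : Fin n) : pdMat i A x = pdMat i B x := by
  ext a b
  exact pd_congr (by filter_upwards [hAB] with y hy; rw [hy]) i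

theorem pdMat_add {A B : 𝔼 → Matrix (Fin n) (Fin n) ℝ} {x : 𝔼} (hA : SmoothMat A x)
    (hB : SmoothMat B x) (i : Fin n) :
    pdMat i (fun y => A y + B y) x = pdMat i A x + pdMat i B x := by
  ext a b
  exact pd_add (infty_differentiableAt (hA a b)) (infty_differentiableAt (hB a b)) i

theorem pdMat_mul {A B : 𝔼 → Matrix (Fin n) (Fin n) ℝ} {x : 𝔼} (hA : SmoothMat A x)
    (hB : SmoothMat B x) (i : Fin n) :
    pdMat i (fun y => A y * B y) x = pdMat i A x * B x + A x * pdMat i B x := by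
  ext a b
  simp only [pdMat, Matrix.of_apply, Matrix.add_apply, Matrix.mul_apply]
  rw [pd_sum fun c _ => (infty_differentiableAt (hA a c)).fun_mul (infty_differentiableAt (hB c b)),
    ← Finset.sum_add_distrib]
  exact Finset.sum_congr rfl fun c _ =>
    pd_mul (infty_differentiableAt (hA a c)) (infty_differentiableAt (hB c b)) i

theorem pdMat_smul {f : 𝔼 → ℝ} {A : 𝔼 → Matrix (Fin n) (Fin n) ℝ} {x : 𝔼}
    (hf : ContDiffAt ℝ ∞ f x) (hA : SmoothMat A x) (i : Fin n) :
    pdMat i (fun y => f y • A y) x = pd i f x • A x + f x • pdMat i A x := by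
  ext a b
  exact pd_mul (infty_differentiableAt hf) (infty_differentiableAt (hA a b)) i

theorem pdMat_sum {ι : Type*} {s : Finset ι} {A : ι → 𝔼 → Matrix (Fin n) (Fin n) ℝ} {x : 𝔼}
    (hA : ∀ c ∈ s, SmoothMat (A c) x) (i : Fin n) :
    pdMat i (fun y => ∑ c ∈ s, A c y) x = ∑ c ∈ s, pdMat i (A c) x := by
  ext a b
  simp only [pdMat, Matrix.of_apply, Matrix.sum_apply]
  exact pd_sum (fun c hc => infty_differentiableAt (hA c hc a b)) i

theorem pdMat_inv {A : 𝔼 → Matrix (Fin n) (Fin n) ℝ} {x : 𝔼} (hA : SmoothMat A x)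
    (hdet : (A x).det ≠ 0) (i : Fin n) :
    pdMat i (fun y => (A y)⁻¹) x = -((A x)⁻¹ * pdMat i A x * (A x)⁻¹) := by
  have hev : (fun y => (A y)⁻¹ * A y) =ᶠ[𝓝 x] fun _ => 1 := by
    filter_upwards [(contDiffAt_det hA).continuousAt.eventually_ne hdet] with y hy
    exact Matrix.nonsing_inv_mul _ (isUnit_iff_ne_zero.2 hy)
  have h1 := pdMat_mul (hA.inv hdet) hA i
  rw [pdMat_congr hev i] at h1
  have h2 : pdMat i (fun _ : 𝔼 => (1 : Matrix (Fin n) (Fin n) ℝ)) x = 0 := by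
    ext a b; exact pd_const _ i x
  rw [h2] at h1
  have h3 : pdMat i (fun y => (A y)⁻¹) x * A x = -((A x)⁻¹ * pdMat i A x) :=
    eq_neg_of_add_eq_zero_left h1.symm
  calc pdMat i (fun y => (A y)⁻¹) x
      = pdMat i (fun y => (A y)⁻¹) x * A x * (A x)⁻¹ := by
        rw [mul_assoc, Matrix.mul_nonsing_inv _ (isUnit_iff_ne_zero.2 hdet), mul_one]
    _ = _ := by rw [h3, Matrix.neg_mul]

/-! ### Change of coordinates -/

/-- The Jacobian matrix of a map. -/
noncomputable def jac (θ : 𝔼 → 𝔼) (x : 𝔼) : Matrix (Fin n) (Fin n) ℝ :=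
  Matrix.of fun a i => pd i (fun y => θ y a) x

theorem contDiffAt_comp_coord {θ : 𝔼 → 𝔼} {x : 𝔼} {k : ℕ∞ω} (hθ : ContDiffAt ℝ k θ x) (a : Fin n) :
    ContDiffAt ℝ k (fun y => θ y a) x :=
  (contDiffAt_euclidean.1 hθ) a

theorem smoothMat_jac {θ : 𝔼 → 𝔼} {x : 𝔼} (hθ : ContDiffAt ℝ ∞ θ x) : SmoothMat (jac θ) x :=
  fun a i => contDiffAt_pd_infty (contDiffAt_comp_coord hθ a) i

theorem fderiv_single_eq {θ : 𝔼 → 𝔼} {x : 𝔼} (hθ : DifferentiableAt ℝ θ x) (i c : Fin n) :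
    (fderiv ℝ θ x (EuclideanSpace.single i 1)) c = jac θ x c i := by
  have h := ((EuclideanSpace.proj c : 𝔼 →L[ℝ] ℝ).hasFDerivAt (x := θ x)).comp x hθ.hasFDerivAt
  have h' : HasFDerivAt (fun y => θ y c) ((EuclideanSpace.proj c : 𝔼 →L[ℝ] ℝ).comp
    (fderiv ℝ θ x)) x := h
  simp [jac, pd, h'.fderiv]

theorem pd_comp_map {θ : 𝔼 → 𝔼} {x : 𝔼} {f : 𝔼 → ℝ} (hf : DifferentiableAt ℝ f (θ x))
    (hθ : DifferentiableAt ℝ θ x) (i : Fin n) :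
    pd i (fun y => f (θ y)) x = ∑ c, jac θ x c i * pd c f (θ x) := by
  have h := (hf.hasFDerivAt.comp x hθ.hasFDerivAt).fderiv
  have h' : fderiv ℝ (fun y => f (θ y)) x = (fderiv ℝ f (θ x)).comp (fderiv ℝ θ x) := h
  rw [pd, h', ContinuousLinearMap.comp_apply, fderiv_apply_eq_sum_pd]
  simp only [fderiv_single_eq hθ]

theorem pdMat_comp_map {θ : 𝔼 → 𝔼} {x : 𝔼} {A : 𝔼 → Matrix (Fin n) (Fin n) ℝ}
    (hA : SmoothMat A (θ x)) (hθ : ContDiffAt ℝ ∞ θ x) (i : Fin n) :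
    pdMat i (fun y => A (θ y)) x = ∑ c, jac θ x c i • pdMat c A (θ x) := by
  ext a b
  simp only [pdMat, Matrix.of_apply, Matrix.sum_apply, Matrix.smul_apply, smul_eq_mul]
  exact pd_comp_map (infty_differentiableAt (hA a b)) (hθ.differentiableAt (by simp)) i

theorem SmoothMat.comp_map {θ : 𝔼 → 𝔼} {x : 𝔼} {A : 𝔼 → Matrix (Fin n) (Fin n) ℝ}
    (hA : SmoothMat A (θ x)) (hθ : ContDiffAt ℝ ∞ θ x) : SmoothMat (fun y => A (θ y)) x :=
  fun a b => (hA a b).comp x hθ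

theorem pdMat_jac_symm {θ : 𝔼 → 𝔼} {x : 𝔼} (hθ : ContDiffAt ℝ ∞ θ x) (a i j : Fin n) :
    pdMat j (jac θ) x a i = pdMat i (jac θ) x a j :=
  pd_comm (infty_two (contDiffAt_comp_coord hθ a)) j i

/-- The Christoffel symbols of the first kind, as matrices. -/
noncomputable def lowerChr (G : 𝔼 → Matrix (Fin n) (Fin n) ℝ) (j : Fin n) (y : 𝔼) :
    Matrix (Fin n) (Fin n) ℝ :=
  Matrix.of fun l i => pd i (fun z => G z j l) y + pd j (fun z => G z i l) y
    - pd l (fun z => G z i j) y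

/-- The Christoffel symbols `Γ^m_{ij}` as matrices with rows `m` and columns `i`. -/
noncomputable def chrMat (G : 𝔼 → Matrix (Fin n) (Fin n) ℝ) (j : Fin n) (y : 𝔼) :
    Matrix (Fin n) (Fin n) ℝ :=
  Matrix.of fun m i => christoffel G m i j y

theorem chrMat_eq (G : 𝔼 → Matrix (Fin n) (Fin n) ℝ) (j : Fin n) (y : 𝔼) :
    chrMat G j y = (1 / 2 : ℝ) • ((G y)⁻¹ * lowerChr G j y) := by
  ext m i
  simp [chrMat, christoffel, lowerChr, Matrix.mul_apply]

theorem smoothMat_chrMat {G : 𝔼 → Matrix (Fin n) (Fin n) ℝ} {x : 𝔼} (hG : SmoothMat G x)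
    (hdet : (G x).det ≠ 0) (j : Fin n) : SmoothMat (chrMat G j) x := by
  have h1 : SmoothMat (lowerChr G j) x := fun l i =>
    ((contDiffAt_pd_infty (hG j l) i).add (contDiffAt_pd_infty (hG i l) j)).sub
      (contDiffAt_pd_infty (hG i j) l)
  have h2 : chrMat G j = fun y => (1 / 2 : ℝ) • ((G y)⁻¹ * lowerChr G j y) :=
    funext fun y => chrMat_eq G j y
  rw [h2]
  exact SmoothMat.smul contDiffAt_const ((hG.inv hdet).mul h1)

theorem christoffel_symm {G : 𝔼 → Matrix (Fin n) (Fin n) ℝ} {y : 𝔼}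
    (hG : ∀ᶠ z in 𝓝 y, (G z).IsSymm) (m i j : Fin n) :
    christoffel G m i j y = christoffel G m j i y := by
  unfold christoffel
  congr 1
  refine Finset.sum_congr rfl fun l _ => ?_
  have : (fun z => G z i j) =ᶠ[𝓝 y] fun z => G z j i := by
    filter_upwards [hG] with z hz using hz.apply j i
  rw [pd_congr this l]
  ring

theorem sum_reverse₃ {ι : Type*} [Fintype ι] (f : ι → ι → ι → ℝ) :
    ∑ a, ∑ b, ∑ c, f a b c = ∑ c, ∑ b, ∑ a, f a b c := by
  rw [Finset.sum_comm]
  refine Eq.trans (Finset.sum_congr rfl fun b _ => Finset.sum_comm) ?_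
  exact Finset.sum_comm

/-- Each derivative of JᵀGJ has two terms A with second derivatives of θ and one term S with a
derivative of G. In the alternating sum there are six terms A; by the symmetry of the second
derivatives of θ four cancel and two are equal, whence the factor 2. -/
theorem lowerChr_transform {G G' : 𝔼 → Matrix (Fin n) (Fin n) ℝ} {θ : 𝔼 → 𝔼} {x : 𝔼}
    (hθ : ContDiffAt ℝ ∞ θ x) (hG : SmoothMat G (θ x)) (hGs : (G (θ x)).IsSymm)
    (hG' : G' =ᶠ[𝓝 x] fun z => (jac θ z)ᵀ * G (θ z) * jac θ z) (j : Fin n) :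
    lowerChr G' j x = (2 : ℝ) • ((jac θ x)ᵀ * G (θ x) * pdMat j (jac θ) x)
      + (jac θ x)ᵀ * (∑ c, jac θ x c j • lowerChr G c (θ x)) * jac θ x := by
  set J := jac θ x with hJ
  set Th : Fin n → Matrix (Fin n) (Fin n) ℝ := fun j => pdMat j (jac θ) x with hTh
  have hJs := smoothMat_jac hθ
  set A : Fin n → Fin n → Fin n → ℝ := fun i j l => ∑ a, ∑ b, Th i a j * G (θ x) a b * J b l with hA
  set S : Fin n → Fin n → Fin n → ℝ := fun p q r => ∑ a, ∑ b, ∑ c,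
    J a p * J b q * J c r * pd c (fun z => G z a b) (θ x) with hS
  have hAs : ∀ i j l, A i j l = A j i l := fun i j l => by
    simp only [hA]
    refine Finset.sum_congr rfl fun a _ => Finset.sum_congr rfl fun b _ => ?_
    have h : Th i a j = Th j a i := pdMat_jac_symm hθ a j i
    rw [h]
  have hd : ∀ i p l, pd i (fun z => G' z p l) x = A i p l + S p l i + A i l p := by
    intro i p l
    have h1 : pd i (fun z => G' z p l) x
        = pdMat i (fun z => (jac θ z)ᵀ * G (θ z) * jac θ z) x p l :=
      congrFun (congrFun (pdMat_congr hG' i) p) l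
    have hGc := hG.comp_map hθ
    rw [h1, pdMat_mul (hJs.transpose.mul hGc) hJs, pdMat_mul hJs.transpose hGc,
      pdMat_comp_map hG hθ, add_mul]
    have e1 : (pdMat i (fun z => (jac θ z)ᵀ) x * G (θ x) * jac θ x) p l = A i p l := by
      simp only [Matrix.mul_apply, hA, Finset.sum_mul]
      rw [Finset.sum_comm]
      rfl
    have e2 : ((jac θ x)ᵀ * (∑ c, jac θ x c i • pdMat c G (θ x)) * jac θ x) p l = S p l i := by
      simp only [Matrix.mul_apply, hS, Finset.sum_mul, Finset.mul_sum, Matrix.sum_apply,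
        Matrix.smul_apply, smul_eq_mul, Matrix.transpose_apply]
      rw [Finset.sum_comm]
      refine Eq.trans ?_ (sum_reverse₃ _).symm
      refine Finset.sum_congr rfl fun a _ => Finset.sum_congr rfl fun b _ =>
        Finset.sum_congr rfl fun c _ => ?_
      simp only [pdMat, Matrix.of_apply, hJ]; ring
    have e3 : ((jac θ x)ᵀ * G (θ x) * pdMat i (jac θ) x) p l = A i l p := by
      simp only [Matrix.mul_apply, hA, Finset.sum_mul, Matrix.transpose_apply]
      refine Finset.sum_congr rfl fun a _ => Finset.sum_congr rfl fun b _ => ?_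
      rw [hGs.apply a b]; simp only [hTh, hJ]; ring
    rw [Matrix.add_apply, Matrix.add_apply, e1, e2, e3]
  ext l i
  have e1 : ((jac θ x)ᵀ * G (θ x) * pdMat j (jac θ) x) l i = A i j l := by
    simp only [Matrix.mul_apply, hA, Finset.sum_mul, Matrix.transpose_apply]
    refine Finset.sum_congr rfl fun a _ => Finset.sum_congr rfl fun b _ => ?_
    rw [hGs.apply a b, ← pdMat_jac_symm hθ]; simp only [hJ]; ring
  have e2 : (Jᵀ * (∑ c, J c j • lowerChr G c (θ x)) * J) l i
      = S j l i + S i l j - S i j l := by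
    simp only [Matrix.mul_apply, Finset.sum_mul, Finset.mul_sum, Matrix.sum_apply,
      Matrix.smul_apply, smul_eq_mul, Matrix.transpose_apply, lowerChr, Matrix.of_apply]
    have e3 : S j l i = ∑ a, ∑ b, ∑ c, J b l * (J c j * pd a (fun z => G z c b) (θ x)) * J a i := by
      simp only [hS]
      rw [Finset.sum_comm_cycle]
      refine Finset.sum_congr rfl fun a _ => ?_
      rw [Finset.sum_comm]
      refine Finset.sum_congr rfl fun b _ => Finset.sum_congr rfl fun c _ => by ring
    have e4 : S i l j = ∑ a, ∑ b, ∑ c, J b l * (J c j * pd c (fun z => G z a b) (θ x)) * J a i := by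
      simp only [hS]
      refine Finset.sum_congr rfl fun a _ => Finset.sum_congr rfl fun b _ =>
        Finset.sum_congr rfl fun c _ => by ring
    have e5 : S i j l = ∑ a, ∑ b, ∑ c, J b l * (J c j * pd b (fun z => G z a c) (θ x)) * J a i := by
      simp only [hS]
      refine Finset.sum_congr rfl fun a _ => ?_
      rw [Finset.sum_comm]
      refine Finset.sum_congr rfl fun b _ => Finset.sum_congr rfl fun c _ => by ring
    rw [e3, e4, e5]
    simp only [← Finset.sum_add_distrib, ← Finset.sum_sub_distrib]
    refine Finset.sum_congr rfl fun a _ => Finset.sum_comm.trans ?_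
    exact Finset.sum_congr rfl fun b _ => Finset.sum_congr rfl fun c _ => by ring
  rw [Matrix.add_apply, Matrix.smul_apply, e1, e2]
  simp only [lowerChr, Matrix.of_apply, hd, smul_eq_mul]
  rw [hAs j i l, hAs j l i, hAs l i j]
  ring

/-- The transformation rule of the Christoffel symbols. -/
theorem chrMat_transform {G G' : 𝔼 → Matrix (Fin n) (Fin n) ℝ} {θ : 𝔼 → 𝔼} {x : 𝔼}
    (hθ : ContDiffAt ℝ ∞ θ x) (hG : SmoothMat G (θ x)) (hGs : (G (θ x)).IsSymm)
    (hdet : (G (θ x)).det ≠ 0) (hJ : (jac θ x).det ≠ 0)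
    (hG' : G' =ᶠ[𝓝 x] fun z => (jac θ z)ᵀ * G (θ z) * jac θ z) (j : Fin n) :
    jac θ x * chrMat G' j x
      = pdMat j (jac θ) x + (∑ c, jac θ x c j • chrMat G c (θ x)) * jac θ x := by
  have h1 : jac θ x * (G' x)⁻¹ * (jac θ x)ᵀ = (G (θ x))⁻¹ := by
    have hu := isUnit_iff_ne_zero.2 hJ
    rw [hG'.self_of_nhds, Matrix.mul_inv_rev, Matrix.mul_inv_rev, ← mul_assoc, ← mul_assoc,
      Matrix.mul_nonsing_inv _ hu, one_mul, mul_assoc, Matrix.nonsing_inv_mul _ (by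
        rwa [Matrix.det_transpose]), mul_one]
  have h2 : ∑ c, jac θ x c j • chrMat G c (θ x)
      = (1 / 2 : ℝ) • ((G (θ x))⁻¹ * ∑ c, jac θ x c j • lowerChr G c (θ x)) := by
    rw [Finset.mul_sum, Finset.smul_sum]
    refine Finset.sum_congr rfl fun c _ => ?_
    rw [chrMat_eq, Matrix.mul_smul, smul_comm]
  rw [h2, chrMat_eq, lowerChr_transform hθ hG hGs hG']
  set Lw := ∑ c, jac θ x c j • lowerChr G c (θ x)
  rw [Matrix.mul_smul, mul_add, mul_add, Matrix.mul_smul, Matrix.mul_smul, smul_add, smul_smul,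
    Matrix.smul_mul]
  norm_num
  congr 1
  · calc jac θ x * ((G' x)⁻¹ * ((jac θ x)ᵀ * G (θ x) * pdMat j (jac θ) x))
        = (jac θ x * (G' x)⁻¹ * (jac θ x)ᵀ) * G (θ x) * pdMat j (jac θ) x := by noncomm_ring
      _ = _ := by rw [h1, Matrix.nonsing_inv_mul _ (isUnit_iff_ne_zero.2 hdet), one_mul]
  · congr 1
    calc jac θ x * ((G' x)⁻¹ * ((jac θ x)ᵀ * Lw * jac θ x))
        = (jac θ x * (G' x)⁻¹ * (jac θ x)ᵀ) * Lw * jac θ x := by noncomm_ring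
      _ = _ := by rw [h1]

end

section

variable {n : ℕ}

local notation "𝔼" => EuclideanSpace ℝ (Fin n)

/-! ### Curvature -/

/-- The curvature of the Levi-Civita connection, as a matrix-valued two-form. -/
noncomputable def curvMat (G : 𝔼 → Matrix (Fin n) (Fin n) ℝ) (k j : Fin n) (y : 𝔼) :
    Matrix (Fin n) (Fin n) ℝ :=
  pdMat k (chrMat G j) y - pdMat j (chrMat G k) y + chrMat G k y * chrMat G j y
    - chrMat G j y * chrMat G k y

theorem coordRicci_eq {G : 𝔼 → Matrix (Fin n) (Fin n) ℝ} {y : 𝔼}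
    (hG : ∀ᶠ z in 𝓝 y, (G z).IsSymm) (i j : Fin n) :
    coordRicci G y i j = ∑ l, curvMat G l j y l i := by
  simp only [coordRicci, curvMat, Matrix.of_apply, Matrix.add_apply, Matrix.sub_apply, pdMat,
    chrMat, Matrix.mul_apply, Finset.sum_sub_distrib, Finset.sum_add_distrib]
  have h1 : ∑ l, ∑ m, christoffel G l i j y * christoffel G m l m y
      = ∑ l, ∑ m, christoffel G l m l y * christoffel G m i j y := by
    rw [Finset.sum_comm]
    exact Finset.sum_congr rfl fun a _ => Finset.sum_congr rfl fun b _ => mul_comm _ _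
  have h2 : ∑ l, ∑ m, christoffel G m i l y * christoffel G l j m y
      = ∑ l, ∑ m, christoffel G l m j y * christoffel G m i l y := by
    refine Finset.sum_congr rfl fun a _ => Finset.sum_congr rfl fun b _ => ?_
    rw [christoffel_symm hG a j b, mul_comm]
  rw [h1, h2]
  ring

/-- `θ` is a smooth change of coordinates on the open set `U`, which transforms the metric `G`
into `G'`. -/
structure IsMetricChange (G G' : 𝔼 → Matrix (Fin n) (Fin n) ℝ) (θ : 𝔼 → 𝔼) (U : Set 𝔼) :
    Prop where
  isOpen : IsOpen U
  smooth_map : ∀ x ∈ U, ContDiffAt ℝ ∞ θ x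
  smooth_target : ∀ x ∈ U, SmoothMat G (θ x)
  smooth_source : ∀ x ∈ U, SmoothMat G' x
  isSymm : ∀ x ∈ U, ∀ᶠ z in 𝓝 (θ x), (G z).IsSymm
  det_ne : ∀ x ∈ U, (G (θ x)).det ≠ 0
  det_jac_ne : ∀ x ∈ U, (jac θ x).det ≠ 0
  eq : ∀ x ∈ U, G' x = (jac θ x)ᵀ * G (θ x) * jac θ x

namespace IsMetricChange

variable {G G' : EuclideanSpace ℝ (Fin n) → Matrix (Fin n) (Fin n) ℝ}
  {θ : EuclideanSpace ℝ (Fin n) → EuclideanSpace ℝ (Fin n)} {U : Set (EuclideanSpace ℝ (Fin n))}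

theorem isSymm_source (h : IsMetricChange G G' θ U) {x : EuclideanSpace ℝ (Fin n)} (hx : x ∈ U) :
    ∀ᶠ z in 𝓝 x, (G' z).IsSymm := by
  filter_upwards [h.isOpen.mem_nhds hx] with z hz
  have := (h.isSymm z hz).self_of_nhds
  rw [h.eq z hz, Matrix.IsSymm, Matrix.transpose_mul, Matrix.transpose_mul, this.eq,
    Matrix.transpose_transpose, mul_assoc]

theorem det_source_ne (h : IsMetricChange G G' θ U) {x : EuclideanSpace ℝ (Fin n)} (hx : x ∈ U) :
    (G' x).det ≠ 0 := by
  rw [h.eq x hx, Matrix.det_mul, Matrix.det_mul, Matrix.det_transpose]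
  exact mul_ne_zero (mul_ne_zero (h.det_jac_ne x hx) (h.det_ne x hx)) (h.det_jac_ne x hx)

theorem chrMat_eq (h : IsMetricChange G G' θ U) {x : EuclideanSpace ℝ (Fin n)} (hx : x ∈ U)
    (j : Fin n) : jac θ x * chrMat G' j x
      = pdMat j (jac θ) x + (∑ c, jac θ x c j • chrMat G c (θ x)) * jac θ x :=
  chrMat_transform (h.smooth_map x hx) (h.smooth_target x hx) (h.isSymm x hx).self_of_nhds
    (h.det_ne x hx) (h.det_jac_ne x hx)
    (Filter.mem_of_superset (h.isOpen.mem_nhds hx) fun z hz => h.eq z hz) j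

theorem pdMat_pdMat_comm {A : EuclideanSpace ℝ (Fin n) → Matrix (Fin n) (Fin n) ℝ}
    {x : EuclideanSpace ℝ (Fin n)} (hA : SmoothMat A x) (k j : Fin n) :
    pdMat k (pdMat j A) x = pdMat j (pdMat k A) x := by
  ext a b
  exact pd_comm (infty_two (hA a b)) k j

/-- The rule J Γ'_j = ∂_j J + A_j J is a gauge transformation, with A_j the pulled back connection.
Differentiating it and antisymmetrising in k and j removes ∂_k ∂_j J and leaves the curvature of A.
This is the pulled back curvature, because ∂_k J_{cj} is symmetric in k and j. -/
theorem curvMat_eq (h : IsMetricChange G G' θ U) {x : EuclideanSpace ℝ (Fin n)} (hx : x ∈ U)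
    (k j : Fin n) : jac θ x * curvMat G' k j x
      = (∑ d, jac θ x d k • ∑ c, jac θ x c j • curvMat G d c (θ x)) * jac θ x := by
  have hJs : SmoothMat (jac θ) x := smoothMat_jac (h.smooth_map x hx)
  have hC' : ∀ j, SmoothMat (chrMat G' j) x := fun j =>
    smoothMat_chrMat (h.smooth_source x hx) (h.det_source_ne hx) j
  have hC : ∀ c, SmoothMat (chrMat G c) (θ x) := fun c =>
    smoothMat_chrMat (h.smooth_target x hx) (h.det_ne x hx) c
  have hCθ : ∀ c, SmoothMat (fun y => chrMat G c (θ y)) x := fun c =>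
    (hC c).comp_map (h.smooth_map x hx)
  set A : Fin n → EuclideanSpace ℝ (Fin n) → Matrix (Fin n) (Fin n) ℝ := fun j y =>
    ∑ c, jac θ y c j • chrMat G c (θ y) with hA
  have hAs : ∀ j, SmoothMat (A j) x := fun j =>
    SmoothMat.sum fun c _ => SmoothMat.smul (hJs c j) (hCθ c)
  have hdJ : ∀ k, pdMat k (jac θ) x = jac θ x * chrMat G' k x - A k x * jac θ x := fun k =>
    eq_sub_of_add_eq (h.chrMat_eq hx k).symm
  have hdiff : ∀ k j, pdMat k (jac θ) x * chrMat G' j x + jac θ x * pdMat k (chrMat G' j) x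
      = pdMat k (pdMat j (jac θ)) x + (pdMat k (A j) x * jac θ x + A j x * pdMat k (jac θ) x) := by
    intro k j
    have hev : (fun y => jac θ y * chrMat G' j y)
        =ᶠ[𝓝 x] fun y => pdMat j (jac θ) y + A j y * jac θ y :=
      Filter.mem_of_superset (h.isOpen.mem_nhds hx) fun y hy => h.chrMat_eq hy j
    have h1 := pdMat_congr hev k
    rw [pdMat_mul hJs (hC' j), pdMat_add (hJs.pdMat j) ((hAs j).mul hJs),
      pdMat_mul (hAs j) hJs] at h1
    exact h1
  have hdA : ∀ k j, pdMat k (A j) x = ∑ c, (pdMat k (jac θ) x c j • chrMat G c (θ x)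
      + jac θ x c j • ∑ d, jac θ x d k • pdMat d (chrMat G c) (θ x)) := by
    intro k j
    rw [hA, pdMat_sum fun c _ => SmoothMat.smul (hJs c j) (hCθ c)]
    refine Finset.sum_congr rfl fun c _ => ?_
    rw [pdMat_smul (hJs c j) (hCθ c), pdMat_comp_map (hC c) (h.smooth_map x hx)]
    rfl
  have hcurv : ∑ d, jac θ x d k • ∑ c, jac θ x c j • curvMat G d c (θ x)
      = pdMat k (A j) x - pdMat j (A k) x + A k x * A j x - A j x * A k x := by
    have e1 : pdMat k (A j) x - pdMat j (A k) x
        = (∑ d, jac θ x d k • ∑ c, jac θ x c j • pdMat d (chrMat G c) (θ x))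
          - ∑ d, jac θ x d k • ∑ c, jac θ x c j • pdMat c (chrMat G d) (θ x) := by
      rw [hdA, hdA, Finset.sum_add_distrib, Finset.sum_add_distrib]
      have e0 : ∑ c, pdMat k (jac θ) x c j • chrMat G c (θ x)
          = ∑ c, pdMat j (jac θ) x c k • chrMat G c (θ x) :=
        Finset.sum_congr rfl fun c _ => by rw [pdMat_jac_symm (h.smooth_map x hx)]
      rw [e0, add_sub_add_left_eq_sub]
      congr 1
      simp only [Finset.smul_sum]
      rw [Finset.sum_comm]
      exact Finset.sum_congr rfl fun c _ => Finset.sum_congr rfl fun d _ => smul_comm _ _ _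
    have e2 : ∀ k j, A k x * A j x = ∑ d, jac θ x d k • ∑ c, jac θ x c j •
        (chrMat G d (θ x) * chrMat G c (θ x)) := by
      intro k j
      simp only [hA, Finset.sum_mul, Finset.mul_sum, Finset.smul_sum, Matrix.smul_mul,
        Matrix.mul_smul]
      rw [Finset.sum_comm]
      exact Finset.sum_congr rfl fun c _ => Finset.sum_congr rfl fun d _ => smul_comm _ _ _
    have e3 : A j x * A k x = ∑ d, jac θ x d k • ∑ c, jac θ x c j •
        (chrMat G c (θ x) * chrMat G d (θ x)) := by
      rw [e2]
      simp only [Finset.smul_sum]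
      rw [Finset.sum_comm]
      exact Finset.sum_congr rfl fun c _ => Finset.sum_congr rfl fun d _ => smul_comm _ _ _
    rw [e1, e2, e3]
    simp only [curvMat, smul_add, smul_sub, Finset.sum_add_distrib, Finset.sum_sub_distrib]
  have h1 := hdiff k j
  have h2 := hdiff j k
  rw [pdMat_pdMat_comm hJs j k] at h2
  rw [hdJ k, hdJ j] at *
  rw [hcurv]
  simp only [curvMat]
  have h3 : jac θ x * pdMat k (chrMat G' j) x - jac θ x * pdMat j (chrMat G' k) x
      = (pdMat k (A j) x * jac θ x + A j x * (jac θ x * chrMat G' k x - A k x * jac θ x))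
        - (jac θ x * chrMat G' k x - A k x * jac θ x) * chrMat G' j x
        - (pdMat j (A k) x * jac θ x + A k x * (jac θ x * chrMat G' j x - A j x * jac θ x))
        + (jac θ x * chrMat G' j x - A j x * jac θ x) * chrMat G' k x := by
    rw [eq_sub_of_add_eq' h1, eq_sub_of_add_eq' h2]
    abel
  calc jac θ x * (pdMat k (chrMat G' j) x - pdMat j (chrMat G' k) x
        + chrMat G' k x * chrMat G' j x - chrMat G' j x * chrMat G' k x)
      = (jac θ x * pdMat k (chrMat G' j) x - jac θ x * pdMat j (chrMat G' k) x)
        + jac θ x * chrMat G' k x * chrMat G' j x - jac θ x * chrMat G' j x * chrMat G' k x := by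
        noncomm_ring
    _ = _ := by rw [h3]; noncomm_ring

theorem coordRicci_eq (h : IsMetricChange G G' θ U) {x : EuclideanSpace ℝ (Fin n)} (hx : x ∈ U) :
    coordRicci G' x = (jac θ x)ᵀ * coordRicci G (θ x) * jac θ x := by
  have hu := isUnit_iff_ne_zero.2 (h.det_jac_ne x hx)
  ext i j
  rw [KRicci.coordRicci_eq (h.isSymm_source hx)]
  have h1 : ∀ l, curvMat G' l j x = ∑ d, jac θ x d l • ((jac θ x)⁻¹ *
      ((∑ c, jac θ x c j • curvMat G d c (θ x)) * jac θ x)) := fun l => by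
    rw [← Matrix.nonsing_inv_mul_cancel_left (A := jac θ x) (curvMat G' l j x) hu,
      h.curvMat_eq hx, Finset.sum_mul, Finset.mul_sum]
    exact Finset.sum_congr rfl fun d _ => by rw [Matrix.smul_mul, Matrix.mul_smul]
  have h2 : ∑ l, curvMat G' l j x l i
      = ∑ d, ((∑ c, jac θ x c j • curvMat G d c (θ x)) * jac θ x) d i := by
    simp only [h1, Matrix.sum_apply]
    rw [Finset.sum_comm]
    refine Finset.sum_congr rfl fun d _ => ?_
    simp only [Matrix.smul_apply, smul_eq_mul]
    rw [← Matrix.mul_apply, Matrix.mul_nonsing_inv_cancel_left _ _ hu]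
  rw [h2]
  simp only [Matrix.mul_apply, Matrix.sum_apply, Matrix.smul_apply, smul_eq_mul,
    KRicci.coordRicci_eq (h.isSymm x hx), Finset.sum_mul, Finset.mul_sum, Matrix.transpose_apply]
  rw [sum_reverse₃]
  refine Finset.sum_congr rfl fun a _ => Finset.sum_congr rfl fun b _ =>
    Finset.sum_congr rfl fun c _ => by ring

theorem pd_comp (h : IsMetricChange G G' θ U) {x : EuclideanSpace ℝ (Fin n)} (hx : x ∈ U)
    {f : EuclideanSpace ℝ (Fin n) → ℝ} (hf : DifferentiableAt ℝ f (θ x)) (i : Fin n) :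
    pd i (fun y => f (θ y)) x = ∑ c, jac θ x c i * pd c f (θ x) :=
  pd_comp_map hf ((h.smooth_map x hx).differentiableAt (by simp)) i

theorem coordHessian_eq (h : IsMetricChange G G' θ U) {x : EuclideanSpace ℝ (Fin n)} (hx : x ∈ U)
    {f : EuclideanSpace ℝ (Fin n) → ℝ} (hf : ContDiffAt ℝ 2 f (θ x)) :
    coordHessian G' (fun y => f (θ y)) x
      = (jac θ x)ᵀ * coordHessian G f (θ x) * jac θ x := by
  have hθ := h.smooth_map x hx
  have hθd : DifferentiableAt ℝ θ x := hθ.differentiableAt (by simp)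
  have hJs : SmoothMat (jac θ) x := smoothMat_jac hθ
  have hpf : ∀ c, DifferentiableAt ℝ (pd c f) (θ x) := fun c =>
    (contDiffAt_pd hf (k := 1) (by norm_num) c).differentiableAt (by simp)
  have hev : ∀ᶠ y in 𝓝 x, DifferentiableAt ℝ f (θ y) := by
    have h1 : ∀ᶠ z in 𝓝 (θ x), ContDiffAt ℝ 2 f z := hf.eventually (by simp)
    filter_upwards [hθ.continuousAt.eventually h1] with y hy using hy.differentiableAt (by simp)
  ext i j
  have h1 : pd i (pd j fun y => f (θ y)) x
      = ∑ c, (pdMat i (jac θ) x c j * pd c f (θ x)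
        + jac θ x c j * ∑ d, jac θ x d i * pd d (pd c f) (θ x)) := by
    have e : pd j (fun y => f (θ y)) =ᶠ[𝓝 x] fun y => ∑ c, jac θ y c j * pd c f (θ y) := by
      filter_upwards [hev, h.isOpen.mem_nhds hx] with y hy hyU using h.pd_comp hyU hy j
    have hd1 : ∀ c, DifferentiableAt ℝ (fun y => jac θ y c j) x := fun c =>
      infty_differentiableAt (hJs c j)
    have hd2 : ∀ c, DifferentiableAt ℝ (fun y => pd c f (θ y)) x := fun c =>
      (hpf c).comp x hθd
    rw [pd_congr e, pd_sum fun c _ => (hd1 c).fun_mul (hd2 c)]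
    refine Finset.sum_congr rfl fun c _ => ?_
    rw [pd_mul (hd1 c) (hd2 c), pd_comp_map (hpf c) hθd]
    rfl
  have h2 : ∀ m, pd m (fun y => f (θ y)) x = ∑ c, jac θ x c m * pd c f (θ x) := fun m =>
    h.pd_comp hx (hf.differentiableAt (by simp)) m
  have h3 : ∑ m, christoffel G' m i j x * pd m (fun y => f (θ y)) x
      = ∑ c, (jac θ x * chrMat G' j x) c i * pd c f (θ x) := by
    simp only [h2, Matrix.mul_apply, Finset.mul_sum, Finset.sum_mul]
    rw [Finset.sum_comm]
    refine Finset.sum_congr rfl fun c _ => Finset.sum_congr rfl fun m _ => ?_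
    simp only [chrMat, Matrix.of_apply]; ring
  rw [coordHessian, Matrix.of_apply, h1, h3, h.chrMat_eq hx, Finset.sum_add_distrib]
  simp only [Matrix.add_apply, add_mul, Finset.sum_add_distrib]
  have h4 : ∑ c, pdMat i (jac θ) x c j * pd c f (θ x) = ∑ c, pdMat j (jac θ) x c i * pd c f (θ x) :=
    Finset.sum_congr rfl fun c _ => by rw [pdMat_jac_symm hθ]
  rw [h4, add_sub_add_left_eq_sub]
  simp only [Matrix.mul_apply, coordHessian, Matrix.of_apply, Matrix.transpose_apply, mul_sub,
    sub_mul, Finset.sum_sub_distrib]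
  congr 1
  · simp only [Finset.mul_sum, Finset.sum_mul]
    exact Finset.sum_congr rfl fun c _ => Finset.sum_congr rfl fun d _ => by ring
  · simp only [Finset.mul_sum, Finset.sum_mul, Matrix.sum_apply, Matrix.smul_apply, smul_eq_mul,
      chrMat, Matrix.of_apply]
    rw [sum_reverse₃]
    exact Finset.sum_congr rfl fun a _ => Finset.sum_congr rfl fun c _ =>
      Finset.sum_congr rfl fun d _ => by ring

end IsMetricChange

/-! ### Symmetry of the Hessian and of the Ricci tensor -/

theorem coordHessian_isSymm {G : 𝔼 → Matrix (Fin n) (Fin n) ℝ} {y : 𝔼}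
    (hG : ∀ᶠ z in 𝓝 y, (G z).IsSymm) {f : 𝔼 → ℝ} (hf : ContDiffAt ℝ 2 f y) :
    (coordHessian G f y).IsSymm := by
  ext i j
  simp only [Matrix.transpose_apply, coordHessian, Matrix.of_apply]
  rw [pd_comm hf]
  congr 1
  exact Finset.sum_congr rfl fun m _ => by rw [christoffel_symm hG]

theorem sum_christoffel_eq {G : 𝔼 → Matrix (Fin n) (Fin n) ℝ} {y : 𝔼}
    (hG : ∀ᶠ z in 𝓝 y, (G z).IsSymm) (i : Fin n) :
    ∑ l, christoffel G l i l y = (1 / 2 : ℝ) * ((G y)⁻¹ * pdMat i G y).trace := by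
  have hinv : ∀ l m, (G y)⁻¹ l m = (G y)⁻¹ m l := fun l m => by
    have h1 : ((G y)⁻¹).IsSymm := by
      rw [Matrix.IsSymm, Matrix.transpose_nonsing_inv, hG.self_of_nhds.eq]
    exact h1.apply m l
  have hs : ∀ a b c, pd c (fun z => G z a b) y = pd c (fun z => G z b a) y := fun a b c =>
    pd_congr (by filter_upwards [hG] with z hz using hz.apply b a) c
  simp only [christoffel, ← Finset.mul_sum, Matrix.trace, Matrix.diag_apply, Matrix.mul_apply]
  congr 1
  have e1 : ∑ l, ∑ m, (G y)⁻¹ l m * pd l (fun z => G z i m) y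
      = ∑ l, ∑ m, (G y)⁻¹ l m * pd m (fun z => G z i l) y := by
    rw [Finset.sum_comm]
    exact Finset.sum_congr rfl fun a _ => Finset.sum_congr rfl fun b _ => by rw [hinv]
  simp only [mul_add, mul_sub, Finset.sum_add_distrib, Finset.sum_sub_distrib, e1,
    add_sub_cancel_right]
  refine Finset.sum_congr rfl fun a _ => Finset.sum_congr rfl fun b _ => ?_
  rw [hs a b]; rfl

/-- The only term whose symmetry is not formal is ∂_j Γ^l_{il}. The contraction Γ^l_{il} = ½ tr(G⁻¹
∂_i G) is a gradient, that of ½ log det G; its derivative is computed directly and is symmetric by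
the cyclicity of the trace. -/
theorem coordRicci_isSymm {G : 𝔼 → Matrix (Fin n) (Fin n) ℝ} {y : 𝔼}
    (hG : ∀ᶠ z in 𝓝 y, (G z).IsSymm) (hs : SmoothMat G y) (hdet : (G y).det ≠ 0) :
    (coordRicci G y).IsSymm := by
  have hc : ∀ᶠ z in 𝓝 y, ∀ m i j, christoffel G m i j z = christoffel G m j i z := by
    filter_upwards [hG.eventually_nhds] with z hz m i j using christoffel_symm hz m i j
  have hcd : ∀ m i j, DifferentiableAt ℝ (christoffel G m i j) y := fun m i j =>
    infty_differentiableAt (smoothMat_chrMat hs hdet j m i)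
  have htr : ∀ i j, ∑ l, pd j (christoffel G l i l) y = (1 / 2 : ℝ) *
      (((G y)⁻¹ * pdMat j (pdMat i G) y).trace
        - ((G y)⁻¹ * pdMat j G y * (G y)⁻¹ * pdMat i G y).trace) := by
    intro i j
    have hev : (fun z => ∑ l, christoffel G l i l z)
        =ᶠ[𝓝 y] fun z => ∑ a, (1 / 2 : ℝ) * ((G z)⁻¹ * pdMat i G z) a a := by
      filter_upwards [hG.eventually_nhds] with z hz
      rw [sum_christoffel_eq hz, ← Finset.mul_sum]; rfl
    have hsm : SmoothMat (fun z => (G z)⁻¹ * pdMat i G z) y := (hs.inv hdet).mul (hs.pdMat i)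
    rw [← pd_sum fun l _ => hcd l i l, pd_congr hev,
      pd_sum fun a _ => (infty_differentiableAt (hsm a a)).const_mul _]
    have e : ∀ a, pd j (fun z => (1 / 2 : ℝ) * ((G z)⁻¹ * pdMat i G z) a a) y
        = (1 / 2 : ℝ) * (pdMat j (fun z => (G z)⁻¹ * pdMat i G z) y) a a := fun a =>
      pd_const_mul (infty_differentiableAt (hsm a a)) _ j
    simp only [e, ← Finset.mul_sum]
    congr 1
    rw [pdMat_mul (hs.inv hdet) (hs.pdMat i), pdMat_inv hs hdet]
    rw [← Matrix.trace_sub]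
    simp only [Matrix.trace, Matrix.diag_apply]
    refine Finset.sum_congr rfl fun a _ => ?_
    rw [Matrix.neg_mul]
    simp only [Matrix.add_apply, Matrix.neg_apply, Matrix.sub_apply]
    ring
  have htr' : ∀ i j, ∑ l, pd j (christoffel G l i l) y = ∑ l, pd i (christoffel G l j l) y := by
    intro i j
    rw [htr, htr, IsMetricChange.pdMat_pdMat_comm hs j i]
    congr 2
    rw [mul_assoc, Matrix.trace_mul_comm, ← mul_assoc]
  ext i j
  simp only [Matrix.transpose_apply, coordRicci, Matrix.of_apply, Finset.sum_sub_distrib]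
  have e1 : ∑ l, pd l (christoffel G l j i) y = ∑ l, pd l (christoffel G l i j) y :=
    Finset.sum_congr rfl fun l _ => pd_congr (by filter_upwards [hc] with z hz using hz l j i) l
  have e2 : ∑ l, ∑ m, christoffel G l j i y * christoffel G m l m y
      = ∑ l, ∑ m, christoffel G l i j y * christoffel G m l m y :=
    Finset.sum_congr rfl fun l _ => Finset.sum_congr rfl fun m _ => by
      rw [hc.self_of_nhds l j i]
  have e3 : ∑ l, ∑ m, christoffel G m j l y * christoffel G l i m y
      = ∑ l, ∑ m, christoffel G m i l y * christoffel G l j m y := by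
    rw [Finset.sum_comm]
    exact Finset.sum_congr rfl fun l _ => Finset.sum_congr rfl fun m _ => mul_comm _ _
  rw [e1, e2, e3, htr' j i]

end

/-! ### Smooth square roots and orthonormal frames -/

/-- Near `1`, the elements of a Banach algebra have an analytic square root. -/
theorem exists_local_sqrt (A : Type*) [NormedRing A] [NormedAlgebra ℝ A] [CompleteSpace A] :
    ∃ s : A → A, s 1 = 1 ∧ (∀ᶠ Y in 𝓝 1, ContDiffAt ℝ ω s Y) ∧ (∀ᶠ Y in 𝓝 1, s Y * s Y = Y) ∧
      ∀ᶠ X in 𝓝 1, s (X * X) = X := by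
  set f : A → A := fun X => X * X with hf
  have hc : ContDiffAt ℝ ω f 1 := contDiffAt_id.mul contDiffAt_id
  set e : A ≃L[ℝ] A :=
    ContinuousLinearEquiv.smulLeft (Units.mk0 (2 : ℝ) two_ne_zero) with he
  -- Squaring has the invertible derivative 2 · id at 1, so the inverse function theorem applies.
  have hd : HasFDerivAt f (e : A →L[ℝ] A) 1 := by
    have h := (hasFDerivAt_id (𝕜 := ℝ) (1 : A)).mul' (hasFDerivAt_id (𝕜 := ℝ) (1 : A))
    refine h.congr_fderiv ?_
    ext X
    simp [he, two_smul]
  have hn : (ω : ℕ∞ω) ≠ 0 := by simp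
  have h1 : f 1 = 1 := by simp [hf]
  set s := hc.localInverse hd hn with hs
  have hs1 : s 1 = 1 := by
    have := hc.localInverse_apply_image hd hn
    rwa [h1] at this
  have hcs : ContDiffAt ℝ ω s 1 := by
    have := hc.to_localInverse hd hn
    rwa [h1] at this
  have hst := hc.hasStrictFDerivAt' hd hn
  have hr : ∀ᶠ Y in 𝓝 1, s Y * s Y = Y := by
    have := hst.eventually_right_inverse
    rw [h1] at this
    exact this
  exact ⟨s, hs1, hcs.eventually (by simp), hr, hst.eventually_left_inverse⟩

section

variable {n : ℕ}

open scoped Matrix.Norms.Operator in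
/-- A smooth field of symmetric matrices has a smooth symmetric square root near a point where it
is the identity. -/
theorem exists_smoothMat_sqrt {Y : EuclideanSpace ℝ (Fin n) → Matrix (Fin n) (Fin n) ℝ}
    {y₀ : EuclideanSpace ℝ (Fin n)} (hY : ∀ᶠ y in 𝓝 y₀, SmoothMat Y y)
    (hsymm : ∀ᶠ y in 𝓝 y₀, (Y y).IsSymm) (h1 : Y y₀ = 1) :
    ∃ R : EuclideanSpace ℝ (Fin n) → Matrix (Fin n) (Fin n) ℝ,
      ∀ᶠ y in 𝓝 y₀, SmoothMat R y ∧ (R y).IsSymm ∧ R y * R y = Y y := by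
  obtain ⟨s, hs1, hsc, hsq, hsl⟩ := exists_local_sqrt (Matrix (Fin n) (Fin n) ℝ)
  have hYc : ∀ᶠ y in 𝓝 y₀, ContDiffAt ℝ ∞ Y y := by
    filter_upwards [hY] with y hy
    have h : Y = fun x => ∑ i, ∑ j, Y x i j • Matrix.single i j (1 : ℝ) := by
      funext x
      conv_lhs => rw [Matrix.matrix_eq_sum_single (Y x)]
      simp [Matrix.smul_single]
    rw [h]
    exact ContDiffAt.sum fun i _ => ContDiffAt.sum fun j _ => (hy i j).smul contDiffAt_const
  have hT : Filter.Tendsto Y (𝓝 y₀) (𝓝 1) := by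
    have := hYc.self_of_nhds.continuousAt
    rwa [ContinuousAt, h1] at this
  have htr : ContDiff ℝ ω (fun X : Matrix (Fin n) (Fin n) ℝ => Xᵀ) :=
    (Matrix.transposeLinearEquiv (Fin n) (Fin n) ℝ ℝ).toLinearMap.toContinuousLinearMap.contDiff
  have hT2 : Filter.Tendsto (fun y => (s (Y y))ᵀ) (𝓝 y₀) (𝓝 1) := by
    have h2 : ContinuousAt (fun X => (s X)ᵀ) 1 :=
      htr.continuous.continuousAt.comp hsc.self_of_nhds.continuousAt
    have h3 : (s 1)ᵀ = 1 := by rw [hs1, Matrix.transpose_one]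
    rw [ContinuousAt, h3] at h2
    exact h2.comp hT
  refine ⟨fun y => s (Y y), ?_⟩
  filter_upwards [hYc, hsymm, hT.eventually hsc, hT.eventually hsq, hT2.eventually hsl]
    with y hy1 hy2 hy3 hy4 hy5
  refine ⟨fun a b => ?_, ?_, hy4⟩
  · have h2 : ContDiffAt ℝ ∞ (fun z => s (Y z)) y := (hy3.of_le le_top).comp y hy1
    have h3 := (Matrix.entryLinearMap ℝ ℝ a b).toContinuousLinearMap.contDiff (n := ∞)
    exact h3.contDiffAt.comp y h2
  · have h4 : (s (Y y))ᵀ * (s (Y y))ᵀ = Y y := by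
      rw [← Matrix.transpose_mul, hy4, hy2.eq]
    rw [h4] at hy5
    exact hy5.symm

/-- A smooth metric has a smooth orthonormal frame near any point. -/
theorem exists_frame {G : EuclideanSpace ℝ (Fin n) → Matrix (Fin n) (Fin n) ℝ}
    {y₀ : EuclideanSpace ℝ (Fin n)} (hG : ∀ᶠ y in 𝓝 y₀, SmoothMat G y)
    (hsymm : ∀ᶠ y in 𝓝 y₀, (G y).IsSymm) (hpos : (G y₀).PosDef) :
    ∃ E : EuclideanSpace ℝ (Fin n) → Matrix (Fin n) (Fin n) ℝ,
      ∀ᶠ y in 𝓝 y₀, SmoothMat E y ∧ (E y)ᵀ * G y * E y = 1 := by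
  have hc : ∀ (A : Matrix (Fin n) (Fin n) ℝ) y, SmoothMat (fun _ => A) y :=
      fun A y a b => contDiffAt_const
  obtain ⟨E₀, hE₀⟩ : ∃ E₀ : Matrix (Fin n) (Fin n) ℝ, E₀ᵀ * G y₀ * E₀ = 1 := by
    have hH := hpos.isHermitian
    set O : Matrix (Fin n) (Fin n) ℝ := hH.eigenvectorUnitary.1 with hO
    have h1 : Oᵀ * O = 1 := by
      have := Unitary.coe_star_mul_self hH.eigenvectorUnitary
      rwa [Matrix.star_eq_conjTranspose, Matrix.conjTranspose_eq_transpose_of_trivial] at this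
    have h2 : G y₀ = O * Matrix.diagonal hH.eigenvalues * Oᵀ := by
      have := hH.spectral_theorem
      rw [Unitary.conjStarAlgAut_apply] at this
      rw [Matrix.star_eq_conjTranspose, Matrix.conjTranspose_eq_transpose_of_trivial] at this
      exact this
    have hd := fun i => hpos.eigenvalues_pos i
    refine ⟨O * Matrix.diagonal fun i => (√(hH.eigenvalues i))⁻¹, ?_⟩
    rw [Matrix.transpose_mul, Matrix.diagonal_transpose]
    generalize hH.eigenvalues = d at *
    rw [h2]
    calc _ = Matrix.diagonal (fun i => (√(d i))⁻¹) * (Oᵀ * O) * Matrix.diagonal d * (Oᵀ * O)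
          * Matrix.diagonal (fun i => (√(d i))⁻¹) := by simp only [mul_assoc]
      _ = 1 := by
        rw [h1, mul_one, mul_one, Matrix.diagonal_mul_diagonal, Matrix.diagonal_mul_diagonal,
          ← Matrix.diagonal_one]
        congr 1
        funext i
        have h3 := Real.sqrt_ne_zero'.2 (hd i)
        field_simp
        rw [Real.sq_sqrt (hd i).le]
  -- The constant frame E₀ is orthonormal at y₀ only; E₀ Y^{-1/2} corrects it nearby, and Y y₀ = 1
  -- is where the square root is available.
  set Y : EuclideanSpace ℝ (Fin n) → Matrix (Fin n) (Fin n) ℝ := fun y => E₀ᵀ * G y * E₀ with hY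
  have hYs : ∀ᶠ y in 𝓝 y₀, SmoothMat Y y := by
    filter_upwards [hG] with y hy using ((hc _ y).mul hy).mul (hc _ y)
  have hYsymm : ∀ᶠ y in 𝓝 y₀, (Y y).IsSymm := by
    filter_upwards [hsymm] with y hy
    simp only [hY]
    rw [Matrix.IsSymm, Matrix.transpose_mul, Matrix.transpose_mul, hy.eq,
      Matrix.transpose_transpose, mul_assoc]
  obtain ⟨R, hR⟩ := exists_smoothMat_sqrt hYs hYsymm hE₀
  have hdet : ∀ᶠ y in 𝓝 y₀, (Y y).det ≠ 0 :=
    (contDiffAt_det hYs.self_of_nhds).continuousAt.eventually_ne (by simp [hY, hE₀])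
  refine ⟨fun y => E₀ * (R y)⁻¹, ?_⟩
  filter_upwards [hR, hdet] with y ⟨h1, h2, h3⟩ h4
  have h5 : (R y).det ≠ 0 := by
    rw [← h3, Matrix.det_mul] at h4
    exact left_ne_zero_of_mul h4
  have hu := isUnit_iff_ne_zero.2 h5
  refine ⟨(hc _ y).mul (h1.inv h5), ?_⟩
  rw [Matrix.transpose_mul, Matrix.transpose_nonsing_inv, h2.eq]
  calc (R y)⁻¹ * E₀ᵀ * G y * (E₀ * (R y)⁻¹) = (R y)⁻¹ * (E₀ᵀ * G y * E₀) * (R y)⁻¹ := by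
        simp only [mul_assoc]
    _ = (R y)⁻¹ * (R y * R y) * (R y)⁻¹ := by rw [h3]
    _ = 1 := by
      rw [← mul_assoc, Matrix.nonsing_inv_mul _ hu, one_mul, Matrix.mul_nonsing_inv _ hu]

end

/-! ### Uniform bounds for a frame -/

section

variable {n : ℕ}

local notation "𝔼" => EuclideanSpace ℝ (Fin n)

theorem exists_jetBound_of_smooth {f : 𝔼 → ℝ} {y₀ : 𝔼}
    (hf : ∀ᶠ y in 𝓝 y₀, ContDiffAt ℝ ∞ f y) : ∃ Λ, ∀ᶠ y in 𝓝 y₀, JetBound Λ f y := by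
  have hb : ∀ {h : 𝔼 → ℝ}, ContDiffAt ℝ ∞ h y₀ → ∀ᶠ y in 𝓝 y₀, |h y| ≤ |h y₀| + 1 := fun hh => by
    filter_upwards [hh.continuousAt.abs.eventually_lt_const (lt_add_one _)] with y hy using hy.le
  have h0 := hf.self_of_nhds
  refine ⟨|f y₀| + 1 + ∑ c, (|pd c f y₀| + 1) + ∑ c, ∑ d, (|pd c (pd d f) y₀| + 1), ?_⟩
  have h1 : ∀ᶠ y in 𝓝 y₀, ∀ c, |pd c f y| ≤ |pd c f y₀| + 1 :=
    Filter.eventually_all.2 fun c => hb (contDiffAt_pd_infty h0 c)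
  have h2 : ∀ᶠ y in 𝓝 y₀, ∀ c d, |pd c (pd d f) y| ≤ |pd c (pd d f) y₀| + 1 :=
    Filter.eventually_all.2 fun c => Filter.eventually_all.2 fun d =>
      hb (contDiffAt_pd_infty (contDiffAt_pd_infty h0 d) c)
  have n1 : 0 ≤ ∑ c, (|pd c f y₀| + 1) := Finset.sum_nonneg fun _ _ => by positivity
  have n2 : 0 ≤ ∑ c, ∑ d, (|pd c (pd d f) y₀| + 1) :=
    Finset.sum_nonneg fun _ _ => Finset.sum_nonneg fun _ _ => by positivity
  have n0 : 0 ≤ |f y₀| + 1 := by positivity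
  filter_upwards [hf, hb h0, h1, h2] with y g0 g1 g2 g3
  refine ⟨infty_two g0, by linarith, fun c => ?_, fun c d => ?_⟩
  · have := Finset.single_le_sum (f := fun c => |pd c f y₀| + 1) (fun _ _ => by positivity)
      (Finset.mem_univ c)
    linarith [g2 c]
  · have e1 := Finset.single_le_sum (f := fun d => |pd c (pd d f) y₀| + 1)
      (fun _ _ => by positivity) (Finset.mem_univ d)
    have e2 := Finset.single_le_sum (f := fun c => ∑ d, (|pd c (pd d f) y₀| + 1))
      (fun _ _ => Finset.sum_nonneg fun _ _ => by positivity) (Finset.mem_univ c)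
    linarith [g3 c d]

theorem exists_jetBound_family {ι : Type*} [Finite ι] {f : ι → 𝔼 → ℝ} {y₀ : 𝔼}
    (hf : ∀ i, ∀ᶠ y in 𝓝 y₀, ContDiffAt ℝ ∞ (f i) y) :
    ∃ Λ, ∀ᶠ y in 𝓝 y₀, ∀ i, JetBound Λ (f i) y := by
  have := Fintype.ofFinite ι
  choose Λ hΛ using fun i => exists_jetBound_of_smooth (hf i)
  have h0 : ∀ i, 0 ≤ Λ i := fun i => (hΛ i).self_of_nhds.nonneg
  refine ⟨∑ i, Λ i, Filter.eventually_all.2 fun i => ?_⟩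
  filter_upwards [hΛ i] with y hy using
    hy.mono (Finset.single_le_sum (fun j _ => h0 j) (Finset.mem_univ i))

/-- `E` is an orthonormal frame of `G` near `x`, and the geometric quantities attached to it are
bounded by `Λ` at `x`. -/
structure FrameBound (G E : 𝔼 → Matrix (Fin n) (Fin n) ℝ) (Λ : ℝ) (x : 𝔼) : Prop where
  one_le : 1 ≤ Λ
  smooth : ∀ᶠ y in 𝓝 x, SmoothMat G y
  isSymm : ∀ᶠ y in 𝓝 x, (G y).IsSymm
  ortho : ∀ᶠ y in 𝓝 x, (E y)ᵀ * G y * E y = 1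
  frame : ∀ i j, JetBound Λ (fun y => E y i j) x
  metric : ∀ i j, JetBound Λ (fun y => G y i j) x
  inv : ∀ i j, JetBound Λ (fun y => (G y)⁻¹ i j) x
  chr : ∀ m i j, JetBound Λ (christoffel G m i j) x
  ricci : ∀ i j, JetBound Λ (fun y => coordRicci G y i j) x

theorem inv_eq_of_ortho {G E : Matrix (Fin n) (Fin n) ℝ} (h : Eᵀ * G * E = 1) :
    G⁻¹ = E * Eᵀ := by
  have h1 : E * (Eᵀ * G) = 1 := mul_eq_one_comm.1 h
  exact Matrix.inv_eq_left_inv (by rwa [mul_assoc])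

theorem det_ne_of_ortho {G E : Matrix (Fin n) (Fin n) ℝ} (h : Eᵀ * G * E = 1) : G.det ≠ 0 := by
  have h1 := congrArg Matrix.det h
  rw [Matrix.det_mul, Matrix.det_mul, Matrix.det_one] at h1
  intro h2
  rw [h2] at h1
  simp at h1

theorem contDiffAt_coordRicci {G : 𝔼 → Matrix (Fin n) (Fin n) ℝ} {y : 𝔼} (hG : SmoothMat G y)
    (hdet : (G y).det ≠ 0) : SmoothMat (coordRicci G) y := fun i j => by
  have h : ∀ m i j, ContDiffAt ℝ ∞ (christoffel G m i j) y := fun m i j =>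
    smoothMat_chrMat hG hdet j m i
  simp only [coordRicci, Matrix.of_apply]
  refine (ContDiffAt.sum fun l _ => ?_).add (ContDiffAt.sum fun l _ => ContDiffAt.sum fun m _ => ?_)
  · exact (contDiffAt_pd_infty (h _ _ _) _).sub (contDiffAt_pd_infty (h _ _ _) _)
  · exact ((h _ _ _).mul (h _ _ _)).sub ((h _ _ _).mul (h _ _ _))

theorem exists_frameBound {G : 𝔼 → Matrix (Fin n) (Fin n) ℝ} {y₀ : 𝔼}
    (hG : ∀ᶠ y in 𝓝 y₀, SmoothMat G y) (hsymm : ∀ᶠ y in 𝓝 y₀, (G y).IsSymm)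
    (hpos : (G y₀).PosDef) : ∃ E Λ, ∀ᶠ y in 𝓝 y₀, FrameBound G E Λ y := by
  obtain ⟨E, hE⟩ := exists_frame hG hsymm hpos
  have hdet : ∀ᶠ y in 𝓝 y₀, (G y).det ≠ 0 := by
    filter_upwards [hE] with y hy using det_ne_of_ortho hy.2
  obtain ⟨Λ₁, h1⟩ := exists_jetBound_family (y₀ := y₀)
    (f := fun (z : Fin n × Fin n) y => E y z.1 z.2)
    fun z => by filter_upwards [hE] with y hy using hy.1 z.1 z.2
  obtain ⟨Λ₂, h2⟩ := exists_jetBound_family (y₀ := y₀)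
    (f := fun (z : Fin n × Fin n) y => G y z.1 z.2)
    fun z => by filter_upwards [hG] with y hy using hy z.1 z.2
  obtain ⟨Λ₃, h3⟩ := exists_jetBound_family (y₀ := y₀)
    (f := fun (z : Fin n × Fin n) y => (G y)⁻¹ z.1 z.2)
    fun z => by filter_upwards [hG, hdet] with y hy hy' using hy.inv hy' z.1 z.2
  obtain ⟨Λ₄, h4⟩ := exists_jetBound_family (y₀ := y₀)
    (f := fun (z : Fin n × Fin n × Fin n) y => christoffel G z.1 z.2.1 z.2.2 y)
    fun z => by
      filter_upwards [hG, hdet] with y hy hy' using smoothMat_chrMat hy hy' z.2.2 z.1 z.2.1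
  obtain ⟨Λ₅, h5⟩ := exists_jetBound_family (y₀ := y₀)
    (f := fun (z : Fin n × Fin n) y => coordRicci G y z.1 z.2)
    fun z => by filter_upwards [hG, hdet] with y hy hy' using contDiffAt_coordRicci hy hy' z.1 z.2
  set Λ := 1 + |Λ₁| + |Λ₂| + |Λ₃| + |Λ₄| + |Λ₅| with hΛ
  have a1 := abs_nonneg Λ₁
  have a2 := abs_nonneg Λ₂
  have a3 := abs_nonneg Λ₃
  have a4 := abs_nonneg Λ₄
  have a5 := abs_nonneg Λ₅
  refine ⟨E, Λ, ?_⟩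
  filter_upwards [h1, h2, h3, h4, h5, hG.eventually_nhds, hsymm.eventually_nhds,
    hE.eventually_nhds] with y g1 g2 g3 g4 g5 g6 g7 g8
  exact
    { one_le := by linarith
      smooth := g6
      isSymm := g7
      ortho := g8.mono fun _ h => h.2
      frame := fun i j => (g1 (i, j)).mono (by linarith [le_abs_self Λ₁])
      metric := fun i j => (g2 (i, j)).mono (by linarith [le_abs_self Λ₂])
      inv := fun i j => (g3 (i, j)).mono (by linarith [le_abs_self Λ₃])
      chr := fun m i j => (g4 (m, i, j)).mono (by linarith [le_abs_self Λ₄])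
      ricci := fun i j => (g5 (i, j)).mono (by linarith [le_abs_self Λ₅]) }

/-! ### The equation in a frame -/

/-- The components of the tensor `g 𝒲[v]` in coordinates. -/
noncomputable def calS (G : 𝔼 → Matrix (Fin n) (Fin n) ℝ) (v : 𝔼 → ℝ) (y : 𝔼) :
    Matrix (Fin n) (Fin n) ℝ :=
  coordHessian G v y - Matrix.vecMulVec (fun i => pd i v y) (fun i => pd i v y)
    + (((G y)⁻¹ * coordHessian G v y).trace / ((n : ℝ) - 2)
      + ∑ i, ∑ j, (G y)⁻¹ i j * pd i v y * pd j v y) • G y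
    - ((n : ℝ) - 2)⁻¹ • coordRicci G y

/-- In coordinates, `v` is `m`-admissible and solves the equation of order `m + 1` at `y`. -/
def SolvesAt (m : ℕ) (G : 𝔼 → Matrix (Fin n) (Fin n) ℝ) (v α α₀ : 𝔼 → ℝ) (y : 𝔼) : Prop :=
  (∀ j, 1 ≤ j → j ≤ m → 0 < sigma j ((G y)⁻¹ * calS G v y)) ∧
    sigma (m + 1) ((((n : ℝ) - 2) * Real.exp (-2 * v y)) • ((G y)⁻¹ * calS G v y))
      + α y * sigma m ((((n : ℝ) - 2) * Real.exp (-2 * v y)) • ((G y)⁻¹ * calS G v y)) = α₀ y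

theorem calS_isSymm {G : 𝔼 → Matrix (Fin n) (Fin n) ℝ} {v : 𝔼 → ℝ} {y : 𝔼}
    (hsymm : ∀ᶠ z in 𝓝 y, (G z).IsSymm) (hs : SmoothMat G y) (hdet : (G y).det ≠ 0)
    (hv : ContDiffAt ℝ 2 v y) : (calS G v y).IsSymm := by
  refine Matrix.IsSymm.sub (Matrix.IsSymm.add (Matrix.IsSymm.sub (coordHessian_isSymm hsymm hv) ?_)
    (hsymm.self_of_nhds.smul _)) ((coordRicci_isSymm hsymm hs hdet).smul _)
  ext i j
  simp [Matrix.vecMulVec_apply, mul_comm]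

theorem sigma_zero (M : Matrix (Fin n) (Fin n) ℝ) : sigma 0 M = 1 := by
  simp [sigma, Multiset.esymm]

theorem isSymm_conj {S : Matrix (Fin n) (Fin n) ℝ} (hS : S.IsSymm) (E : Matrix (Fin n) (Fin n) ℝ) :
    (Eᵀ * S * E).IsHermitian := by
  rw [Matrix.IsHermitian, Matrix.conjTranspose_eq_transpose_of_trivial, Matrix.transpose_mul,
    Matrix.transpose_mul, hS.eq, Matrix.transpose_transpose, mul_assoc]

/-- The equation, rewritten in an orthonormal frame. -/
theorem solvesAt_frame {m : ℕ} (hn : 3 ≤ n) {G : 𝔼 → Matrix (Fin n) (Fin n) ℝ} {v α α₀ : 𝔼 → ℝ}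
    {y : 𝔼} (h : SolvesAt m G v α α₀ y) (hα₀ : 0 < α₀ y) {E : Matrix (Fin n) (Fin n) ℝ}
    (hE : Eᵀ * G y * E = 1) (hS : (calS G v y).IsSymm) :
    MatGam m (Eᵀ * calS G v y * E) ∧
      matOp m (Eᵀ * calS G v y * E)
        (α₀ y ^ ((m + 1 : ℕ) : ℝ)⁻¹ * (Real.exp (2 * v y) / ((n : ℝ) - 2)))
        = -(α y * (Real.exp (2 * v y) / ((n : ℝ) - 2))) ∧
      sigma (m + 1) (Eᵀ * calS G v y * E)
        = (α₀ y ^ ((m + 1 : ℕ) : ℝ)⁻¹ * (Real.exp (2 * v y) / ((n : ℝ) - 2))) ^ (m + 1)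
          - α y * (Real.exp (2 * v y) / ((n : ℝ) - 2)) * sigma m (Eᵀ * calS G v y * E) := by
  set M := Eᵀ * calS G v y * E with hM
  have hMH : M.IsHermitian := isSymm_conj hS E
  have hn2 : (0 : ℝ) < (n : ℝ) - 2 := by
    have : (3 : ℝ) ≤ n := by exact_mod_cast hn
    linarith
  set c := ((n : ℝ) - 2) * Real.exp (-2 * v y) with hc
  have hc0 : 0 < c := by positivity
  have hci : Real.exp (2 * v y) / ((n : ℝ) - 2) = c⁻¹ := by
    rw [hc, mul_inv, ← Real.exp_neg, div_eq_inv_mul]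
    congr 2; ring
  -- Orthonormality says that EᵀG is the inverse of E, so 𝒲[v] is similar to the symmetric matrix M
  -- and has the same σ_j.
  have hW : (G y)⁻¹ * calS G v y = E * M * (Eᵀ * G y) := by
    have h1 : E * (Eᵀ * G y) = 1 := mul_eq_one_comm.1 hE
    calc (G y)⁻¹ * calS G v y = E * Eᵀ * calS G v y * (E * (Eᵀ * G y)) := by
          rw [inv_eq_of_ortho hE, h1, mul_one]
      _ = _ := by simp only [hM, mul_assoc]
  have hs : ∀ j, sigma j ((G y)⁻¹ * calS G v y) = sigma j M := fun j => sigma_conj hE hW j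
  have hs' : ∀ j, sigma j (c • ((G y)⁻¹ * calS G v y)) = c ^ j * sigma j M := fun j => by
    rw [← sigma_smul hMH]
    refine sigma_conj hE ?_ j
    rw [hW, Matrix.mul_smul, Matrix.smul_mul]
  have hgam : MatGam m M := fun j hj => by
    rcases Nat.eq_zero_or_pos j with rfl | hj0
    · rw [sigma_zero]; exact one_pos
    · rw [← hs]; exact h.1 j hj0 hj
  have heq := h.2
  rw [hs', hs'] at heq
  have hroot : (α₀ y ^ ((m + 1 : ℕ) : ℝ)⁻¹) ^ (m + 1) = α₀ y :=
    Real.rpow_inv_natCast_pow hα₀.le (Nat.succ_ne_zero m)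
  have key : sigma (m + 1) M = (α₀ y ^ ((m + 1 : ℕ) : ℝ)⁻¹ * c⁻¹) ^ (m + 1)
      - α y * c⁻¹ * sigma m M := by
    rw [mul_pow, hroot, ← heq, inv_pow]
    have h1 : c ^ (m + 1) * (c ^ (m + 1))⁻¹ = 1 := mul_inv_cancel₀ (pow_pos hc0 _).ne'
    have h2 : c ^ m * (c ^ (m + 1))⁻¹ = c⁻¹ := by
      rw [pow_succ, mul_inv, mul_inv_cancel_left₀ (pow_pos hc0 _).ne']
    linear_combination (-sigma (m + 1) M) * h1 - α y * sigma m M * h2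
  have hm0 := hgam m le_rfl
  rw [hci]
  refine ⟨hgam, ?_, key⟩
  rw [matOp, key]
  field_simp
  ring

theorem trace_mul_eq_sum_prod {P S : Matrix (Fin n) (Fin n) ℝ} (hS : S.IsSymm) :
    (P * S).trace = ∑ z : Fin n × Fin n, P z.1 z.2 * S z.1 z.2 := by
  rw [Fintype.sum_prod_type]
  simp only [Matrix.trace, Matrix.diag_apply, Matrix.mul_apply]
  exact Finset.sum_congr rfl fun a _ => Finset.sum_congr rfl fun b _ => by rw [hS.apply]

/-- The linearised operator, contracted with `Q`, is a quasilinear expression in `v`. -/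
theorem trace_mul_calS {G : 𝔼 → Matrix (Fin n) (Fin n) ℝ} {v : 𝔼 → ℝ} {y : 𝔼}
    {Q : 𝔼 → Matrix (Fin n) (Fin n) ℝ} {s : 𝔼 → ℝ}
    (hH : (coordHessian G v y).IsSymm) (hR : (coordRicci G y).IsSymm)
    (hQ : (Q y * G y).trace = 1) :
    (Q y * calS G v y).trace + s y * Real.exp (2 * v y)
      = quasi v (fun z x => Q x z.1 z.2 + ((n : ℝ) - 2)⁻¹ * (G x)⁻¹ z.1 z.2)
          (fun z x => (G x)⁻¹ z.1 z.2 + (-1) * Q x z.1 z.2)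
          (fun a x => (-1) * ∑ z : Fin n × Fin n,
            (Q x z.1 z.2 + ((n : ℝ) - 2)⁻¹ * (G x)⁻¹ z.1 z.2) * christoffel G a z.1 z.2 x)
          (fun x => (-((n : ℝ) - 2)⁻¹) * ∑ z : Fin n × Fin n, Q x z.1 z.2 * coordRicci G x z.1 z.2)
          s y := by
  have hV : (Matrix.vecMulVec (fun i => pd i v y) (fun i => pd i v y)).IsSymm := by
    ext i j
    simp [Matrix.vecMulVec_apply, mul_comm]
  rw [calS, mul_sub, mul_add, mul_sub, Matrix.trace_sub, Matrix.trace_add, Matrix.trace_sub,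
    Matrix.mul_smul, Matrix.mul_smul, Matrix.trace_smul, Matrix.trace_smul, hQ,
    trace_mul_eq_sum_prod hH, trace_mul_eq_sum_prod hV, trace_mul_eq_sum_prod hR,
    trace_mul_eq_sum_prod hH, quasi]
  have e1 : ∑ i, ∑ j, (G y)⁻¹ i j * pd i v y * pd j v y
      = ∑ z : Fin n × Fin n, (G y)⁻¹ z.1 z.2 * (pd z.1 v y * pd z.2 v y) := by
    rw [Fintype.sum_prod_type]
    exact Finset.sum_congr rfl fun a _ => Finset.sum_congr rfl fun b _ => mul_assoc _ _ _
  have e2 : ∑ a, ((-1) * ∑ z : Fin n × Fin n,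
        (Q y z.1 z.2 + ((n : ℝ) - 2)⁻¹ * (G y)⁻¹ z.1 z.2) * christoffel G a z.1 z.2 y) * pd a v y
      = -∑ z : Fin n × Fin n, (Q y z.1 z.2 + ((n : ℝ) - 2)⁻¹ * (G y)⁻¹ z.1 z.2)
        * ∑ a, christoffel G a z.1 z.2 y * pd a v y := by
    simp only [Finset.mul_sum, Finset.sum_mul, ← Finset.sum_neg_distrib]
    rw [Finset.sum_comm]
    exact Finset.sum_congr rfl fun a _ => Finset.sum_congr rfl fun b _ => by ring
  rw [e1, e2]
  simp only [coordHessian, Matrix.of_apply, Matrix.vecMulVec_apply, mul_sub, add_mul,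
    Finset.sum_add_distrib, Finset.sum_sub_distrib, mul_assoc, ← Finset.mul_sum, smul_eq_mul]
  ring

end

/-! ### From concavity to barriers -/

section

variable {n : ℕ}

local notation "𝔼" => EuclideanSpace ℝ (Fin n)

theorem quadratic_eq (A : Matrix (Fin n) (Fin n) ℝ) (ξ : Fin n → ℝ) :
    ∑ z : Fin n × Fin n, A z.1 z.2 * (ξ z.1 * ξ z.2) = ξ ⬝ᵥ (A *ᵥ ξ) := by
  rw [Fintype.sum_prod_type]
  simp only [dotProduct, Matrix.mulVec, Finset.mul_sum]
  exact Finset.sum_congr rfl fun a _ => Finset.sum_congr rfl fun b _ => by ring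

theorem quadratic_conj (P E : Matrix (Fin n) (Fin n) ℝ) (ξ : Fin n → ℝ) :
    ξ ⬝ᵥ ((E * P * Eᵀ) *ᵥ ξ) = (Eᵀ *ᵥ ξ) ⬝ᵥ (P *ᵥ (Eᵀ *ᵥ ξ)) := by
  rw [← Matrix.mulVec_mulVec, ← Matrix.mulVec_mulVec, Matrix.dotProduct_mulVec,
    ← Matrix.mulVec_transpose]

theorem abs_mul_apply_le {A B : Matrix (Fin n) (Fin n) ℝ} {a b : ℝ} (ha : 0 ≤ a)
    (hA : ∀ i j, |A i j| ≤ a) (hB : ∀ i j, |B i j| ≤ b) (i j : Fin n) :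
    |(A * B) i j| ≤ n * (a * b) := by
  rw [Matrix.mul_apply]
  have := abs_sum_mul_le (ι := Fin n) (a := fun c => A i c) (b := fun c => B c j) ha
    (fun c => hA i c) fun c => hB c j
  simpa using this

theorem abs_apply_le_trace {P : Matrix (Fin n) (Fin n) ℝ} (hP : P.PosSemidef) (i j : Fin n) :
    |P i j| ≤ P.trace := by
  have hd : ∀ i, 0 ≤ P i i := fun i => hP.diag_nonneg
  have ht : ∀ i, P i i ≤ P.trace := fun i =>
    Finset.single_le_sum (f := fun i => P i i) (fun a _ => hd a) (Finset.mem_univ i)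
  have hs : P j i = P i j := by
    have := hP.isHermitian.apply i j
    simpa using this
  have key : ∀ e : ℝ, e ^ 2 = 1 → 0 ≤ P i i + P j j + 2 * e * P i j := by
    intro e he
    have h := hP.dotProduct_mulVec_nonneg (Pi.single i 1 + Pi.single j e)
    simp only [star_trivial, add_dotProduct, Matrix.mulVec_add, dotProduct_add,
      Matrix.mulVec_single, single_dotProduct] at h
    simp at h
    rw [hs] at h
    linear_combination h + P j j * he
  have h1 := key 1 (by norm_num)
  have h2 := key (-1) (by norm_num)
  rw [abs_le]
  constructor <;> linarith [ht i, ht j]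

/-- With η = Eᵀξ the form G⁻¹ is |η|², and ξ = G E η with the entries of G E bounded. -/
theorem FrameBound.ellipticity {G E : 𝔼 → Matrix (Fin n) (Fin n) ℝ} {Λ : ℝ} {x : 𝔼}
    (h : FrameBound G E Λ x) (ξ : Fin n → ℝ) :
    ∑ i, ξ i ^ 2 ≤ (n * (n * (n * (Λ * Λ)) ^ 2)) *
      ∑ z : Fin n × Fin n, (G x)⁻¹ z.1 z.2 * (ξ z.1 * ξ z.2) := by
  have hE := h.ortho.self_of_nhds
  have h0 : 0 ≤ Λ := zero_le_one.trans h.one_le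
  have h1 : G x * E x * (E x)ᵀ = 1 := mul_eq_one_comm.1 (by rw [← mul_assoc]; exact hE)
  set η := (E x)ᵀ *ᵥ ξ with hη
  have hq : ∑ z : Fin n × Fin n, (G x)⁻¹ z.1 z.2 * (ξ z.1 * ξ z.2) = ∑ i, η i ^ 2 := by
    rw [quadratic_eq, inv_eq_of_ortho hE]
    have := quadratic_conj 1 (E x) ξ
    rw [mul_one, Matrix.one_mulVec] at this
    rw [this]
    exact Finset.sum_congr rfl fun i _ => (sq _).symm
  have hξ : ξ = (G x * E x) *ᵥ η := by
    rw [hη, Matrix.mulVec_mulVec, h1, Matrix.one_mulVec]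
  rw [hq]
  have hb : ∀ i j, |(G x * E x) i j| ≤ n * (Λ * Λ) := fun i j =>
    abs_mul_apply_le h0 (fun i j => (h.metric i j).2.1) (fun i j => (h.frame i j).2.1) i j
  have hi : ∀ i, ξ i ^ 2 ≤ n * (n * (Λ * Λ)) ^ 2 * ∑ j, η j ^ 2 := by
    intro i
    have e : ξ i = ∑ j, (G x * E x) i j * η j := congrFun hξ i
    have e2 : ∑ j, (G x * E x) i j ^ 2 ≤ n * (n * (Λ * Λ)) ^ 2 := by
      have := Finset.sum_le_card_nsmul (Finset.univ : Finset (Fin n))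
        (fun j => (G x * E x) i j ^ 2) ((n * (Λ * Λ)) ^ 2) fun j _ => by
          rw [← sq_abs]; exact pow_le_pow_left₀ (abs_nonneg _) (hb i j) 2
      simpa using this
    rw [e]
    exact (Finset.sum_mul_sq_le_sq_mul_sq _ _ _).trans
      (mul_le_mul_of_nonneg_right e2 (Finset.sum_nonneg fun _ _ => sq_nonneg _))
  have := Finset.sum_le_card_nsmul (Finset.univ : Finset (Fin n)) (fun i => ξ i ^ 2) _
    fun i _ => hi i
  rw [mul_assoc]
  simpa using this

theorem jetBound_rpow {f : 𝔼 → ℝ} {x : 𝔼} {A₀ a p : ℝ} (hf : JetBound A₀ f x) (ha : 0 < a)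
    (hfa : a ≤ f x) (hp0 : 0 ≤ p) (hp1 : p ≤ 1) :
    JetBound ((A₀ ^ p + a ^ (p - 1) + a ^ (p - 2)) * (1 + A₀ + A₀ ^ 2)) (fun y => f y ^ p) x := by
  have hpos := ha.trans_le hfa
  have hA0 := hf.nonneg
  have n1 : 0 ≤ A₀ ^ p := Real.rpow_nonneg hA0 _
  have n2 : 0 ≤ a ^ (p - 1) := Real.rpow_nonneg ha.le _
  have n3 : 0 ≤ a ^ (p - 2) := Real.rpow_nonneg ha.le _
  have b1 : f x ^ p ≤ A₀ ^ p := Real.rpow_le_rpow hpos.le ((le_abs_self _).trans hf.2.1) hp0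
  have b2 : f x ^ (p - 1) ≤ a ^ (p - 1) :=
    Real.rpow_le_rpow_of_nonpos ha hfa (by linarith)
  have b3 : f x ^ (p - 2) ≤ a ^ (p - 2) :=
    Real.rpow_le_rpow_of_nonpos ha hfa (by linarith)
  have m1 : 0 ≤ f x ^ p := Real.rpow_nonneg hpos.le _
  have m2 : 0 ≤ f x ^ (p - 1) := Real.rpow_nonneg hpos.le _
  have m3 : 0 ≤ f x ^ (p - 2) := Real.rpow_nonneg hpos.le _
  refine hf.comp (g := fun t => t ^ p) (g' := fun t => p * t ^ (p - 1))
    (g'' := fun t => p * ((p - 1) * t ^ (p - 2))) ?_ ?_ ?_ ?_ ?_ ?_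
  · exact contDiffAt_id.rpow_const_of_ne hpos.ne'
  · filter_upwards [lt_mem_nhds hpos] with t ht using Real.hasDerivAt_rpow_const (Or.inl ht.ne')
  · have := (Real.hasDerivAt_rpow_const (x := f x) (p := p - 1) (Or.inl hpos.ne')).const_mul p
    rwa [show p - 1 - 1 = p - 2 by ring] at this
  · rw [abs_of_nonneg m1]; linarith
  · rw [abs_mul, abs_of_nonneg m2, abs_of_nonneg hp0]
    nlinarith
  · rw [abs_mul, abs_mul, abs_of_nonneg m3, abs_of_nonneg hp0, abs_of_nonpos (by linarith)]
    have e1 : p * (-(p - 1) * f x ^ (p - 2)) ≤ 1 * (1 * f x ^ (p - 2)) :=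
      mul_le_mul hp1 (mul_le_mul_of_nonneg_right (by linarith) m3)
        (mul_nonneg (by linarith) m3) zero_le_one
    linarith

theorem jetBound_conj {E : 𝔼 → Matrix (Fin n) (Fin n) ℝ} {Λ : ℝ} {x : 𝔼} (h0 : 0 ≤ Λ)
    (hE : ∀ i j, JetBound Λ (fun y => E y i j) x) {P : Matrix (Fin n) (Fin n) ℝ}
    (hP : ∀ i j, |P i j| ≤ 1) (i j : Fin n) :
    JetBound (n * (n * (4 * (Λ * Λ)))) (fun y => (E y * P * (E y)ᵀ) i j) x := by
  have h1 : ∀ y, (E y * P * (E y)ᵀ) i j = ∑ d, ∑ c, P c d * (E y i c * E y j d) := fun y => by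
    simp only [Matrix.mul_apply, Matrix.transpose_apply, Finset.sum_mul]
    exact Finset.sum_congr rfl fun d _ => Finset.sum_congr rfl fun c _ => by ring
  simp only [h1]
  have h2 := JetBound.sum (Finset.univ : Finset (Fin n)) (x := x)
    (f := fun d y => ∑ c, P c d * (E y i c * E y j d)) (Λ := fun _ => n * (4 * (Λ * Λ)))
    fun d _ => by
      have h3 := JetBound.sum (Finset.univ : Finset (Fin n)) (x := x)
        (f := fun c y => P c d * (E y i c * E y j d)) (Λ := fun _ => 4 * (Λ * Λ))
        fun c _ => (((hE i c).mul (hE j d)).const_mul (P c d)).mono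
          (mul_le_of_le_one_left (by positivity) (hP c d))
      simpa using h3
  simpa using h2

/-- A uniform form of `JetBound.sum`. -/
theorem JetBound.sum_card {ι : Type*} [Fintype ι] {Λ : ℝ} {f : ι → 𝔼 → ℝ} {x : 𝔼}
    (hf : ∀ a, JetBound Λ (f a) x) :
    JetBound (Fintype.card ι * Λ) (fun y => ∑ a, f a y) x := by
  have := JetBound.sum Finset.univ fun a _ => hf a
  simpa using this

set_option maxHeartbeats 1000000 in
/-- Concavity of the equation yields a barrier at every point. -/
theorem exists_barrier {m : ℕ} (hn : 3 ≤ n) (hm : m + 1 ≤ n) (Λ A A₀ : ℝ) {a : ℝ} (ha : 0 < a) :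
    ∃ Λ' : ℝ, ∀ (G E : EuclideanSpace ℝ (Fin n) → Matrix (Fin n) (Fin n) ℝ)
      (v α α₀ : EuclideanSpace ℝ (Fin n) → ℝ) (x : EuclideanSpace ℝ (Fin n)) (c : ℝ),
      FrameBound G E Λ x → ContDiffAt ℝ 2 v x → JetBound A α x → JetBound A₀ α₀ x →
      (∀ᶠ y in 𝓝 x, a ≤ α₀ y) → (∀ᶠ y in 𝓝 x, SolvesAt m G v α α₀ y) →
      (∀ ξ : Fin n → ℝ, c * ∑ i, ξ i ^ 2 ≤
        ((n : ℝ) - 2)⁻¹ * ∑ z : Fin n × Fin n, (G x)⁻¹ z.1 z.2 * (ξ z.1 * ξ z.2)) →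
      HasBarrier v Λ' c x := by
  obtain ⟨c₀, hc₀, hgrad⟩ := exists_matrix_supergradient (n := n) (m := m) hm
  have hn3 : (3 : ℝ) ≤ n := by exact_mod_cast hn
  have hn2 : (1 : ℝ) ≤ (n : ℝ) - 2 := by linarith
  have hi1 : ((n : ℝ) - 2)⁻¹ ≤ 1 := inv_le_one_of_one_le₀ hn2
  have hi0 : 0 ≤ ((n : ℝ) - 2)⁻¹ := by positivity
  set p : ℝ := ((m + 1 : ℕ) : ℝ)⁻¹ with hp
  have hp0 : 0 ≤ p := by positivity
  have hp1 : p ≤ 1 := inv_le_one_of_one_le₀ (by exact_mod_cast Nat.le_add_left 1 m)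
  set ΛQ : ℝ := n * (n * (4 * (Λ * Λ))) with hΛQ
  set ΛL := ΛQ + Λ with hΛL
  set ΛC : ℝ := ((n * n : ℕ) : ℝ) * (4 * (ΛL * Λ)) with hΛC
  set ΛD : ℝ := ((n * n : ℕ) : ℝ) * (4 * (ΛQ * Λ)) with hΛD
  set Λs : ℝ := (A₀ ^ p + a ^ (p - 1) + a ^ (p - 2)) * (1 + A₀ + A₀ ^ 2) + c₀⁻¹ * A with hΛs
  refine ⟨ΛL + ΛC + ΛD + |Λs|, fun G E v α α₀ x c hF hv hα hα₀ ha₀ hsol hell => ?_⟩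
  have hΛ1 := hF.one_le
  have hΛ0 : 0 ≤ Λ := by linarith
  have hΛQ0 : 0 ≤ ΛQ := by positivity
  have hΛL0 : 0 ≤ ΛL := by positivity
  have hΛC0 : 0 ≤ ΛC := by positivity
  have hΛD0 : 0 ≤ ΛD := by positivity
  have hΛs0 := abs_nonneg Λs
  have hA0 := hα.nonneg
  have hev : ∀ᶠ y in 𝓝 x, (E y)ᵀ * G y * E y = 1 ∧ (G y).IsSymm ∧ (calS G v y).IsSymm ∧
      (coordHessian G v y).IsSymm ∧ (coordRicci G y).IsSymm := by
    filter_upwards [hF.ortho, hF.smooth, hF.isSymm.eventually_nhds, hv.eventually (by simp)]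
      with y h1 h2 h3 h4
    exact ⟨h1, h3.self_of_nhds, calS_isSymm h3 h2 (det_ne_of_ortho h1) h4,
      coordHessian_isSymm h3 h4, coordRicci_isSymm h3 h2 (det_ne_of_ortho h1)⟩
  set w : EuclideanSpace ℝ (Fin n) → ℝ := fun y => Real.exp (2 * v y) / ((n : ℝ) - 2) with hw
  have hw0 : ∀ y, 0 < w y := fun y => by positivity
  set M : EuclideanSpace ℝ (Fin n) → Matrix (Fin n) (Fin n) ℝ :=
    fun y => (E y)ᵀ * calS G v y * E y with hM
  set τ : EuclideanSpace ℝ (Fin n) → ℝ := fun y => α₀ y ^ p * w y with hτ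
  have hred : ∀ᶠ y in 𝓝 x, (M y).IsHermitian ∧ MatGam m (M y) ∧ 0 < τ y ∧
      matOp m (M y) (τ y) = -(α y * w y) := by
    filter_upwards [hev, ha₀, hsol] with y ⟨h1, _, h2, _, _⟩ h3 h4
    have hpos := ha.trans_le h3
    obtain ⟨g1, g2, _⟩ := solvesAt_frame hn h4 hpos h1 h2
    exact ⟨isSymm_conj h2 _, g1, mul_pos (Real.rpow_pos_of_pos hpos _) (hw0 y), g2⟩
  obtain ⟨x1, x2, x3, x4⟩ := hred.self_of_nhds
  -- The supergradient is taken at x and kept fixed as y varies, so no derivative of the operator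
  -- occurs in the barrier.
  obtain ⟨P, q, hP, hq, hPc, hqP, heq, hle⟩ := hgrad (M x) (τ x) x1 x2 x3
  set T := P.trace with hT
  have hT0 : 0 < T := hc₀.trans_le hPc
  have hTi : 0 < T⁻¹ := inv_pos.2 hT0
  -- P has no upper bound, but P₁ has entries of size at most 1, |q| / T ≤ 1 and T⁻¹ ≤ c₀⁻¹. Trace
  -- one also fixes the coefficient of g⁻¹/(n-2) in the leading part.
  set P₁ := T⁻¹ • P with hP₁
  have hP₁b : ∀ i j, |P₁ i j| ≤ 1 := fun i j => by
    rw [hP₁, Matrix.smul_apply, smul_eq_mul, abs_mul, abs_of_pos hTi, ← div_eq_inv_mul,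
      div_le_one hT0]
    exact abs_apply_le_trace hP i j
  have hP₁t : P₁.trace = 1 := by
    rw [hP₁, Matrix.trace_smul, smul_eq_mul, inv_mul_cancel₀ hT0.ne']
  have hP₁s : P₁.IsSymm := by
    have : P.IsSymm := by
      have := hP.isHermitian.eq
      rwa [Matrix.conjTranspose_eq_transpose_of_trivial] at this
    exact this.smul _
  have hP₁p : P₁.PosSemidef := hP.smul hTi.le
  set Q : EuclideanSpace ℝ (Fin n) → Matrix (Fin n) (Fin n) ℝ :=
    fun y => E y * P₁ * (E y)ᵀ with hQ
  -- Both t and β carry the factor e^{2v}/(n-2), so q t + β becomes one coefficient times e^{2v},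
  -- with no derivative of v in the coefficient.
  set s : EuclideanSpace ℝ (Fin n) → ℝ := fun y =>
    (((n : ℝ) - 2)⁻¹ * (T⁻¹ * q)) * α₀ y ^ p + (((n : ℝ) - 2)⁻¹ * T⁻¹) * α y with hs
  have hquasi : ∀ᶠ y in 𝓝 x, quasi v
      (fun z x => Q x z.1 z.2 + ((n : ℝ) - 2)⁻¹ * (G x)⁻¹ z.1 z.2)
      (fun z x => (G x)⁻¹ z.1 z.2 + (-1) * Q x z.1 z.2)
      (fun a x => (-1) * ∑ z : Fin n × Fin n,
        (Q x z.1 z.2 + ((n : ℝ) - 2)⁻¹ * (G x)⁻¹ z.1 z.2) * christoffel G a z.1 z.2 x)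
      (fun x => (-((n : ℝ) - 2)⁻¹) * ∑ z : Fin n × Fin n, Q x z.1 z.2 * coordRicci G x z.1 z.2)
      s y = T⁻¹ * ((P * M y).trace + q * τ y + α y * w y) := by
    filter_upwards [hev] with y ⟨h1, h2, h3, h4, h5⟩
    have t1 : (Q y * G y).trace = 1 := by
      rw [hQ, mul_assoc, mul_assoc, Matrix.trace_mul_comm, mul_assoc, h1, mul_one, hP₁t]
    rw [← trace_mul_calS h4 h5 t1]
    have t2 : (Q y * calS G v y).trace = T⁻¹ * (P * M y).trace := by
      have e : (Q y * calS G v y).trace = (P₁ * M y).trace := by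
        simp only [hQ, hM]
        rw [mul_assoc, mul_assoc, Matrix.trace_mul_comm]
        simp only [mul_assoc]
      rw [e, hP₁, Matrix.smul_mul, Matrix.trace_smul, smul_eq_mul]
    rw [t2]
    simp only [hs, hτ, hw]
    ring
  have hγ : ∀ i j, (G x)⁻¹ i j = (G x)⁻¹ j i := fun i j => by
    have h1 : ((G x)⁻¹).IsSymm := by
      rw [Matrix.IsSymm, Matrix.transpose_nonsing_inv, hF.isSymm.self_of_nhds.eq]
    exact h1.apply j i
  have hQs : ∀ i j, Q x i j = Q x j i := fun i j => by
    have h1 : (Q x).IsSymm := by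
      simp only [hQ]
      rw [Matrix.IsSymm, Matrix.transpose_mul, Matrix.transpose_mul,
        Matrix.transpose_transpose, hP₁s.eq, mul_assoc]
    exact h1.apply j i
  have jQ : ∀ i j, JetBound ΛQ (fun y => Q y i j) x := fun i j =>
    jetBound_conj hΛ0 hF.frame hP₁b i j
  have jL : ∀ z : Fin n × Fin n, JetBound ΛL
      (fun x => Q x z.1 z.2 + ((n : ℝ) - 2)⁻¹ * (G x)⁻¹ z.1 z.2) x := fun z => by
    refine (jQ z.1 z.2).add (((hF.inv z.1 z.2).const_mul _).mono ?_)
    rw [abs_of_nonneg hi0]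
    exact mul_le_of_le_one_left hΛ0 hi1
  refine ⟨fun z x => Q x z.1 z.2 + ((n : ℝ) - 2)⁻¹ * (G x)⁻¹ z.1 z.2,
    fun z x => (G x)⁻¹ z.1 z.2 + (-1) * Q x z.1 z.2,
    fun a x => (-1) * ∑ z : Fin n × Fin n,
      (Q x z.1 z.2 + ((n : ℝ) - 2)⁻¹ * (G x)⁻¹ z.1 z.2) * christoffel G a z.1 z.2 x,
    fun x => (-((n : ℝ) - 2)⁻¹) * ∑ z : Fin n × Fin n, Q x z.1 z.2 * coordRicci G x z.1 z.2,
    s, fun z => (jL z).mono (by linarith), fun z => ?_, fun b => ?_, ?_, ?_,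
    fun i j => ?_, fun ξ => ?_, ?_, ?_⟩
  rotate_left 6
  · filter_upwards [hquasi, hred] with y h1 ⟨h2, h3, h4, h5⟩
    rw [h1]
    refine mul_nonneg hTi.le ?_
    have := hle (M y) (τ y) h2 h3 h4
    linarith
  · rw [hquasi.self_of_nhds, ← heq, x4]
    ring
  · refine ((hF.inv z.1 z.2).add (((jQ z.1 z.2).const_mul (-1)).mono (Λ' := ΛQ) (by simp))).mono ?_
    linarith
  · have h1 := JetBound.sum_card fun z : Fin n × Fin n => (jL z).mul (hF.chr b z.1 z.2)
    refine (h1.const_mul (-1)).mono ?_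
    simp only [abs_neg, abs_one, one_mul, Fintype.card_prod, Fintype.card_fin]
    linarith
  · have h1 := JetBound.sum_card fun z : Fin n × Fin n =>
      (jQ z.1 z.2).mul (hF.ricci z.1 z.2)
    refine ((h1.const_mul (-((n : ℝ) - 2)⁻¹)).mono (Λ' := ΛD) ?_).mono (by linarith)
    rw [abs_neg, abs_of_nonneg hi0]
    simp only [Fintype.card_prod, Fintype.card_fin]
    exact mul_le_of_le_one_left hΛD0 hi1
  · have h1 := jetBound_rpow hα₀ ha ha₀.self_of_nhds hp0 hp1
    have h2 : JetBound Λs s x := by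
      refine ((h1.const_mul _).mono (mul_le_of_le_one_left h1.nonneg ?_)).add
        ((hα.const_mul _).mono (mul_le_mul_of_nonneg_right ?_ hA0))
      · rw [abs_mul, abs_of_nonneg hi0, abs_mul, abs_of_pos hTi, abs_of_nonpos hq]
        refine mul_le_one₀ hi1 (mul_nonneg hTi.le (by linarith)) ?_
        rw [← div_eq_inv_mul, div_le_one hT0]
        exact hqP
      · rw [abs_mul, abs_of_nonneg hi0, abs_of_pos hTi]
        exact (mul_le_of_le_one_left hTi.le hi1).trans (inv_anti₀ hc₀ hPc)
    exact h2.mono (by linarith [le_abs_self Λs])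
  · simp only
    rw [hγ i j, hQs i j]
  -- Ellipticity comes from g⁻¹/(n-2) alone; the part Q is only nonnegative.
  · refine (hell ξ).trans ?_
    simp only [add_mul, Finset.sum_add_distrib, mul_assoc, ← Finset.mul_sum]
    have h1 : 0 ≤ ∑ z : Fin n × Fin n, Q x z.1 z.2 * (ξ z.1 * ξ z.2) := by
      rw [quadratic_eq, hQ, quadratic_conj]
      have := hP₁p.dotProduct_mulVec_nonneg ((E x)ᵀ *ᵥ ξ)
      simpa using this
    linarith

end

/-! ### Control of the Hessian by its trace, and the estimate in coordinates -/

section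

variable {n : ℕ}

local notation "𝔼" => EuclideanSpace ℝ (Fin n)

/-- The norm of an admissible solution matrix is controlled by its trace. -/
theorem abs_apply_le_of_solution {m : ℕ} (hm1 : 1 ≤ m) {M : Matrix (Fin n) (Fin n) ℝ}
    (hM : M.IsHermitian) (hgam : MatGam m M) {τ β B : ℝ}
    (heq : sigma (m + 1) M = τ ^ (m + 1) - β * sigma m M) (hβ : |β| ≤ B) (i j : Fin n) :
    |M i j| ≤ M.trace + B := by
  obtain ⟨h1, h2⟩ := trace_sq_eq hM
  have htr : 0 < M.trace := h1 ▸ hgam 1 hm1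
  have hB : 0 ≤ B := (abs_nonneg _).trans hβ
  have hsum : ∑ i, ∑ j, M i j ^ 2 ≤ (M.trace + B) ^ 2 := by
    rw [h2]
    -- For m ≥ 2 admissibility gives σ₂ > 0. For m = 1 the equation itself gives σ₂ = τ² - β σ₁ ≥ -B
    -- σ₁. Either way σ₁² - 2σ₂ ≤ (σ₁ + B)².
    rcases Nat.lt_or_ge m 2 with hm | hm
    · obtain rfl : m = 1 := by omega
      have h3 : sigma 2 M = τ ^ 2 - β * M.trace := by rw [← h1]; exact heq
      rw [h3]
      have h4 : β * M.trace ≤ B * M.trace :=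
        mul_le_mul_of_nonneg_right ((le_abs_self _).trans hβ) htr.le
      nlinarith [sq_nonneg τ, sq_nonneg B]
    · have h3 := hgam 2 hm
      nlinarith [mul_nonneg htr.le hB, sq_nonneg B]
  have h3 : M i j ^ 2 ≤ ∑ i, ∑ j, M i j ^ 2 :=
    (Finset.single_le_sum (f := fun j => M i j ^ 2) (fun _ _ => sq_nonneg _)
      (Finset.mem_univ j)).trans
    (Finset.single_le_sum (f := fun i => ∑ j, M i j ^ 2)
      (fun _ _ => Finset.sum_nonneg fun _ _ => sq_nonneg _) (Finset.mem_univ i))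
  exact abs_le_of_sq_le_sq (h3.trans hsum) (by linarith)

theorem abs_trace_le {A : Matrix (Fin n) (Fin n) ℝ} {a : ℝ} (hA : ∀ i j, |A i j| ≤ a) :
    |A.trace| ≤ n * a := by
  have := abs_sum_mul_le (ι := Fin n) (a := fun _ => 1) (b := fun i => A i i) zero_le_one
    (fun _ => by simp) fun i => hA i i
  simpa [Matrix.trace] using this

theorem abs_conj_apply_le {A E : Matrix (Fin n) (Fin n) ℝ} {a e : ℝ} (he : 0 ≤ e)
    (hE : ∀ i j, |E i j| ≤ e) (hA : ∀ i j, |A i j| ≤ a) (i j : Fin n) :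
    |(Eᵀ * A * E) i j| ≤ n * (e * (n * (a * e))) := by
  have ha : 0 ≤ a := (abs_nonneg _).trans (hA i j)
  rw [mul_assoc]
  exact abs_mul_apply_le he (fun i j => hE j i)
    (fun i j => abs_mul_apply_le ha hA hE i j) i j

set_option maxHeartbeats 1000000 in
/-- The Hessian of an admissible solution is controlled by its Laplacian. -/
theorem exists_cone_bound {m : ℕ} (hn : 3 ≤ n) (hm1 : 1 ≤ m) {Λ K A : ℝ} (hΛ : 1 ≤ Λ)
    (hK : 0 ≤ K) (hA : 0 ≤ A) :
    ∃ C₅ C₆ : ℝ, 0 < C₅ ∧ 1 ≤ C₆ ∧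
      ∀ (G E : EuclideanSpace ℝ (Fin n) → Matrix (Fin n) (Fin n) ℝ)
        (v α α₀ : EuclideanSpace ℝ (Fin n) → ℝ) (x : EuclideanSpace ℝ (Fin n)),
        FrameBound G E Λ x → ContDiffAt ℝ 2 v x → |v x| ≤ K → (∀ i, |pd i v x| ≤ K) →
        |α x| ≤ A → 0 < α₀ x → SolvesAt m G v α α₀ x →
        √(∑ z : Fin n × Fin n, pd z.1 (pd z.2 v) x ^ 2)
          ≤ C₅ * (C₆ + trHess (fun z y => (G y)⁻¹ z.1 z.2) v x) := by
  have hn3 : (3 : ℝ) ≤ n := by exact_mod_cast hn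
  have hn2 : (1 : ℝ) ≤ (n : ℝ) - 2 := by linarith
  have hi1 : ((n : ℝ) - 2)⁻¹ ≤ 1 := inv_le_one_of_one_le₀ hn2
  have hi0 : 0 ≤ ((n : ℝ) - 2)⁻¹ := by positivity
  have hΛ0 : 0 ≤ Λ := by linarith
  have hn0 : (0 : ℝ) ≤ n := by positivity
  -- The constants are introduced as opaque reals, to be treated as atoms by the linear arithmetic
  -- below.
  obtain ⟨B, hB⟩ : ∃ X : ℝ, X = A * Real.exp (2 * K) := ⟨_, rfl⟩
  have hB0 : 0 ≤ B := by rw [hB]; positivity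
  obtain ⟨D₁, hD₁⟩ : ∃ X : ℝ, X = n * (Λ * (n * (K * K * Λ))) := ⟨_, rfl⟩
  obtain ⟨D₂, hD₂⟩ : ∃ X : ℝ, X = n * (Λ * (n * (Λ * Λ))) := ⟨_, rfl⟩
  obtain ⟨D₃, hD₃⟩ : ∃ X : ℝ, X = ((n * n : ℕ) : ℝ) * (Λ * (K * K)) := ⟨_, rfl⟩
  obtain ⟨D, hD⟩ : ∃ X : ℝ, X = D₁ + D₂ + D₃ := ⟨_, rfl⟩
  have hD₁0 : 0 ≤ D₁ := by rw [hD₁]; positivity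
  have hD₂0 : 0 ≤ D₂ := by rw [hD₂]; positivity
  have hD₃0 : 0 ≤ D₃ := by rw [hD₃]; positivity
  obtain ⟨S, hS⟩ : ∃ X : ℝ, X = n * (Λ * K) := ⟨_, rfl⟩
  have hS0 : 0 ≤ S := by rw [hS]; positivity
  obtain ⟨S', hS'⟩ : ∃ X : ℝ, X = ((n * n : ℕ) : ℝ) * (Λ * S) := ⟨_, rfl⟩
  have hS'0 : 0 ≤ S' := by rw [hS']; positivity
  obtain ⟨F, hF⟩ : ∃ X : ℝ, X = n * ((n * (Λ * Λ)) * (n * (1 * (n * (Λ * Λ))))) := ⟨_, rfl⟩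
  have hF0 : 0 ≤ F := by rw [hF]; positivity
  obtain ⟨N, hN⟩ : ∃ X : ℝ, X = ((n * n : ℕ) : ℝ) := ⟨_, rfl⟩
  have hN0 : 0 ≤ N := by rw [hN]; positivity
  have hN1 : 1 ≤ N := by rw [hN]; push_cast; nlinarith
  have hD0 : 0 ≤ D := by linarith
  obtain ⟨Y₀, hY₀⟩ : ∃ X : ℝ, X = (n + 2) * (2 * (n * D)) + (n + 1) * D + B := ⟨_, rfl⟩
  have hY₀0 : 0 ≤ Y₀ := by rw [hY₀]; positivity
  obtain ⟨C₅, hC₅⟩ : ∃ X : ℝ, X = N * F * (n + 2) + 1 := ⟨_, rfl⟩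
  obtain ⟨D₄, hD₄⟩ : ∃ X : ℝ, X = N * (F * ((n + 2) * S' + Y₀) + S) + (n * D + S') := ⟨_, rfl⟩
  have hD₄0 : 0 ≤ D₄ := by rw [hD₄]; positivity
  have hC₅1 : 1 ≤ C₅ := by
    have : 0 ≤ N * F * (n + 2) := by positivity
    linarith
  refine ⟨C₅, D₄ + 1, by linarith, by linarith, fun G E v α α₀ x hFr hv hvK hvp hα hα₀ hsol => ?_⟩
  have hE := hFr.ortho.self_of_nhds
  have hdet := det_ne_of_ortho hE
  have hGs := hFr.isSymm.self_of_nhds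
  have hHs := coordHessian_isSymm hFr.isSymm hv
  have hSs := calS_isSymm hFr.isSymm hFr.smooth.self_of_nhds hdet hv
  obtain ⟨hgam, -, heq⟩ := solvesAt_frame hn hsol hα₀ hE hSs
  set M := (E x)ᵀ * calS G v x * E x with hM
  set X := (E x)ᵀ * coordHessian G v x * E x with hX
  set V := (E x)ᵀ * Matrix.vecMulVec (fun i => pd i v x) (fun i => pd i v x) * E x with hV
  set Rc := (E x)ᵀ * coordRicci G x * E x with hRc
  set g := ∑ i, ∑ j, (G x)⁻¹ i j * pd i v x * pd j v x with hg
  set t := X.trace with ht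
  have htH : ((G x)⁻¹ * coordHessian G v x).trace = t := by
    rw [ht, hX, inv_eq_of_ortho hE, mul_assoc, mul_assoc, Matrix.trace_mul_comm, mul_assoc]
  have hMX : M = X - V + (t / ((n : ℝ) - 2) + g) • (1 : Matrix (Fin n) (Fin n) ℝ)
      - ((n : ℝ) - 2)⁻¹ • Rc := by
    rw [hM, calS, htH, ← hE]
    simp only [mul_sub, mul_add, sub_mul, add_mul, Matrix.mul_smul, Matrix.smul_mul, hX, hV, hRc,
      hg]
  have bE : ∀ i j, |E x i j| ≤ Λ := fun i j => (hFr.frame i j).2.1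
  have bV : ∀ i j, |V i j| ≤ D₁ := by
    rw [hV, hD₁]
    refine abs_conj_apply_le hΛ0 bE fun i j => ?_
    rw [Matrix.vecMulVec_apply, abs_mul]
    exact mul_le_mul (hvp i) (hvp j) (abs_nonneg _) hK
  have bR : ∀ i j, |Rc i j| ≤ D₂ := by
    rw [hRc, hD₂]
    exact abs_conj_apply_le hΛ0 bE fun i j => (hFr.ricci i j).2.1
  have bg : |g| ≤ D₃ := by
    have h1 := abs_sum_mul_le (ι := Fin n × Fin n) (a := fun z => (G x)⁻¹ z.1 z.2)
      (b := fun z => pd z.1 v x * pd z.2 v x) (A := Λ) (B := K * K) hΛ0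
      (fun z => (hFr.inv z.1 z.2).2.1) fun z => by
        rw [abs_mul]; exact mul_le_mul (hvp _) (hvp _) (abs_nonneg _) hK
    rw [Fintype.sum_prod_type] at h1
    simpa [hg, hD₃, mul_assoc] using h1
  have hβ : |α x * (Real.exp (2 * v x) / ((n : ℝ) - 2))| ≤ B := by
    rw [abs_mul, abs_of_pos (by positivity : 0 < Real.exp (2 * v x) / ((n : ℝ) - 2)), hB]
    refine mul_le_mul hα ?_ (by positivity) hA
    rw [div_le_iff₀ (by linarith)]
    have h1 : Real.exp (2 * v x) ≤ Real.exp (2 * K) :=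
      Real.exp_le_exp.2 (by linarith [(abs_le.1 hvK).2])
    nlinarith [Real.exp_pos (2 * K)]
  have bM : ∀ i j, |M i j| ≤ M.trace + B :=
    abs_apply_le_of_solution hm1 (isSymm_conj hSs _) hgam heq hβ
  have htrM : 0 < M.trace := by
    rw [← (trace_sq_eq (isSymm_conj hSs (E x))).1]; exact hgam 1 hm1
  have hRi : ∀ y : ℝ, |((n : ℝ) - 2)⁻¹ * y| ≤ |y| := fun y => by
    rw [abs_mul, abs_of_nonneg hi0]
    exact mul_le_of_le_one_left (abs_nonneg _) hi1
  have htr : |M.trace - (t + n * (t / ((n : ℝ) - 2)))| ≤ n * D := by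
    have e : M.trace - (t + n * (t / ((n : ℝ) - 2)))
        = -V.trace + n * g + -(((n : ℝ) - 2)⁻¹ * Rc.trace) := by
      rw [hMX, Matrix.trace_sub, Matrix.trace_add, Matrix.trace_sub, Matrix.trace_smul,
        Matrix.trace_smul, Matrix.trace_one, Fintype.card_fin, ← ht]
      simp only [smul_eq_mul]; ring
    rw [e]
    refine (abs_add_three _ _ _).trans ?_
    rw [abs_neg, abs_neg, abs_mul, abs_of_nonneg hn0]
    have h1 := abs_trace_le bV
    have h2 := (hRi Rc.trace).trans (abs_trace_le bR)
    have h3 := mul_le_mul_of_nonneg_left bg hn0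
    rw [hD]; linarith
  have hdiv : |t / ((n : ℝ) - 2)| ≤ |t| := by rw [div_eq_inv_mul]; exact hRi t
  -- tr M is positive and equals t (1 + n/(n-2)) up to n D, so the Laplacian t is bounded below; its
  -- absolute value is then at most t plus a constant.
  have htlow : -(n * D) ≤ t := by
    by_contra! hlt
    have h0 : 0 ≤ (n : ℝ) * D := by positivity
    have h1 : t / ((n : ℝ) - 2) ≤ 0 := div_nonpos_of_nonpos_of_nonneg (by linarith) (by linarith)
    have h2 := mul_nonneg hn0 (neg_nonneg.2 h1)
    have h3 := (abs_le.1 htr).2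
    linarith
  have htabs : |t| ≤ t + 2 * (n * D) := by
    have h0 : 0 ≤ (n : ℝ) * D := by positivity
    rw [abs_le]; constructor <;> linarith
  have htrM' : M.trace ≤ (1 + n) * |t| + n * D := by
    have h1 := (abs_le.1 htr).2
    have h2 := mul_le_mul_of_nonneg_left ((le_abs_self _).trans hdiv) hn0
    linarith [le_abs_self t]
  obtain ⟨Y, hY⟩ : ∃ Y : ℝ, Y = (n + 2) * t + Y₀ := ⟨_, rfl⟩
  have bX : ∀ i j, |X i j| ≤ Y := fun i j => by
    have e : X i j = M i j + V i j + -((t / ((n : ℝ) - 2) + g) * (1 : Matrix (Fin n) (Fin n) ℝ) i j)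
        + ((n : ℝ) - 2)⁻¹ * Rc i j := by
      rw [hMX]
      simp only [Matrix.add_apply, Matrix.sub_apply, Matrix.smul_apply, smul_eq_mul]; ring
    have h1 : |(t / ((n : ℝ) - 2) + g) * (1 : Matrix (Fin n) (Fin n) ℝ) i j| ≤ |t| + D₃ := by
      rw [abs_mul]
      have h2 : |(1 : Matrix (Fin n) (Fin n) ℝ) i j| ≤ 1 := by
        rw [Matrix.one_apply]; split_ifs <;> simp
      refine (mul_le_of_le_one_right (abs_nonneg _) h2).trans ((abs_add_le _ _).trans ?_)
      linarith
    rw [e]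
    refine (abs_add_le _ _).trans ?_
    have h3 := abs_add_three (M i j) (V i j)
      (-((t / ((n : ℝ) - 2) + g) * (1 : Matrix (Fin n) (Fin n) ℝ) i j))
    rw [abs_neg] at h3
    have h4 := (hRi (Rc i j)).trans (bR i j)
    have h5 := mul_le_mul_of_nonneg_left htabs (by positivity : (0 : ℝ) ≤ n + 2)
    rw [hY, hY₀]
    have h6 := bM i j
    have h7 := bV i j
    linarith
  have hY0 : 0 ≤ Y := by
    have : 0 < n := by omega
    exact (abs_nonneg _).trans (bX ⟨0, this⟩ ⟨0, this⟩)
  have bH : ∀ i j, |coordHessian G v x i j| ≤ F * Y := fun i j => by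
    have h1 : G x * E x * (E x)ᵀ = 1 := mul_eq_one_comm.1 (by rw [← mul_assoc]; exact hE)
    have h1' : E x * ((E x)ᵀ * G x) = 1 := mul_eq_one_comm.1 hE
    have e : coordHessian G v x = ((E x)ᵀ * G x)ᵀ * X * ((E x)ᵀ * G x) := by
      rw [Matrix.transpose_mul, Matrix.transpose_transpose, hGs.eq, hX]
      calc coordHessian G v x = (G x * E x * (E x)ᵀ) * coordHessian G v x
            * (E x * ((E x)ᵀ * G x)) := by rw [h1, h1', one_mul, mul_one]
        _ = _ := by simp only [mul_assoc]
    rw [e]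
    refine (abs_conj_apply_le (e := n * (Λ * Λ)) (by positivity) (fun i j =>
      abs_mul_apply_le hΛ0 (fun i j => bE j i) (fun i j => (hFr.metric i j).2.1) i j) bX
      i j).trans (le_of_eq ?_)
    rw [hF]; ring
  have bΓ : ∀ i j, |∑ a, christoffel G a i j x * pd a v x| ≤ S := fun i j => by
    have := abs_sum_mul_le (ι := Fin n) (a := fun a => christoffel G a i j x)
      (b := fun a => pd a v x) hΛ0 (fun a => (hFr.chr a i j).2.1) hvp
    simpa [hS] using this
  have ev : ∀ i j, pd i (pd j v) x
      = coordHessian G v x i j + ∑ a, christoffel G a i j x * pd a v x := fun i j => by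
    rw [coordHessian, Matrix.of_apply]; ring
  have hsum : √(∑ z : Fin n × Fin n, pd z.1 (pd z.2 v) x ^ 2) ≤ N * (F * Y + S) := by
    have h1 : ∀ z : Fin n × Fin n, |pd z.1 (pd z.2 v) x| ≤ F * Y + S := fun z => by
      rw [ev]
      exact (abs_add_le _ _).trans (add_le_add (bH _ _) (bΓ _ _))
    have h0 : 0 ≤ F * Y + S := by positivity
    have h2 : ∑ z : Fin n × Fin n, pd z.1 (pd z.2 v) x ^ 2 ≤ N * (F * Y + S) ^ 2 := by
      have := Finset.sum_le_card_nsmul (Finset.univ : Finset (Fin n × Fin n))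
        (fun z => pd z.1 (pd z.2 v) x ^ 2) ((F * Y + S) ^ 2) fun z _ => by
          rw [← sq_abs]; exact pow_le_pow_left₀ (abs_nonneg _) (h1 z) 2
      simpa [hN] using this
    refine Real.sqrt_le_iff.2 ⟨by positivity, h2.trans ?_⟩
    rw [mul_pow]
    exact mul_le_mul_of_nonneg_right (by nlinarith) (by positivity)
  have htrace : |trHess (fun z y => (G y)⁻¹ z.1 z.2) v x - t| ≤ S' := by
    have e : trHess (fun z y => (G y)⁻¹ z.1 z.2) v x - t
        = ∑ z : Fin n × Fin n, (G x)⁻¹ z.1 z.2 * ∑ a, christoffel G a z.1 z.2 x * pd a v x := by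
      rw [← htH, trace_mul_eq_sum_prod hHs, trHess, ← Finset.sum_sub_distrib]
      exact Finset.sum_congr rfl fun z _ => by rw [ev]; ring
    rw [e]
    have := abs_sum_mul_le (ι := Fin n × Fin n) (a := fun z => (G x)⁻¹ z.1 z.2)
      (b := fun z => ∑ a, christoffel G a z.1 z.2 x * pd a v x) hΛ0
      (fun z => (hFr.inv z.1 z.2).2.1) fun z => bΓ z.1 z.2
    simpa [hS'] using this
  generalize trHess (fun z y => (G y)⁻¹ z.1 z.2) v x = w at *
  have hwt : t ≤ w + S' := by linarith [(abs_le.1 htrace).1]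
  have hwlow : 0 ≤ w + (n * D + S') := by linarith
  refine hsum.trans ?_
  have h1 : N * (F * Y + S) ≤ N * (F * ((n + 2) * (w + S') + Y₀) + S) := by
    refine mul_le_mul_of_nonneg_left ?_ hN0
    have := mul_le_mul_of_nonneg_left hwt (by positivity : (0 : ℝ) ≤ n + 2)
    have := mul_le_mul_of_nonneg_left (by linarith : Y ≤ (n + 2) * (w + S') + Y₀) hF0
    linarith
  have h2 : D₄ + 1 ≤ C₅ * (D₄ + 1) := le_mul_of_one_le_left (by linarith) hC₅1
  -- Adding the nonnegative quantity w + (n D + S') accounts for the extra 1 in C₅ and the last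
  -- bracket of D₄. Then C₅ ≥ 1 allows C₅ to be factored out, with C₆ = D₄ + 1.
  have h3 : N * (F * ((n + 2) * (w + S') + Y₀) + S) + (w + (n * D + S')) = C₅ * w + D₄ := by
    rw [hC₅, hD₄]; ring
  rw [mul_add]
  linarith


theorem HasBarrier.mono {v : 𝔼 → ℝ} {Λ Λ' c : ℝ} {x : 𝔼} (h : HasBarrier v Λ c x)
    (hΛ : Λ ≤ Λ') : HasBarrier v Λ' c x := by
  obtain ⟨L, B, C, D, s, h1, h2, h3, h4, h5, h6⟩ := h
  exact ⟨L, B, C, D, s, fun z => (h1 z).mono hΛ, fun z => (h2 z).mono hΛ, fun a => (h3 a).mono hΛ,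
    h4.mono hΛ, h5.mono hΛ, h6⟩

/-- The local form of the second derivative estimate, in coordinates. -/
theorem exists_local_estimate {m : ℕ} (hn : 3 ≤ n) (hm1 : 1 ≤ m) (hm : m + 1 ≤ n)
    {G : EuclideanSpace ℝ (Fin n) → Matrix (Fin n) (Fin n) ℝ} {y₀ : EuclideanSpace ℝ (Fin n)}
    (hG : ∀ᶠ y in 𝓝 y₀, SmoothMat G y) (hsymm : ∀ᶠ y in 𝓝 y₀, (G y).IsSymm)
    (hpos : (G y₀).PosDef) :
    ∃ V ∈ 𝓝 y₀, ∀ R : ℝ, 0 < R → Metric.closedBall y₀ R ⊆ V → ∀ K A A₀ a : ℝ, 0 < a →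
      ∃ C : ℝ, ∀ (v α α₀ : EuclideanSpace ℝ (Fin n) → ℝ) (U : Set (EuclideanSpace ℝ (Fin n))),
        IsOpen U → Metric.closedBall y₀ R ⊆ U → U ⊆ V →
        (∀ x ∈ U, ContDiffAt ℝ 4 v x) → (∀ x ∈ U, |v x| ≤ K) → (∀ x ∈ U, ∀ i, |pd i v x| ≤ K) →
        (∀ x ∈ U, JetBound A α x) → (∀ x ∈ U, JetBound A₀ α₀ x) → (∀ x ∈ U, a ≤ α₀ x) →
        (∀ x ∈ U, SolvesAt m G v α α₀ x) →
        ∀ x ∈ Metric.ball y₀ (R / 2), √(∑ z : Fin n × Fin n, pd z.1 (pd z.2 v) x ^ 2) ≤ C := by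
  obtain ⟨E, Λ, hF⟩ := exists_frameBound hG hsymm hpos
  refine ⟨{y | FrameBound G E Λ y}, hF, fun R hR hRV K A A₀ a ha => ?_⟩
  have hΛ1 : 1 ≤ Λ := hF.self_of_nhds.one_le
  have hn3 : (3 : ℝ) ≤ n := by exact_mod_cast hn
  have hn2 : (1 : ℝ) ≤ (n : ℝ) - 2 := by linarith
  have hi1 : ((n : ℝ) - 2)⁻¹ ≤ 1 := inv_le_one_of_one_le₀ hn2
  have hi0 : 0 < ((n : ℝ) - 2)⁻¹ := by positivity
  obtain ⟨Λ', hbar⟩ := exists_barrier (n := n) hn hm Λ A A₀ ha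
  obtain ⟨C₅, C₆, hC₅, hC₆, hcone⟩ := exists_cone_bound (n := n) (m := m) hn hm1 hΛ1
    (abs_nonneg K) (abs_nonneg A)
  have hC₆0 : 0 < C₆ := by linarith
  have hC₆i : C₆⁻¹ ≤ 1 := inv_le_one_of_one_le₀ hC₆
  have hC₆i0 : 0 < C₆⁻¹ := inv_pos.2 hC₆0
  obtain ⟨e, he⟩ : ∃ e : ℝ, e = n * (n * (n * (Λ * Λ)) ^ 2) := ⟨_, rfl⟩
  have he0 : 0 < e := by rw [he]; positivity
  -- One ellipticity constant for both γ = C₆⁻¹ g⁻¹ and the barriers; for each of them the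
  -- superfluous factor is at most 1.
  obtain ⟨c, hc⟩ : ∃ c : ℝ, c = ((n : ℝ) - 2)⁻¹ * (C₆⁻¹ * e⁻¹) := ⟨_, rfl⟩
  have hc0 : 0 < c := by rw [hc]; positivity
  -- With γ = C₆⁻¹ g⁻¹ the cone bound C₅ (C₆ + w) takes the required form C₁ (1 + C₆⁻¹ w), where C₁
  -- = C₅ C₆.
  obtain ⟨C, hC⟩ := interior_hessian_estimate n (Λ := Λ + |Λ'|) (K := |K|) (c := c)
    (C₁ := C₅ * C₆) (R := R) (by positivity) (abs_nonneg K) hc0 (by positivity) hR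
  refine ⟨C, fun v α α₀ U hU hRU hUV hv hvK hvp hα hα₀ ha₀ hsol => ?_⟩
  have hell : ∀ x ∈ U, ∀ ξ : Fin n → ℝ, e⁻¹ * ∑ i, ξ i ^ 2 ≤
      ∑ z : Fin n × Fin n, (G x)⁻¹ z.1 z.2 * (ξ z.1 * ξ z.2) := fun x hx ξ => by
    rw [inv_mul_le_iff₀ he0, he]
    exact (hUV hx).ellipticity ξ
  have hnn : ∀ x ∈ U, ∀ ξ : Fin n → ℝ,
      0 ≤ ∑ z : Fin n × Fin n, (G x)⁻¹ z.1 z.2 * (ξ z.1 * ξ z.2) := fun x hx ξ =>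
    le_trans (mul_nonneg (inv_nonneg.2 he0.le) (Finset.sum_nonneg fun _ _ => sq_nonneg _))
      (hell x hx ξ)
  refine hC v (fun z y => C₆⁻¹ * (G y)⁻¹ z.1 z.2) y₀ U hRU hv
    (fun x hx => (hvK x hx).trans (le_abs_self K))
    (fun x hx i => (hvp x hx i).trans (le_abs_self K)) (fun x hx z => ?_) (fun x hx i j => ?_)
    (fun x hx ξ => ?_) (fun x hx => ?_) fun x hx => ?_
  · refine (((hUV hx).inv z.1 z.2).const_mul C₆⁻¹).mono ?_
    rw [abs_of_pos hC₆i0]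
    exact (mul_le_of_le_one_left (by linarith) hC₆i).trans (by linarith [abs_nonneg Λ'])
  · have h1 : ((G x)⁻¹).IsSymm := by
      rw [Matrix.IsSymm, Matrix.transpose_nonsing_inv, (hUV hx).isSymm.self_of_nhds.eq]
    simp only
    rw [h1.apply j i]
  · simp only [mul_assoc, ← Finset.mul_sum, hc]
    refine (mul_le_of_le_one_left ?_ hi1).trans ?_
    · exact mul_nonneg hC₆i0.le (mul_nonneg (inv_nonneg.2 he0.le)
        (Finset.sum_nonneg fun _ _ => sq_nonneg _))
    · exact mul_le_mul_of_nonneg_left (hell x hx ξ) hC₆i0.le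
  · have hUx : ∀ᶠ y in 𝓝 x, y ∈ U := hU.mem_nhds hx
    refine (hbar G E v α α₀ x c (hUV hx) ((hv x hx).of_le (by norm_num)) (hα x hx) (hα₀ x hx)
      (hUx.mono ha₀) (hUx.mono hsol) fun ξ => ?_).mono (by linarith [le_abs_self Λ'])
    rw [hc, mul_assoc]
    refine mul_le_mul_of_nonneg_left ?_ hi0.le
    rw [mul_assoc]
    exact (mul_le_of_le_one_left (mul_nonneg (inv_nonneg.2 he0.le)
        (Finset.sum_nonneg fun _ _ => sq_nonneg _)) hC₆i).trans (hell x hx ξ)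
  · refine (hcone G E v α α₀ x (hUV hx) ((hv x hx).of_le (by norm_num))
      ((hvK x hx).trans (le_abs_self K)) (fun i => (hvp x hx i).trans (le_abs_self K))
      ((hα x hx).2.1.trans (le_abs_self A)) (ha.trans_le (ha₀ x hx)) (hsol x hx)).trans
      (le_of_eq ?_)
    have h1 : trHess (fun z y => C₆⁻¹ * (G y)⁻¹ z.1 z.2) v x
        = C₆⁻¹ * trHess (fun z y => (G y)⁻¹ z.1 z.2) v x := by
      simp only [trHess, Finset.mul_sum, mul_assoc]
    rw [h1]
    field_simp

end

/-! ### The metric in a chart -/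

section

variable {n : ℕ} {H : Type*} [TopologicalSpace H]
  (I : ModelWithCorners ℝ (EuclideanSpace ℝ (Fin n)) H)
  {M : Type*} [TopologicalSpace M] [ChartedSpace H M]

/-- The interior of the domain of the inverse of the chart at `p`. -/
def chartDom (p : M) : Set (EuclideanSpace ℝ (Fin n)) := interior (extChartAt I p).target

theorem isOpen_chartDom (p : M) : IsOpen (chartDom I p) := isOpen_interior

theorem chartDom_subset (p : M) : chartDom I p ⊆ (extChartAt I p).target := interior_subset

theorem mem_chartDom {p : M} (hp : p ∈ I.interior M) : extChartAt I p p ∈ chartDom I p := by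
  have h1 : range I ∈ 𝓝 (extChartAt I p p) := mem_interior_iff_mem_nhds.1 hp
  have h2 := extChartAt_target_mem_nhdsWithin (I := I) p
  rw [nhdsWithin_eq_nhds.2 h1] at h2
  exact mem_interior_iff_mem_nhds.2 h2

/-- The differential of the inverse of the chart at `p`. -/
noncomputable def chartDeriv (p : M) (y : EuclideanSpace ℝ (Fin n)) :
    EuclideanSpace ℝ (Fin n) →L[ℝ] EuclideanSpace ℝ (Fin n) :=
  mfderiv 𝓘(ℝ, EuclideanSpace ℝ (Fin n)) I (extChartAt I p).symm y

theorem coordField_eq {p : M} {y : EuclideanSpace ℝ (Fin n)} (hy : y ∈ chartDom I p) (i : Fin n) :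
    coordField I p i y = chartDeriv I p y (EuclideanSpace.single i (1 : ℝ)) := by
  have h : range I ∈ 𝓝 y := Filter.mem_of_superset ((isOpen_chartDom I p).mem_nhds hy)
    ((chartDom_subset I p).trans (extChartAt_target_subset_range p))
  rw [coordField, mfderivWithin_of_mem_nhds h]
  rfl

section

variable [IsManifold I ∞ M]

theorem contMDiffAt_symm {p : M} {y : EuclideanSpace ℝ (Fin n)} (hy : y ∈ chartDom I p) :
    ContMDiffAt 𝓘(ℝ, EuclideanSpace ℝ (Fin n)) I ∞ (extChartAt I p).symm y :=
  (contMDiffOn_extChartAt_symm p).contMDiffAt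
    (Filter.mem_of_superset ((isOpen_chartDom I p).mem_nhds hy) (chartDom_subset I p))

theorem chartDeriv_injective {p : M} {y : EuclideanSpace ℝ (Fin n)} (hy : y ∈ chartDom I p) :
    Function.Injective (chartDeriv I p y) := by
  have h : range I ∈ 𝓝 y := Filter.mem_of_superset ((isOpen_chartDom I p).mem_nhds hy)
    ((chartDom_subset I p).trans (extChartAt_target_subset_range p))
  have h1 := (isInvertible_mfderivWithin_extChartAt_symm (I := I)
    (chartDom_subset I p hy)).injective
  rw [mfderivWithin_of_mem_nhds h] at h1
  exact h1

/-- The coordinate field is the tangent map of the inverse chart applied to a constant section, so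
the tangent map theorem gives its smoothness. -/
theorem contMDiffOn_coordField (p : M) (i : Fin n) :
    ContMDiffOn 𝓘(ℝ, EuclideanSpace ℝ (Fin n)) I.tangent ∞
      (fun y => (⟨(extChartAt I p).symm y, coordField I p i y⟩ : TangentBundle I M))
      (chartDom I p) := by
  have hU : UniqueMDiffOn 𝓘(ℝ, EuclideanSpace ℝ (Fin n)) (chartDom I p) :=
    (isOpen_chartDom I p).uniqueMDiffOn
  have h1 : ContMDiffOn 𝓘(ℝ, EuclideanSpace ℝ (Fin n)) I ∞ (extChartAt I p).symm (chartDom I p) :=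
    (contMDiffOn_extChartAt_symm p).mono (chartDom_subset I p)
  have h2 := h1.contMDiffOn_tangentMapWithin (m := ∞) (by simp) hU
  have h3 : ContMDiff 𝓘(ℝ, EuclideanSpace ℝ (Fin n)) 𝓘(ℝ, EuclideanSpace ℝ (Fin n)).tangent ∞
      (fun y => (⟨y, (EuclideanSpace.single i (1 : ℝ) : EuclideanSpace ℝ (Fin n))⟩ :
        TangentBundle 𝓘(ℝ, EuclideanSpace ℝ (Fin n)) (EuclideanSpace ℝ (Fin n)))) :=
    contMDiff_vectorSpace_iff_contDiff.2 contDiff_const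
  have h4 := h2.comp (h3.contMDiffOn (s := chartDom I p)) (fun y hy => hy)
  refine h4.congr fun y hy => ?_
  have h5 := mfderivWithin_of_mem_nhds (I := 𝓘(ℝ, EuclideanSpace ℝ (Fin n))) (I' := I)
    (f := (extChartAt I p).symm) ((isOpen_chartDom I p).mem_nhds hy)
  simp only [Function.comp_apply, tangentMapWithin]
  rw [coordField_eq I hy, h5]
  rfl

end

section

variable [RiemannianBundle (fun x : M => TangentSpace I x)]

/-- The Riemannian scalar product at `x`, as a bilinear form on the model space. -/
noncomputable def innerAt (x : M) :
    EuclideanSpace ℝ (Fin n) →ₗ[ℝ] EuclideanSpace ℝ (Fin n) →ₗ[ℝ] ℝ :=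
  LinearMap.mk₂ ℝ (fun u w => @inner ℝ (TangentSpace I x) _ u w)
    (fun u u' w => inner_add_left (𝕜 := ℝ) (E := TangentSpace I x) u u' w)
    (fun c u w => real_inner_smul_left (F := TangentSpace I x) u w c)
    (fun u w w' => inner_add_right (𝕜 := ℝ) (E := TangentSpace I x) u w w')
    (fun c u w => real_inner_smul_right (F := TangentSpace I x) u w c)

theorem innerAt_pos (x : M) {u : EuclideanSpace ℝ (Fin n)} (hu : u ≠ 0) :
    0 < innerAt I x u u :=
  real_inner_self_pos (F := TangentSpace I x).2 hu

theorem chartMetric_apply {p : M} {y : EuclideanSpace ℝ (Fin n)} (hy : y ∈ chartDom I p)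
    (i j : Fin n) : chartMetric I p y i j = innerAt I ((extChartAt I p).symm y)
      (chartDeriv I p y (EuclideanSpace.single i (1 : ℝ)))
      (chartDeriv I p y (EuclideanSpace.single j (1 : ℝ))) := by
  rw [chartMetric, Matrix.of_apply, coordField_eq I hy, coordField_eq I hy]
  rfl

theorem chartMetric_isSymm (p : M) (y : EuclideanSpace ℝ (Fin n)) :
    (chartMetric I p y).IsSymm := by
  ext i j
  exact real_inner_comm (F := TangentSpace I ((extChartAt I p).symm y)) _ _

theorem euclidean_eq_sum (u : EuclideanSpace ℝ (Fin n)) :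
    u = ∑ i, u i • (EuclideanSpace.single i (1 : ℝ) : EuclideanSpace ℝ (Fin n)) := by
  ext j
  simp [Pi.single_apply]

theorem chartMetric_posDef [IsManifold I ∞ M] {p : M} {y : EuclideanSpace ℝ (Fin n)}
    (hy : y ∈ chartDom I p) : (chartMetric I p y).PosDef := by
  refine Matrix.PosDef.of_dotProduct_mulVec_pos ?_ fun ξ hξ => ?_
  · rw [Matrix.IsHermitian, Matrix.conjTranspose_eq_transpose_of_trivial]
    exact chartMetric_isSymm I p y
  · set u : EuclideanSpace ℝ (Fin n) := WithLp.toLp 2 ξ with hu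
    have hu0 : u ≠ 0 := fun h => hξ (by
      funext i
      have := congrArg (fun w : EuclideanSpace ℝ (Fin n) => w i) h
      simpa [hu] using this)
    have h1 : chartDeriv I p y u ≠ 0 := fun h =>
      hu0 (chartDeriv_injective I hy (by rw [h, map_zero]))
    have h2 := innerAt_pos I ((extChartAt I p).symm y) h1
    have h3 : chartDeriv I p y u
        = ∑ i, ξ i • chartDeriv I p y (EuclideanSpace.single i (1 : ℝ)) := by
      conv_lhs => rw [euclidean_eq_sum u]
      rw [map_sum]
      exact Finset.sum_congr rfl fun i _ => by rw [map_smul]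
    rw [h3] at h2
    simp only [map_sum, map_smul, LinearMap.sum_apply, LinearMap.smul_apply, smul_eq_mul,
      ← chartMetric_apply I hy] at h2
    refine h2.trans_le (le_of_eq ?_)
    simp only [star_trivial, dotProduct, Matrix.mulVec]
    refine Finset.sum_congr rfl fun i _ => ?_
    simp only [Finset.mul_sum]
    refine Finset.sum_congr rfl fun j _ => ?_
    rw [(chartMetric_isSymm I p y).apply i j]
    ring

theorem smoothMat_chartMetric [IsManifold I ∞ M]
    [IsContMDiffRiemannianBundle I ∞ (EuclideanSpace ℝ (Fin n)) (fun x : M => TangentSpace I x)]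
    {p : M} {y : EuclideanSpace ℝ (Fin n)} (hy : y ∈ chartDom I p) :
    SmoothMat (chartMetric I p) y := fun i j => by
  have h := (contMDiffOn_coordField I p i).inner_bundle (contMDiffOn_coordField I p j)
  exact (contMDiffOn_iff_contDiffOn.1 h).contDiffAt ((isOpen_chartDom I p).mem_nhds hy)

end

end

/-! ### Comparison of two charts -/

section

variable {n : ℕ} {H : Type*} [TopologicalSpace H]
  (I : ModelWithCorners ℝ (EuclideanSpace ℝ (Fin n)) H)
  {M : Type*} [TopologicalSpace M] [ChartedSpace H M]

/-- The transition map from the chart at `p` to the chart at `q`. -/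
noncomputable def transMap (q p : M) (z : EuclideanSpace ℝ (Fin n)) : EuclideanSpace ℝ (Fin n) :=
  extChartAt I q ((extChartAt I p).symm z)

/-- The domain on which `transMap` is a smooth change of coordinates. -/
def transDom (q p : M) : Set (EuclideanSpace ℝ (Fin n)) :=
  chartDom I p ∩ (extChartAt I p).symm ⁻¹' ((extChartAt I q).source ∩
    extChartAt I q ⁻¹' chartDom I q)

theorem isOpen_transDom (q p : M) : IsOpen (transDom I q p) := by
  have h1 : ContinuousOn (extChartAt I p).symm (chartDom I p) :=
    (continuousOn_extChartAt_symm p).mono (chartDom_subset I p)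
  exact h1.isOpen_inter_preimage (isOpen_chartDom I p)
    ((continuousOn_extChartAt q).isOpen_inter_preimage (isOpen_extChartAt_source q)
      (isOpen_chartDom I q))

theorem symm_transMap {q p : M} {z : EuclideanSpace ℝ (Fin n)} (hz : z ∈ transDom I q p) :
    (extChartAt I q).symm (transMap I q p z) = (extChartAt I p).symm z :=
  (extChartAt I q).left_inv hz.2.1

theorem transMap_mem {q p : M} {z : EuclideanSpace ℝ (Fin n)} (hz : z ∈ transDom I q p) :
    transMap I q p z ∈ chartDom I q := hz.2.2

theorem contDiffAt_transMap [IsManifold I ∞ M] {q p : M} {z : EuclideanSpace ℝ (Fin n)}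
    (hz : z ∈ transDom I q p) : ContDiffAt ℝ ∞ (transMap I q p) z := by
  have h1 : ContMDiffAt I 𝓘(ℝ, EuclideanSpace ℝ (Fin n)) ∞ (extChartAt I q)
      ((extChartAt I p).symm z) :=
    contMDiffAt_extChartAt' (by simpa using hz.2.1)
  exact (h1.comp z (contMDiffAt_symm I hz.1)).contDiffAt

theorem chartDeriv_trans [IsManifold I ∞ M] {q p : M} {z : EuclideanSpace ℝ (Fin n)}
    (hz : z ∈ transDom I q p) (i : Fin n) :
    chartDeriv I p z (EuclideanSpace.single i (1 : ℝ))
      = ∑ a, jac (transMap I q p) z a i •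
        chartDeriv I q (transMap I q p z) (EuclideanSpace.single a (1 : ℝ)) := by
  have hθ := contDiffAt_transMap I hz
  have hθd : DifferentiableAt ℝ (transMap I q p) z := hθ.differentiableAt (by simp)
  have hev : (extChartAt I p).symm =ᶠ[𝓝 z] (extChartAt I q).symm ∘ transMap I q p :=
    Filter.mem_of_superset ((isOpen_transDom I q p).mem_nhds hz) fun y hy =>
      (symm_transMap I hy).symm
  have h1 : MDifferentiableAt 𝓘(ℝ, EuclideanSpace ℝ (Fin n)) I (extChartAt I q).symm
      (transMap I q p z) := (contMDiffAt_symm I hz.2.2).mdifferentiableAt (by simp)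
  have h2 := mfderiv_comp z h1 hθd.mdifferentiableAt
  have h3 : chartDeriv I p z
      = (chartDeriv I q (transMap I q p z)).comp (fderiv ℝ (transMap I q p) z) := by
    have h4 := hev.mfderiv_eq (I := 𝓘(ℝ, EuclideanSpace ℝ (Fin n))) (I' := I)
    rw [← mfderiv_eq_fderiv]
    exact h4.trans h2
  rw [h3, ContinuousLinearMap.comp_apply,
    euclidean_eq_sum (fderiv ℝ (transMap I q p) z (EuclideanSpace.single i (1 : ℝ))), map_sum]
  refine Finset.sum_congr rfl fun a _ => ?_
  rw [map_smul, fderiv_single_eq hθd]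

variable [IsManifold I ∞ M] [RiemannianBundle (fun x : M => TangentSpace I x)]

theorem chartMetric_trans {q p : M} {z : EuclideanSpace ℝ (Fin n)} (hz : z ∈ transDom I q p) :
    chartMetric I p z = (jac (transMap I q p) z)ᵀ * chartMetric I q (transMap I q p z)
      * jac (transMap I q p) z := by
  ext i j
  rw [chartMetric_apply I hz.1, chartDeriv_trans I hz, chartDeriv_trans I hz]
  simp only [map_sum, map_smul, LinearMap.sum_apply, LinearMap.smul_apply, smul_eq_mul,
    Matrix.mul_apply, Matrix.transpose_apply, Finset.sum_mul, Finset.mul_sum,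
    chartMetric_apply I (transMap_mem I hz), symm_transMap I hz]
  refine Finset.sum_congr rfl fun a _ => Finset.sum_congr rfl fun b _ => ?_
  ring

variable [IsContMDiffRiemannianBundle I ∞ (EuclideanSpace ℝ (Fin n))
  (fun x : M => TangentSpace I x)]

theorem isMetricChange_transMap (q p : M) :
    IsMetricChange (chartMetric I q) (chartMetric I p) (transMap I q p) (transDom I q p) where
  isOpen := isOpen_transDom I q p
  smooth_map x hx := contDiffAt_transMap I hx
  smooth_target x hx := smoothMat_chartMetric I hx.2.2
  smooth_source x hx := smoothMat_chartMetric I hx.1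
  isSymm x _ := Filter.Eventually.of_forall fun z => chartMetric_isSymm I q z
  det_ne x hx := (chartMetric_posDef I hx.2.2).det_pos.ne'
  det_jac_ne x hx := by
    have h1 := (chartMetric_posDef I hx.1).det_pos.ne'
    rw [chartMetric_trans I hx, Matrix.det_mul] at h1
    exact right_ne_zero_of_mul h1
  eq x hx := chartMetric_trans I hx

/-- `J` transforms the tensors at `p`, in the chart at `p`, from those in the chart at `q`. -/
structure IsTensorChange (q p : M) (J : Matrix (Fin n) (Fin n) ℝ) : Prop where
  det_ne : J.det ≠ 0
  metric : metricAt I p = Jᵀ * chartMetric I q (extChartAt I q p) * J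
  ricci : ricciAt I p = Jᵀ * coordRicci (chartMetric I q) (extChartAt I q p) * J
  hess : ∀ f : M → ℝ, ContDiffAt ℝ 2 (inChart I q f) (extChartAt I q p) →
    hessAt I f p = Jᵀ * coordHessian (chartMetric I q) (inChart I q f) (extChartAt I q p) * J
  diff : ∀ f : M → ℝ, ContDiffAt ℝ 2 (inChart I q f) (extChartAt I q p) →
    diffAt I f p = Jᵀ *ᵥ fun i => pd i (inChart I q f) (extChartAt I q p)

theorem coordHessian_congr (G : EuclideanSpace ℝ (Fin n) → Matrix (Fin n) (Fin n) ℝ)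
    {f g : EuclideanSpace ℝ (Fin n) → ℝ} {x : EuclideanSpace ℝ (Fin n)} (h : f =ᶠ[𝓝 x] g) :
    coordHessian G f x = coordHessian G g x := by
  ext i j
  simp only [coordHessian, Matrix.of_apply]
  rw [pd_congr (pd_congr_eventually h j) i]
  simp only [pd_congr h]

/-- The preferred chart at p may vary wildly with p. This reduces every tensor at p to the chart at
a fixed q, with J the Jacobian of the transition map; no bound for J is needed, since J drops out of
norms and eigenvalues. -/
theorem exists_isTensorChange {q p : M} (hp : p ∈ I.interior M) (hpq : p ∈ (extChartAt I q).source)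
    (hq : extChartAt I q p ∈ chartDom I q) : ∃ J, IsTensorChange I q p J := by
  have hz : extChartAt I p p ∈ transDom I q p := by
    refine ⟨mem_chartDom I hp, ?_⟩
    rw [mem_preimage, extChartAt_to_inv]
    exact ⟨hpq, hq⟩
  have hθ : transMap I q p (extChartAt I p p) = extChartAt I q p := by
    rw [transMap, extChartAt_to_inv]
  have hch := isMetricChange_transMap I q p
  have hev : ∀ f : M → ℝ, inChart I p f
      =ᶠ[𝓝 (extChartAt I p p)] fun y => inChart I q f (transMap I q p y) := fun f =>
    Filter.mem_of_superset ((isOpen_transDom I q p).mem_nhds hz) fun y hy => by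
      simp only [mem_ofPred_eq, inChart, symm_transMap I hy]
  refine ⟨jac (transMap I q p) (extChartAt I p p), hch.det_jac_ne _ hz, ?_, ?_, fun f hf => ?_,
    fun f hf => ?_⟩
  · rw [metricAt, hch.eq _ hz, hθ]
  · rw [ricciAt, hch.coordRicci_eq hz, hθ]
  · rw [hessAt, coordHessian_congr _ (hev f), hch.coordHessian_eq hz (by rwa [hθ]), hθ]
  · funext i
    rw [diffAt, pd_congr (hev f), hch.pd_comp hz (by rw [hθ]; exact hf.differentiableAt (by simp)),
      hθ]
    rfl

end

section

variable {n : ℕ}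

local notation "𝔼" => EuclideanSpace ℝ (Fin n)

/-! ### Norms in an orthonormal frame -/

theorem sum_inv_mul_eq {G F : Matrix (Fin n) (Fin n) ℝ} (h : Fᵀ * G * F = 1) (d : Fin n → ℝ) :
    ∑ i, ∑ j, G⁻¹ i j * d i * d j = ∑ k, (Fᵀ *ᵥ d) k ^ 2 := by
  have h1 := quadratic_eq G⁻¹ d
  have h2 := quadratic_conj 1 F d
  rw [mul_one, Matrix.one_mulVec, ← inv_eq_of_ortho h, ← h1, Fintype.sum_prod_type] at h2
  simp only [mul_assoc]
  rw [h2]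
  exact Finset.sum_congr rfl fun k _ => (sq _).symm

theorem trace_transpose_mul_eq (A B : Matrix (Fin n) (Fin n) ℝ) :
    (Aᵀ * B).trace = ∑ i, ∑ j, A i j * B i j := by
  simp only [Matrix.trace, Matrix.diag_apply, Matrix.mul_apply, Matrix.transpose_apply]
  exact Finset.sum_comm

theorem sum_inv_inv_mul_eq {G F : Matrix (Fin n) (Fin n) ℝ} (h : Fᵀ * G * F = 1)
    (S : Matrix (Fin n) (Fin n) ℝ) :
    ∑ i, ∑ j, ∑ a, ∑ b, G⁻¹ i a * G⁻¹ j b * S i j * S a b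
      = ∑ k, ∑ l, (Fᵀ * S * F) k l ^ 2 := by
  have h1 : ∑ k, ∑ l, (Fᵀ * S * F) k l ^ 2 = (Sᵀ * (G⁻¹ * S * (G⁻¹)ᵀ)).trace := by
    have h2 := trace_transpose_mul_eq (Fᵀ * S * F) (Fᵀ * S * F)
    simp only [← sq] at h2
    rw [← h2, inv_eq_of_ortho h, Matrix.transpose_mul, Matrix.transpose_mul, Matrix.transpose_mul,
      Matrix.transpose_transpose, mul_assoc, Matrix.trace_mul_comm]
    simp only [mul_assoc]
  rw [h1, trace_transpose_mul_eq]
  refine Finset.sum_congr rfl fun i _ => Finset.sum_congr rfl fun j _ => ?_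
  simp only [Matrix.mul_apply, Matrix.transpose_apply, Finset.mul_sum, Finset.sum_mul]
  rw [Finset.sum_comm]
  exact Finset.sum_congr rfl fun a _ => Finset.sum_congr rfl fun b _ => by ring

theorem mul_frame_inv {G F : Matrix (Fin n) (Fin n) ℝ} (h : Fᵀ * G * F = 1) : G * F * Fᵀ = 1 :=
  mul_eq_one_comm.1 (by rw [← mul_assoc]; exact h)

theorem FrameBound.abs_mul_le {G E : 𝔼 → Matrix (Fin n) (Fin n) ℝ} {Λ : ℝ} {x : 𝔼}
    (h : FrameBound G E Λ x) (i j : Fin n) : |(G x * E x) i j| ≤ n * (Λ * Λ) :=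
  abs_mul_apply_le (zero_le_one.trans h.one_le) (fun i j => (h.metric i j).2.1)
    (fun i j => (h.frame i j).2.1) i j

theorem FrameBound.abs_le_of_frame {G E : 𝔼 → Matrix (Fin n) (Fin n) ℝ} {Λ : ℝ} {x : 𝔼}
    (h : FrameBound G E Λ x) {d : Fin n → ℝ} {A : ℝ} (hd : √(∑ k, ((E x)ᵀ *ᵥ d) k ^ 2) ≤ A)
    (i : Fin n) : |d i| ≤ n * (n * (Λ * Λ) * A) := by
  have h0 : 0 ≤ Λ := zero_le_one.trans h.one_le
  have h1 : ∀ k, |((E x)ᵀ *ᵥ d) k| ≤ A := fun k => by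
    refine (Real.abs_le_sqrt ?_).trans hd
    exact Finset.single_le_sum (f := fun k => ((E x)ᵀ *ᵥ d) k ^ 2) (fun _ _ => sq_nonneg _)
      (Finset.mem_univ k)
  have h2 : d = (G x * E x) *ᵥ ((E x)ᵀ *ᵥ d) := by
    rw [Matrix.mulVec_mulVec, mul_frame_inv h.ortho.self_of_nhds, Matrix.one_mulVec]
  have h3 : d i = ∑ k, (G x * E x) i k * ((E x)ᵀ *ᵥ d) k := congrFun h2 i
  rw [h3]
  have := abs_sum_mul_le (ι := Fin n) (a := fun k => (G x * E x) i k)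
    (b := fun k => ((E x)ᵀ *ᵥ d) k) (by positivity) (fun k => h.abs_mul_le i k) h1
  simpa using this

theorem abs_apply_le_sqrt_sum (A : Matrix (Fin n) (Fin n) ℝ) (k l : Fin n) :
    |A k l| ≤ √(∑ k, ∑ l, A k l ^ 2) := by
  refine Real.abs_le_sqrt ?_
  exact (Finset.single_le_sum (f := fun l => A k l ^ 2) (fun _ _ => sq_nonneg _)
      (Finset.mem_univ l)).trans
    (Finset.single_le_sum (f := fun k => ∑ l, A k l ^ 2)
      (fun _ _ => Finset.sum_nonneg fun _ _ => sq_nonneg _) (Finset.mem_univ k))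

theorem FrameBound.abs_hessian_le_of_frame {G E : 𝔼 → Matrix (Fin n) (Fin n) ℝ} {Λ : ℝ} {x : 𝔼}
    (h : FrameBound G E Λ x) {S : Matrix (Fin n) (Fin n) ℝ} {A : ℝ}
    (hS : √(∑ k, ∑ l, ((E x)ᵀ * S * E x) k l ^ 2) ≤ A) (i j : Fin n) :
    |S i j| ≤ n * (n * (Λ * Λ) * (n * (A * (n * (Λ * Λ))))) := by
  have h0 : 0 ≤ Λ := zero_le_one.trans h.one_le
  have hE := h.ortho.self_of_nhds
  have h1 := mul_frame_inv hE
  have h1' : E x * ((E x)ᵀ * G x) = 1 := mul_eq_one_comm.1 hE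
  have hGs := h.isSymm.self_of_nhds
  have e : S = ((G x * E x)ᵀ)ᵀ * ((E x)ᵀ * S * E x) * (G x * E x)ᵀ := by
    rw [Matrix.transpose_transpose, Matrix.transpose_mul, hGs.eq]
    calc S = (G x * E x * (E x)ᵀ) * S * (E x * ((E x)ᵀ * G x)) := by
          rw [h1, h1', one_mul, mul_one]
      _ = _ := by simp only [mul_assoc]
  rw [e]
  exact abs_conj_apply_le (e := n * (Λ * Λ)) (by positivity) (fun i j => h.abs_mul_le j i)
    (fun i j => (abs_apply_le_sqrt_sum _ i j).trans hS) i j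

/-- Turns an invariant C² bound into bounds for partial derivatives. The four summands come from the
value, the gradient, the covariant Hessian and the Christoffel correction. -/
theorem FrameBound.jetBound {G E : 𝔼 → Matrix (Fin n) (Fin n) ℝ} {Λ : ℝ} {x : 𝔼}
    (h : FrameBound G E Λ x) {f : 𝔼 → ℝ} {A : ℝ} (hf : ContDiffAt ℝ 2 f x) (h0 : |f x| ≤ A)
    (h1 : √(∑ k, ((E x)ᵀ *ᵥ fun i => pd i f x) k ^ 2) ≤ A)
    (h2 : √(∑ k, ∑ l, ((E x)ᵀ * coordHessian G f x * E x) k l ^ 2) ≤ A) :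
    JetBound (A + n * (n * (Λ * Λ) * A) + n * (n * (Λ * Λ) * (n * (A * (n * (Λ * Λ)))))
      + n * (Λ * (n * (n * (Λ * Λ) * A)))) f x := by
  have hΛ : 0 ≤ Λ := zero_le_one.trans h.one_le
  have hA : 0 ≤ A := (abs_nonneg _).trans h0
  obtain ⟨B₁, hB₁⟩ : ∃ B : ℝ, B = n * (n * (Λ * Λ) * A) := ⟨_, rfl⟩
  obtain ⟨B₂, hB₂⟩ : ∃ B : ℝ, B = n * (n * (Λ * Λ) * (n * (A * (n * (Λ * Λ))))) := ⟨_, rfl⟩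
  have n1 : 0 ≤ B₁ := by rw [hB₁]; positivity
  have n2 : 0 ≤ B₂ := by rw [hB₂]; positivity
  rw [← hB₁, ← hB₂]
  have n3 : 0 ≤ n * (Λ * B₁) := by positivity
  have g1 : ∀ i, |pd i f x| ≤ B₁ := fun i => by rw [hB₁]; exact h.abs_le_of_frame h1 i
  have g2 : ∀ i j, |coordHessian G f x i j| ≤ B₂ := fun i j => by
    rw [hB₂]; exact h.abs_hessian_le_of_frame h2 i j
  refine ⟨hf, by linarith, fun i => by linarith [g1 i], fun i j => ?_⟩
  have e : pd i (pd j f) x = coordHessian G f x i j + ∑ a, christoffel G a i j x * pd a f x := by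
    rw [coordHessian, Matrix.of_apply]; ring
  have g3 := abs_sum_mul_le (ι := Fin n) (a := fun a => christoffel G a i j x)
    (b := fun a => pd a f x) hΛ (fun a => (h.chr a i j).2.1) g1
  rw [Fintype.card_fin] at g3
  rw [e]
  exact (abs_add_le _ _).trans (by linarith [g2 i j])

theorem FrameBound.sqrt_sum_hessian_le {G E : 𝔼 → Matrix (Fin n) (Fin n) ℝ} {Λ : ℝ} {x : 𝔼}
    (h : FrameBound G E Λ x) {f : 𝔼 → ℝ} {K C : ℝ} (hK : ∀ i, |pd i f x| ≤ K)
    (hC : √(∑ z : Fin n × Fin n, pd z.1 (pd z.2 f) x ^ 2) ≤ C) :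
    √(∑ k, ∑ l, ((E x)ᵀ * coordHessian G f x * E x) k l ^ 2)
      ≤ n * (n * (Λ * (n * ((C + n * (Λ * K)) * Λ)))) := by
  have hΛ : 0 ≤ Λ := zero_le_one.trans h.one_le
  have g2 : ∀ i j, |coordHessian G f x i j| ≤ C + n * (Λ * K) := fun i j => by
    have g3 := abs_sum_mul_le (ι := Fin n) (a := fun a => christoffel G a i j x)
      (b := fun a => pd a f x) hΛ (fun a => (h.chr a i j).2.1) hK
    rw [Fintype.card_fin] at g3
    have g4 : |pd i (pd j f) x| ≤ C := by
      refine (Real.abs_le_sqrt ?_).trans hC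
      exact Finset.single_le_sum (f := fun z : Fin n × Fin n => pd z.1 (pd z.2 f) x ^ 2)
        (fun _ _ => sq_nonneg _) (Finset.mem_univ (i, j))
    rw [coordHessian, Matrix.of_apply]
    exact (abs_sub _ _).trans (add_le_add g4 g3)
  have g5 := abs_conj_apply_le (A := coordHessian G f x) hΛ (fun i j => (h.frame i j).2.1) g2
  obtain ⟨B, hB⟩ : ∃ B : ℝ, B = n * (Λ * (n * ((C + n * (Λ * K)) * Λ))) := ⟨_, rfl⟩
  rw [← hB] at g5 ⊢
  rcases Nat.eq_zero_or_pos n with rfl | hn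
  · simp
  have hB0 : 0 ≤ B := (abs_nonneg _).trans (g5 ⟨0, hn⟩ ⟨0, hn⟩)
  refine Real.sqrt_le_iff.2 ⟨by positivity, ?_⟩
  have h1 : ∀ k, ∑ l, ((E x)ᵀ * coordHessian G f x * E x) k l ^ 2 ≤ n * B ^ 2 := fun k => by
    have := Finset.sum_le_card_nsmul (Finset.univ : Finset (Fin n))
      (fun l => ((E x)ᵀ * coordHessian G f x * E x) k l ^ 2) (B ^ 2) fun l _ => by
        rw [← sq_abs]; exact pow_le_pow_left₀ (abs_nonneg _) (g5 k l) 2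
    simpa using this
  have h2 := Finset.sum_le_card_nsmul (Finset.univ : Finset (Fin n)) _ _ fun k _ => h1 k
  rw [Finset.card_univ, Fintype.card_fin, nsmul_eq_mul] at h2
  exact h2.trans (le_of_eq (by ring))

end

/-! ### Invariance of norms and of 𝒲 under the change of chart -/

section

variable {n : ℕ} {H : Type*} [TopologicalSpace H]
  {I : ModelWithCorners ℝ (EuclideanSpace ℝ (Fin n)) H}
  {M : Type*} [TopologicalSpace M] [ChartedSpace H M]
  [RiemannianBundle (fun x : M => TangentSpace I x)]

namespace IsTensorChange

variable {q p : M} {J E : Matrix (Fin n) (Fin n) ℝ}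

/-- J⁻¹E is the frame E expressed in the chart at p. In it the tensors at p have the components that
E gives in the chart at q, so norms agree. -/
theorem ortho (h : IsTensorChange I q p J)
    (hE : Eᵀ * chartMetric I q (extChartAt I q p) * E = 1) :
    (J⁻¹ * E)ᵀ * metricAt I p * (J⁻¹ * E) = 1 := by
  have hu := isUnit_iff_ne_zero.2 h.det_ne
  rw [h.metric]
  calc (J⁻¹ * E)ᵀ * (Jᵀ * chartMetric I q (extChartAt I q p) * J) * (J⁻¹ * E)
      = (J * (J⁻¹ * E))ᵀ * chartMetric I q (extChartAt I q p) * (J * (J⁻¹ * E)) := by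
        rw [Matrix.transpose_mul J]; simp only [mul_assoc]
    _ = 1 := by rw [Matrix.mul_nonsing_inv_cancel_left _ _ hu, hE]

theorem conj_eq (h : IsTensorChange I q p J) (S : Matrix (Fin n) (Fin n) ℝ) :
    (J⁻¹ * E)ᵀ * (Jᵀ * S * J) * (J⁻¹ * E) = Eᵀ * S * E := by
  have hu := isUnit_iff_ne_zero.2 h.det_ne
  calc (J⁻¹ * E)ᵀ * (Jᵀ * S * J) * (J⁻¹ * E) = (J * (J⁻¹ * E))ᵀ * S * (J * (J⁻¹ * E)) := by
        rw [Matrix.transpose_mul J]; simp only [mul_assoc]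
    _ = _ := by rw [Matrix.mul_nonsing_inv_cancel_left _ _ hu]

theorem gradSq_eq (h : IsTensorChange I q p J)
    (hE : Eᵀ * chartMetric I q (extChartAt I q p) * E = 1) {f : M → ℝ}
    (hf : ContDiffAt ℝ 2 (inChart I q f) (extChartAt I q p)) :
    gradSq I f p = ∑ k, (Eᵀ *ᵥ fun i => pd i (inChart I q f) (extChartAt I q p)) k ^ 2 := by
  have h1 : J * J⁻¹ = 1 := Matrix.mul_nonsing_inv _ (isUnit_iff_ne_zero.2 h.det_ne)
  rw [gradSq, sum_inv_mul_eq (h.ortho hE), h.diff f hf, Matrix.mulVec_mulVec,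
    ← Matrix.transpose_mul, ← mul_assoc, h1, one_mul]

theorem hessNorm_eq (h : IsTensorChange I q p J)
    (hE : Eᵀ * chartMetric I q (extChartAt I q p) * E = 1) {f : M → ℝ}
    (hf : ContDiffAt ℝ 2 (inChart I q f) (extChartAt I q p)) :
    hessNorm I f p = √(∑ k, ∑ l, (Eᵀ * coordHessian (chartMetric I q) (inChart I q f)
      (extChartAt I q p) * E) k l ^ 2) := by
  rw [hessNorm, sum_inv_inv_mul_eq (h.ortho hE), h.hess f hf, h.conj_eq]

theorem calW_eq (h : IsTensorChange I q p J)
    (hE : Eᵀ * chartMetric I q (extChartAt I q p) * E = 1) {f : M → ℝ}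
    (hf : ContDiffAt ℝ 2 (inChart I q f) (extChartAt I q p)) :
    calW I f p = J⁻¹ * ((chartMetric I q (extChartAt I q p))⁻¹
      * calS (chartMetric I q) (inChart I q f) (extChartAt I q p)) * J := by
  have hu := isUnit_iff_ne_zero.2 h.det_ne
  have h1 : J * J⁻¹ = 1 := Matrix.mul_nonsing_inv _ hu
  have h2 : (Jᵀ)⁻¹ * Jᵀ = 1 := Matrix.nonsing_inv_mul _ (by
    rw [Matrix.det_transpose]; exact hu)
  have hinv : (metricAt I p)⁻¹ = J⁻¹ * (chartMetric I q (extChartAt I q p))⁻¹ * (Jᵀ)⁻¹ := by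
    rw [h.metric, Matrix.mul_inv_rev, Matrix.mul_inv_rev, mul_assoc]
  have hmul : ∀ S : Matrix (Fin n) (Fin n) ℝ, (metricAt I p)⁻¹ * (Jᵀ * S * J)
      = J⁻¹ * ((chartMetric I q (extChartAt I q p))⁻¹ * S) * J := fun S => by
    rw [hinv]
    calc J⁻¹ * (chartMetric I q (extChartAt I q p))⁻¹ * (Jᵀ)⁻¹ * (Jᵀ * S * J)
        = J⁻¹ * (chartMetric I q (extChartAt I q p))⁻¹ * ((Jᵀ)⁻¹ * Jᵀ) * S * J := by
          simp only [mul_assoc]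
      _ = _ := by rw [h2, mul_one]; simp only [mul_assoc]
  have hlap : laplacianAt I f p = ((chartMetric I q (extChartAt I q p))⁻¹
      * coordHessian (chartMetric I q) (inChart I q f) (extChartAt I q p)).trace := by
    rw [laplacianAt, h.hess f hf, hmul, Matrix.trace_mul_comm, ← mul_assoc, h1, one_mul]
  rw [calW, ← hmul, calS, h.gradSq_eq hE hf, ← sum_inv_mul_eq hE, hlap, h.hess f hf, h.ricci,
    h.diff f hf]
  congr 1
  rw [mul_sub, sub_mul, mul_add, add_mul, mul_sub, sub_mul, Matrix.mul_smul, Matrix.smul_mul,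
    Matrix.mul_smul, Matrix.smul_mul, ← h.metric]
  congr 3
  rw [Matrix.mul_vecMulVec, Matrix.vecMulVec_mul, Matrix.mulVec_transpose]

end IsTensorChange

end

/-! ### Solutions read in a fixed chart -/

section

variable {n : ℕ} {H : Type*} [TopologicalSpace H]
  (I : ModelWithCorners ℝ (EuclideanSpace ℝ (Fin n)) H)
  {M : Type*} [TopologicalSpace M] [ChartedSpace H M]
  [RiemannianBundle (fun x : M => TangentSpace I x)]

/-- The hypotheses of the second derivative estimate at an interior point. -/
structure SolutionDataAt (m : ℕ) (K A A₀ a : ℝ) (v α α₀ : M → ℝ) (p : M) : Prop where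
  interior : p ∈ I.interior M
  smooth : ContMDiffAt I 𝓘(ℝ) 4 v p
  smooth_α : ContMDiffAt I 𝓘(ℝ) 2 α p
  smooth_α₀ : ContMDiffAt I 𝓘(ℝ) 2 α₀ p
  abs_le : |v p| ≤ K
  grad_le : gradNorm I v p ≤ K
  α_abs_le : |α p| ≤ A
  α_grad_le : gradNorm I α p ≤ A
  α_hess_le : hessNorm I α p ≤ A
  α₀_abs_le : |α₀ p| ≤ A₀
  α₀_grad_le : gradNorm I α₀ p ≤ A₀
  α₀_hess_le : hessNorm I α₀ p ≤ A₀
  le_α₀ : a ≤ α₀ p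
  admissible : InGardingCone m (calW I v p)
  equation : sigma (m + 1) ((((n : ℝ) - 2) * Real.exp (-2 * v p)) • calW I v p)
    + α p * sigma m ((((n : ℝ) - 2) * Real.exp (-2 * v p)) • calW I v p) = α₀ p

theorem contDiffAt_inChart [IsManifold I ∞ M] {k : ℕ∞ω} [ENat.LEInfty k] {q p : M} {f : M → ℝ}
    (hf : ContMDiffAt I 𝓘(ℝ) k f p) (hpq : p ∈ (extChartAt I q).source)
    (hq : extChartAt I q p ∈ chartDom I q) :
    ContDiffAt ℝ k (inChart I q f) (extChartAt I q p) := by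
  have h1 : ContMDiffAt I 𝓘(ℝ) k f ((extChartAt I q).symm (extChartAt I q p)) := by
    rwa [(extChartAt I q).left_inv hpq]
  exact (h1.comp _ ((contMDiffAt_symm I hq).of_le ENat.LEInfty.out)).contDiffAt

namespace SolutionDataAt

variable {I} [IsManifold I ∞ M] {m : ℕ} {K A A₀ a : ℝ} {v α α₀ : M → ℝ} {p q : M}
  {J : Matrix (Fin n) (Fin n) ℝ}
  {E : EuclideanSpace ℝ (Fin n) → Matrix (Fin n) (Fin n) ℝ} {Λ : ℝ}

theorem abs_pd_le (h : SolutionDataAt I m K A A₀ a v α α₀ p) (hJ : IsTensorChange I q p J)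
    (hF : FrameBound (chartMetric I q) E Λ (extChartAt I q p))
    (hv : ContDiffAt ℝ 2 (inChart I q v) (extChartAt I q p)) (i : Fin n) :
    |pd i (inChart I q v) (extChartAt I q p)| ≤ n * (n * (Λ * Λ) * K) := by
  refine hF.abs_le_of_frame (d := fun i => pd i (inChart I q v) (extChartAt I q p)) ?_ i
  rw [← hJ.gradSq_eq hF.ortho.self_of_nhds hv]
  exact h.grad_le

theorem solvesAt (h : SolutionDataAt I m K A A₀ a v α α₀ p) (hJ : IsTensorChange I q p J)
    (hpq : p ∈ (extChartAt I q).source)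
    (hF : FrameBound (chartMetric I q) E Λ (extChartAt I q p))
    (hv : ContDiffAt ℝ 2 (inChart I q v) (extChartAt I q p)) :
    SolvesAt m (chartMetric I q) (inChart I q v) (inChart I q α) (inChart I q α₀)
      (extChartAt I q p) := by
  have hval : ∀ f : M → ℝ, inChart I q f (extChartAt I q p) = f p := fun f => by
    rw [inChart, (extChartAt I q).left_inv hpq]
  have hW := hJ.calW_eq hF.ortho.self_of_nhds hv
  have h1 : J * J⁻¹ = 1 := Matrix.mul_nonsing_inv _ (isUnit_iff_ne_zero.2 hJ.det_ne)
  have hs : ∀ (c : ℝ) j, sigma j (c • calW I v p)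
      = sigma j (c • ((chartMetric I q (extChartAt I q p))⁻¹
          * calS (chartMetric I q) (inChart I q v) (extChartAt I q p))) := fun c j =>
    sigma_conj h1 (by rw [hW, Matrix.mul_smul, Matrix.smul_mul]) j
  refine ⟨fun j hj1 hj2 => ?_, ?_⟩
  · have := h.admissible j hj1 hj2
    rwa [sigma_conj h1 hW] at this
  · rw [hval, hval, hval, ← hs, ← hs]
    exact h.equation

end SolutionDataAt

theorem jetBound_inChart [IsManifold I ∞ M] {p q : M} {J : Matrix (Fin n) (Fin n) ℝ}
    {E : EuclideanSpace ℝ (Fin n) → Matrix (Fin n) (Fin n) ℝ} {Λ A : ℝ} {f : M → ℝ}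
    (hJ : IsTensorChange I q p J) (hpq : p ∈ (extChartAt I q).source)
    (hF : FrameBound (chartMetric I q) E Λ (extChartAt I q p))
    (hf : ContDiffAt ℝ 2 (inChart I q f) (extChartAt I q p)) (h0 : |f p| ≤ A)
    (h1 : gradNorm I f p ≤ A) (h2 : hessNorm I f p ≤ A) :
    JetBound (A + n * (n * (Λ * Λ) * A) + n * (n * (Λ * Λ) * (n * (A * (n * (Λ * Λ)))))
      + n * (Λ * (n * (n * (Λ * Λ) * A)))) (inChart I q f) (extChartAt I q p) := by
  refine hF.jetBound hf ?_ ?_ ?_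
  · rwa [inChart, (extChartAt I q).left_inv hpq]
  · rw [← hJ.gradSq_eq hF.ortho.self_of_nhds hf]
    exact h1
  · rwa [← hJ.hessNorm_eq hF.ortho.self_of_nhds hf]

end

/-! ### The estimate near a point, and compactness -/

section

variable {n : ℕ} {H : Type*} [TopologicalSpace H]
  (I : ModelWithCorners ℝ (EuclideanSpace ℝ (Fin n)) H)
  {M : Type*} [EMetricSpace M] [ChartedSpace H M] [IsManifold I ∞ M]
  [RiemannianBundle (fun x : M => TangentSpace I x)]
  [IsContMDiffRiemannianBundle I ∞ (EuclideanSpace ℝ (Fin n)) (fun x : M => TangentSpace I x)]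

/-- The second derivative estimate near a given point. -/
theorem exists_nhds_estimate {m : ℕ} (hn : 3 ≤ n) (hm1 : 1 ≤ m) (hm : m + 1 ≤ n)
    (K A A₀ : ℝ) {a ρ : ℝ} (ha : 0 < a) (hρ : 0 < ρ) (q : M) :
    ∃ N ∈ 𝓝 q, ∃ C : ℝ, ∀ p ∈ N, ∀ v α α₀ : M → ℝ,
      (∀ x ∈ Metric.eball p (ENNReal.ofReal ρ), SolutionDataAt I m K A A₀ a v α α₀ x) →
      hessNorm I v p ≤ C := by
  -- If q is a boundary point, the ball of radius ρ about a nearby p contains q, so the hypotheses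
  -- cannot hold there.
  by_cases hq : q ∈ I.interior M
  swap
  · refine ⟨Metric.eball q (ENNReal.ofReal ρ), Metric.eball_mem_nhds q (by simpa using hρ), 0,
      fun p hp v α α₀ h => absurd (h q ?_).interior hq⟩
    rwa [Metric.mem_eball, edist_comm]
  set y₀ := extChartAt I q q with hy₀
  have hD := mem_chartDom I hq
  have hDn : chartDom I q ∈ 𝓝 y₀ := (isOpen_chartDom I q).mem_nhds hD
  have hG : ∀ᶠ y in 𝓝 y₀, SmoothMat (chartMetric I q) y :=
    Filter.mem_of_superset hDn fun y hy => smoothMat_chartMetric I hy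
  have hsymm : ∀ᶠ y in 𝓝 y₀, (chartMetric I q y).IsSymm :=
    Filter.Eventually.of_forall fun y => chartMetric_isSymm I q y
  have hpos := chartMetric_posDef I hD
  obtain ⟨V, hV, hest⟩ := exists_local_estimate hn hm1 hm hG hsymm hpos
  obtain ⟨E, Λ, hF⟩ := exists_frameBound hG hsymm hpos
  have hρ2 : (0 : ℝ≥0∞) < ENNReal.ofReal (ρ / 2) := by simpa using hρ
  have hball : (extChartAt I q).symm ⁻¹' Metric.eball q (ENNReal.ofReal (ρ / 2)) ∈ 𝓝 y₀ := by
    have h1 : ContinuousAt (extChartAt I q).symm y₀ := (contMDiffAt_symm I hD).continuousAt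
    refine h1.preimage_mem_nhds ?_
    rw [hy₀, extChartAt_to_inv]
    exact Metric.eball_mem_nhds q hρ2
  -- R depends on q, on the metric and on ρ only. The coordinate ball lies in the good part of the
  -- chart, in V, in the domain of the bounded frame and over the ball of radius ρ/2 about q.
  obtain ⟨R, hR, hRsub⟩ := Metric.mem_nhds_iff.1
    (Filter.inter_mem (Filter.inter_mem hDn hV) (Filter.inter_mem hF hball))
  obtain ⟨A', hA'⟩ : ∃ X : ℝ → ℝ, X = fun A => A + n * (n * (Λ * Λ) * A)
      + n * (n * (Λ * Λ) * (n * (A * (n * (Λ * Λ))))) + n * (Λ * (n * (n * (Λ * Λ) * A))) :=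
    ⟨_, rfl⟩
  set K' := K + |n * (n * (Λ * Λ) * K)| with hK'
  obtain ⟨C, hC⟩ := hest (R / 2) (by positivity)
    ((Metric.closedBall_subset_ball (by linarith)).trans fun y hy => (hRsub hy).1.2)
    K' (A' A) (A' A₀) a ha
  set N : Set M := (extChartAt I q).source ∩ extChartAt I q ⁻¹' Metric.ball y₀ (R / 2 / 2)
    ∩ Metric.eball q (ENNReal.ofReal (ρ / 2)) with hN
  have hNq : N ∈ 𝓝 q := by
    refine Filter.inter_mem (Filter.inter_mem (extChartAt_source_mem_nhds q) ?_)
      (Metric.eball_mem_nhds q hρ2)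
    exact (continuousAt_extChartAt q).preimage_mem_nhds (Metric.ball_mem_nhds _ (by positivity))
  refine ⟨N, hNq, n * (n * (Λ * (n * ((C + n * (Λ * K')) * Λ)))), fun p hp v α α₀ hdata => ?_⟩
  have hpt : ∀ y ∈ Metric.ball y₀ R, ∃ x : M, x ∈ (extChartAt I q).source ∧
      extChartAt I q x = y ∧ SolutionDataAt I m K A A₀ a v α α₀ x := by
    intro y hy
    have hyT := chartDom_subset I q (hRsub hy).1.1
    refine ⟨(extChartAt I q).symm y, (extChartAt I q).map_target hyT,
      (extChartAt I q).right_inv hyT, hdata _ ?_⟩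
    have h1 : edist ((extChartAt I q).symm y) q < ENNReal.ofReal (ρ / 2) := (hRsub hy).2.2
    have h2 : edist q p < ENNReal.ofReal (ρ / 2) := by rw [edist_comm]; exact hp.2
    -- Both points are within ρ/2 of q, so the whole coordinate ball lies over the ρ-ball about p,
    -- where the data are given.
    refine (edist_triangle _ q _).trans_lt ((ENNReal.add_lt_add h1 h2).trans_le (le_of_eq ?_))
    rw [← ENNReal.ofReal_add (by positivity) (by positivity), add_halves]
  have hloc : ∀ y ∈ Metric.ball y₀ R, ContDiffAt ℝ 4 (inChart I q v) y ∧
      |inChart I q v y| ≤ K' ∧ (∀ i, |pd i (inChart I q v) y| ≤ K') ∧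
      JetBound (A' A) (inChart I q α) y ∧ JetBound (A' A₀) (inChart I q α₀) y ∧
      a ≤ inChart I q α₀ y ∧
      SolvesAt m (chartMetric I q) (inChart I q v) (inChart I q α) (inChart I q α₀) y := by
    intro y hy
    obtain ⟨x, hxq, rfl, hx⟩ := hpt y hy
    have hxD := (hRsub hy).1.1
    have hxF : FrameBound (chartMetric I q) E Λ (extChartAt I q x) := (hRsub hy).2.1
    obtain ⟨J, hJ⟩ := exists_isTensorChange I hx.interior hxq hxD
    have hv4 := contDiffAt_inChart I hx.smooth hxq hxD
    have hv2 : ContDiffAt ℝ 2 (inChart I q v) (extChartAt I q x) := hv4.of_le (by norm_num)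
    have hα := contDiffAt_inChart I hx.smooth_α hxq hxD
    have hα₀ := contDiffAt_inChart I hx.smooth_α₀ hxq hxD
    have hval : ∀ f : M → ℝ, inChart I q f (extChartAt I q x) = f x := fun f => by
      rw [inChart, (extChartAt I q).left_inv hxq]
    have hK0 : 0 ≤ K := (abs_nonneg _).trans hx.abs_le
    refine ⟨hv4, ?_, fun i => ?_, ?_, ?_, ?_, hx.solvesAt hJ hxq hxF hv2⟩
    · rw [hval, hK']
      linarith [hx.abs_le, abs_nonneg (n * (n * (Λ * Λ) * K))]
    · have h1 := hx.abs_pd_le hJ hxF hv2 i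
      have h2 := le_abs_self (n * (n * (Λ * Λ) * K))
      rw [hK']
      linarith
    · rw [hA']
      exact jetBound_inChart I hJ hxq hxF hα hx.α_abs_le hx.α_grad_le hx.α_hess_le
    · rw [hA']
      exact jetBound_inChart I hJ hxq hxF hα₀ hx.α₀_abs_le hx.α₀_grad_le hx.α₀_hess_le
    · rw [hval]; exact hx.le_α₀
  have hpB : extChartAt I q p ∈ Metric.ball y₀ (R / 2 / 2) := hp.1.2
  have hpR : extChartAt I q p ∈ Metric.ball y₀ R := Metric.ball_subset_ball (by linarith) hpB
  have hpF : FrameBound (chartMetric I q) E Λ (extChartAt I q p) := (hRsub hpR).2.1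
  have hpd := hdata p (Metric.mem_eball_self (by simpa using hρ))
  obtain ⟨J, hJ⟩ := exists_isTensorChange I hpd.interior hp.1.1 (hRsub hpR).1.1
  have hfin := hC (inChart I q v) (inChart I q α) (inChart I q α₀) (Metric.ball y₀ R)
    Metric.isOpen_ball (Metric.closedBall_subset_ball (by linarith)) (fun y hy => (hRsub hy).1.2)
    (fun y hy => (hloc y hy).1) (fun y hy => (hloc y hy).2.1) (fun y hy => (hloc y hy).2.2.1)
    (fun y hy => (hloc y hy).2.2.2.1) (fun y hy => (hloc y hy).2.2.2.2.1)
    (fun y hy => (hloc y hy).2.2.2.2.2.1) (fun y hy => (hloc y hy).2.2.2.2.2.2) _ hpB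
  rw [hJ.hessNorm_eq hpF.ortho.self_of_nhds ((hloc _ hpR).1.of_le (by norm_num))]
  exact hpF.sqrt_sum_hessian_le (hloc _ hpR).2.2.1 hfin

/-- The second derivative estimate, uniformly on a compact manifold. -/
theorem exists_uniform_estimate [CompactSpace M] {m : ℕ} (hn : 3 ≤ n) (hm1 : 1 ≤ m)
    (hm : m + 1 ≤ n) (K A A₀ : ℝ) {a ρ : ℝ} (ha : 0 < a) (hρ : 0 < ρ) :
    ∃ C : ℝ, ∀ (p : M) (v α α₀ : M → ℝ),
      (∀ x ∈ Metric.eball p (ENNReal.ofReal ρ), SolutionDataAt I m K A A₀ a v α α₀ x) →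
      hessNorm I v p ≤ C := by
  have h := isCompact_univ.induction_on (X := M) (p := fun s => ∃ C : ℝ, ∀ p ∈ s,
    ∀ v α α₀ : M → ℝ, (∀ x ∈ Metric.eball p (ENNReal.ofReal ρ),
      SolutionDataAt I m K A A₀ a v α α₀ x) → hessNorm I v p ≤ C)
    ⟨0, fun p hp => absurd hp (notMem_empty p)⟩
    (fun s t hst ⟨C, hC⟩ => ⟨C, fun p hp => hC p (hst hp)⟩)
    (fun s t ⟨C, hC⟩ ⟨C', hC'⟩ => ⟨max C C', fun p hp v α α₀ hd => hp.elim
      (fun hps => (hC p hps v α α₀ hd).trans (le_max_left _ _))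
      (fun hpt => (hC' p hpt v α α₀ hd).trans (le_max_right _ _))⟩)
    (fun q _ => by
      obtain ⟨N, hN, C, hC⟩ := exists_nhds_estimate I hn hm1 hm K A A₀ ha hρ q
      exact ⟨N, mem_nhdsWithin_of_mem_nhds hN, C, hC⟩)
  obtain ⟨C, hC⟩ := h
  exact ⟨C, fun p => hC p (mem_univ p)⟩

end

/-! ### Pointwise bounds from the norms -/

section

variable {n : ℕ} {H : Type*} [TopologicalSpace H]
  {I : ModelWithCorners ℝ (EuclideanSpace ℝ (Fin n)) H}
  {M : Type*} [TopologicalSpace M] [ChartedSpace H M]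
  [RiemannianBundle (fun x : M => TangentSpace I x)]

/-- K is not assumed nonnegative and `ENNReal.ofReal` truncates at 0, hence the absolute value. -/
theorem le_abs_of_ofReal_le {x K : ℝ} (h : ENNReal.ofReal x ≤ ENNReal.ofReal K) : x ≤ |K| :=
  (ENNReal.ofReal_le_ofReal_iff (abs_nonneg K)).1
    (h.trans (ENNReal.ofReal_le_ofReal (le_abs_self K)))

theorem le_of_normC1_le {s : Set M} {f : M → ℝ} {K : ℝ}
    (h : normC1 I s f ≤ ENNReal.ofReal K) {p : M} (hp : p ∈ s) :
    |f p| ≤ |K| ∧ gradNorm I f p ≤ |K| := by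
  have h1 : ENNReal.ofReal |f p| ≤ ⨆ p ∈ s, ENNReal.ofReal |f p| :=
    le_iSup₂ (f := fun p (_ : p ∈ s) => ENNReal.ofReal |f p|) p hp
  have h2 : ENNReal.ofReal (gradNorm I f p) ≤ ⨆ p ∈ s, ENNReal.ofReal (gradNorm I f p) :=
    le_iSup₂ (f := fun p (_ : p ∈ s) => ENNReal.ofReal (gradNorm I f p)) p hp
  exact ⟨le_abs_of_ofReal_le (h1.trans (le_self_add.trans h)),
    le_abs_of_ofReal_le (h2.trans (le_add_self.trans h))⟩

theorem le_of_normC2_le {s : Set M} {f : M → ℝ} {K : ℝ}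
    (h : normC2 I s f ≤ ENNReal.ofReal K) {p : M} (hp : p ∈ s) :
    |f p| ≤ |K| ∧ gradNorm I f p ≤ |K| ∧ hessNorm I f p ≤ |K| := by
  have h1 := le_of_normC1_le (I := I) (le_self_add.trans h) hp
  have h2 : ENNReal.ofReal (hessNorm I f p) ≤ ⨆ p ∈ s, ENNReal.ofReal (hessNorm I f p) :=
    le_iSup₂ (f := fun p (_ : p ∈ s) => ENNReal.ofReal (hessNorm I f p)) p hp
  exact ⟨h1.1, h1.2, le_abs_of_ofReal_le (h2.trans (le_add_self.trans h))⟩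

end

end KRicci

theorem theorem4p3 {n k : ℕ} (hn : 3 ≤ n) (hk : 2 ≤ k) (hkn : k ≤ n)
    {H : Type*} [TopologicalSpace H] (I : ModelWithCorners ℝ (EuclideanSpace ℝ (Fin n)) H)
    {M : Type*} [EMetricSpace M] [ChartedSpace H M] [IsManifold I ∞ M] [CompactSpace M]
    [RiemannianBundle (fun x : M => TangentSpace I x)]
    [IsContMDiffRiemannianBundle I ∞ (EuclideanSpace ℝ (Fin n)) (fun x : M => TangentSpace I x)]
    [IsRiemannianManifold I M]
    (r₁ K A A₀ a : ℝ) (hr₁ : 0 < r₁) (ha : 0 < a) :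
    ∃ C : ℝ, ∀ (x₀ : M) (r : ℝ) (v α α₀ : M → ℝ), r₁ ≤ r →
      Metric.eball x₀ (ENNReal.ofReal r) ⊆ I.interior M →
      ContMDiffOn I 𝓘(ℝ) 4 v (Metric.eball x₀ (ENNReal.ofReal r)) →
      ContMDiffOn I 𝓘(ℝ) 2 α (Metric.eball x₀ (ENNReal.ofReal r)) →
      ContMDiffOn I 𝓘(ℝ) 2 α₀ (Metric.eball x₀ (ENNReal.ofReal r)) →
      KRicci.normC1 I (Metric.eball x₀ (ENNReal.ofReal r)) v ≤ ENNReal.ofReal K →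
      KRicci.normC2 I (Metric.eball x₀ (ENNReal.ofReal r)) α ≤ ENNReal.ofReal A →
      KRicci.normC2 I (Metric.eball x₀ (ENNReal.ofReal r)) α₀ ≤ ENNReal.ofReal A₀ →
      (∀ p ∈ Metric.eball x₀ (ENNReal.ofReal r), a ≤ α₀ p) →
      KRicci.IsAdmissibleOn I (k - 1) (Metric.eball x₀ (ENNReal.ofReal r)) v →
      KRicci.IsSolutionOn I k α α₀ (Metric.eball x₀ (ENNReal.ofReal r)) v →
      ∀ p ∈ Metric.eball x₀ (ENNReal.ofReal (r / 2)), KRicci.hessNorm I v p ≤ C := by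
  obtain ⟨m, rfl⟩ : ∃ m, k = m + 1 := ⟨k - 1, by omega⟩
  -- With ρ = r₁/2 ≤ r/2, the ρ-ball about any point of B_{r/2}(x₀) stays in B_r(x₀), so C does not
  -- depend on r or x₀.
  obtain ⟨C, hC⟩ := KRicci.exists_uniform_estimate (M := M) I hn (m := m) (by omega) hkn
    |K| |A| |A₀| ha (half_pos hr₁)
  refine ⟨C, fun x₀ r v α α₀ hr hint hv hα hα₀ nv nα nα₀ hle hadm hsol p hp =>
    hC p v α α₀ fun x hx => ?_⟩
  have hxB : x ∈ Metric.eball x₀ (ENNReal.ofReal r) := by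
    have h1 : edist x p < ENNReal.ofReal (r / 2) :=
      (Metric.mem_eball.1 hx).trans_le (ENNReal.ofReal_le_ofReal (by linarith))
    refine (edist_triangle x p x₀).trans_lt ((ENNReal.add_lt_add h1 hp).trans_le (le_of_eq ?_))
    rw [← ENNReal.ofReal_add (by linarith) (by linarith), add_halves]
  have hN := Metric.isOpen_eball.mem_nhds hxB
  obtain ⟨v1, v2⟩ := KRicci.le_of_normC1_le nv hxB
  obtain ⟨a1, a2, a3⟩ := KRicci.le_of_normC2_le nα hxB
  obtain ⟨b1, b2, b3⟩ := KRicci.le_of_normC2_le nα₀ hxB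
  exact
    { interior := hint hxB
      smooth := hv.contMDiffAt hN
      smooth_α := hα.contMDiffAt hN
      smooth_α₀ := hα₀.contMDiffAt hN
      abs_le := v1
      grad_le := v2
      α_abs_le := a1
      α_grad_le := a2
      α_hess_le := a3
      α₀_abs_le := b1
      α₀_grad_le := b2
      α₀_hess_le := b3
      le_α₀ := hle x hxB
      admissible := hadm x hxB
      equation := hsol x hxB }
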